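/- **Setting.** Let $\nu\ge 2$, let $G$ be an abelian group with a character $\sigma:G\to\mathbb C^\times$, write $\tilde\alpha=\sigma(\alpha)$, and let $|\sigma|$ be the order of the group $\sigma(G)$. *Lie algebras.* Let $\mathcal R_\sigma$ be the complex algebra with basis $t^me^\alpha$ ($m\in\mathbb Z,\alpha\in G$) and product $t^me^\alpha\cdot t^ne^\beta=\tilde\alpha^{\,n}t^{m+n}e^{\alpha+\beta}$, with the linear anti-involution $\overline{t^me^\alpha}=(-\tilde\alpha)^{-m}t^me^{-\alpha}$. On $\widehat{\mathfrak{gl}}_\nu(\mathcal R_\sigma)=M_\nu(\mathcal R_\sigma)\oplus\mathbb Cc$ take $c$ central and $$[E_{ij}t^me^\alpha,E_{kl}t^ne^\beta]=\delta_{jk}\tilde\alpha^nE_{il}t^{m+n}e^{\alpha+\beta}-\delta_{il}\tilde\beta^mE_{kj}t^{m+n}e^{\alpha+\beta}+m\,\delta_{il}\delta_{jk}\delta_{m+n,0}\delta_{\tilde\alpha\tilde\beta,1}\tilde\alpha^n c .$$ Let $\widehat{\mathfrak u}_\nu(\mathcal R_\sigma,\bar{\ })=\{X\in M_\nu(\mathcal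 R_\sigma):\overline X^{\,t}=-X\}\oplus\mathbb Cc$, put $e_{ij}(m,\alpha)=E_{ij}t^me^\alpha-E_{ji}\overline{t^me^\alpha}$, and let $\widehat{\mathfrak{eu}}_\nu(\mathcal R_\sigma,\bar{\ })$ be the subalgebra of $\widehat{\mathfrak u}_\nu(\mathcal R_\sigma,\bar{\ })$ generated by the $e_{ij}(m,\alpha)$ with $i\ne j$. *Fock space.* Let $\Gamma=\bigoplus_{i=1}^\nu\mathbb Z\epsilon_i$ with $(\epsilon_i,\epsilon_j)=\delta_{ij}$, let $\bar\Gamma=\Gamma/2\Gamma$, and let $\mathbb C[\bar\Gamma]$ have basis $e^{\bar\alpha}$ and product $e^{\bar\alpha}e^{\bar\beta}=\varepsilon(\alpha,\beta)e^{\overline{\alpha+\beta}}$, where $\varepsilon$ is bimultiplicative with $\varepsilon(\epsilon_i,\epsilon_j)=1$ if $i\le j$ and $-1$ if $i>j$. Let $\mathcal H^-$ have basis $\epsilon_i(n)$ ($1\le i\le\nu$, $n<0$ odd), and let $M=\mathbb C[\bar\Gamma]\otimes S(\mathcal H^-)$, on which $\epsilon_i(n)$ acts, for $n$ odd, by multiplication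 if $n<0$ and by $\frac n2\,\partial/\partial\epsilon_i(-n)$ if $n>0$; extend to $\alpha(n)$, $\alpha\in\Gamma$, by linearity. With $E_\pm(\alpha,z)=\exp\big(-2\sum_{n\in\pm\{1,3,5,\dots\}}\frac{\alpha(n)}nz^{-n}\big)$ set, for $a\in\mathbb C^\times$, $Y_{ij}(a,z)=E_-(\epsilon_i,z)E_-(-\epsilon_j,az)E_+(\epsilon_i,z)E_+(-\epsilon_j,az)$ and $$X_{ij}(a,z)=\sum_{n\in\mathbb Z}x_{ij}(a,n)z^{-n}=\begin{cases}\varepsilon(\epsilon_i,\epsilon_j)\,e^{\overline{\epsilon_i-\epsilon_j}}\,Y_{ij}(a,z),& i\ne j,\\ 4\sum_{n\text{ odd}}\epsilon_i(n)z^{-n},& i=j,\ a=1,\\ \frac{1+a}{1-a}\big(Y_{ii}(a,z)-1\big),& i=j,\ a\neq1.\end{cases}$$ *Components.* For $\rho_1,\dots,\rho_\nu\in\{\pm1\}$ let $w(\rho_1,\dots,\rho_\nu)=w_1(\rho_1)\cdots w_\nu(\rho_\nu)\in\mathbb C[\bar\Gamma]$, where $w_j(\rho)=1+\sqrt{-1}\,\rho\,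 e^{\bar\epsilon_j}$ for $j$ odd and $w_j(\rho)=1+\rho\, e^{\bar\epsilon_j}$ for $j$ even. For $d=\lfloor\nu/2\rfloor$ and $\gamma\in\{\pm1\}^{d+1}$ let $V_\nu(\gamma)$ be the span of the $w(\rho_1,\dots,\rho_\nu)$ with $\rho_1=\gamma_1$, with $\rho_{2j}\rho_{2j+1}=\gamma_{j+1}$ for all $j\ge1$ with $2j+1\le\nu$, and, if $\nu$ is even, with $\rho_\nu=\gamma_{d+1}$. **Theorem 4.4.** There is a representation of $\widehat{\mathfrak u}_\nu(\mathcal R_\sigma,\bar{\ })$ on $M$ such that $c$ acts as $\frac12$ and $2e_{ij}(m,\alpha)$ acts as $x_{ij}(\tilde\alpha,m)$ if $i\ne j$ or $\tilde\alpha=1$, and as $x_{ii}(\tilde\alpha,m)+\delta_{m,0}\frac{1+\tilde\alpha}{1-\tilde\alpha}$ if $i=j$ and $\tilde\alpha\ne1$. For this representation and every $\gamma$, the subspace $V_\nu(\gamma)\otimes S(\mathcal H^-)$ is a $\widehat{\mathfrak u}_\nu(\mathcal R_\sigma,\bar{\ })$-submodule of $M$, and: (1) If $|\sigma|$ is infinite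 or even, then $V_\nu(\gamma)\otimes S(\mathcal H^-)$ is irreducible as an $\widehat{\mathfrak{eu}}_\nu(\mathcal R_\sigma,\bar{\ })$-module. (2) If $|\sigma|=N$ is finite and odd, let $\mathcal H_0^-$ be the subspace of $\mathcal H^-$ spanned by the $\epsilon_i(m)-\epsilon_j(m)$ and the $\epsilon_i(n)$ with $1\le i\ne j\le\nu$, $m,n$ negative odd and $n\notin N\mathbb Z$. Then $V_\nu(\gamma)\otimes S(\mathcal H_0^-)$ is an irreducible $\widehat{\mathfrak{eu}}_\nu(\mathcal R_\sigma,\bar{\ })$-submodule of $V_\nu(\gamma)\otimes S(\mathcal H^-)$. Moreover, $V_\nu(\gamma)\otimes S(\mathcal H^-)$ is completely reducible (a direct sum of irreducible submodules) as an $\widehat{\mathfrak{eu}}_\nu(\mathcal R_\sigma,\bar{\ })$-module. -/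

import Mathlib

open scoped TensorProduct

-- associative algebras, in particular `Module.End`, carry the commutator bracket
attribute [local instance 100] LieRing.ofAssociativeRing

noncomputable section

namespace VertexUnitary

/-! ## Twisted group algebras -/

/-- A normalized complex valued two-cocycle on an abelian group. -/
structure TwoCocycle (A : Type*) [AddCommGroup A] where
  toFun : A → A → ℂ
  zero_left : ∀ b, toFun 0 b = 1
  zero_right : ∀ a, toFun a 0 = 1
  cocycle : ∀ a b d, toFun a b * toFun (a + b) d = toFun b d * toFun a (b + d)

/-- The twisted group algebra: the complex vector space with basis `e^a`, `a ∈ A`, and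
multiplication `e^a e^b = c(a, b) e^(a + b)`. -/
def TwistedAlgebra {A : Type*} [AddCommGroup A] (_c : TwoCocycle A) : Type _ := A →₀ ℂ

namespace TwistedAlgebra

variable {A : Type*} [AddCommGroup A] {c : TwoCocycle A}

instance : AddCommGroup (TwistedAlgebra c) := inferInstanceAs (AddCommGroup (A →₀ ℂ))
instance : Module ℂ (TwistedAlgebra c) := inferInstanceAs (Module ℂ (A →₀ ℂ))

/-- The basis element `e^a`. -/
def e (c : TwoCocycle A) (a : A) : TwistedAlgebra c := Finsupp.single a (1 : ℂ)

/-- The linear map on the twisted group algebra with prescribed values on the basis `e^a`. -/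
def lift (c : TwoCocycle A) {W : Type*} [AddCommGroup W] [Module ℂ W] (f : A → W) :
    TwistedAlgebra c →ₗ[ℂ] W :=
  Finsupp.lsum ℂ (fun a => LinearMap.toSpanSingleton ℂ W (f a))

@[simp] theorem lift_e {W : Type*} [AddCommGroup W] [Module ℂ W] (f : A → W) (a : A) :
    lift c f (e c a) = f a := by
  simp only [lift, e]
  erw [Finsupp.lsum_single]
  simp

theorem hom_ext {W : Type*} [AddCommGroup W] [Module ℂ W] {f g : TwistedAlgebra c →ₗ[ℂ] W}
    (h : ∀ a, f (e c a) = g (e c a)) : f = g := by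
  refine Finsupp.lhom_ext' (M := ℂ) (R := ℂ) (φ := f) (ψ := g) fun a => ?_
  ext
  exact h a

theorem induction_on {P : TwistedAlgebra c → Prop} (x : TwistedAlgebra c)
    (h0 : P 0) (hadd : ∀ x y, P x → P y → P (x + y)) (he : ∀ (r : ℂ) a, P (r • e c a)) : P x := by
  refine Finsupp.induction_linear (motive := P) x h0 hadd fun a r => ?_
  have h : (Finsupp.single a r : A →₀ ℂ) = r • Finsupp.single a (1 : ℂ) := by simp
  rw [h]
  exact he r a

/-- The multiplication as a bilinear map. -/
def mulHom (c : TwoCocycle A) :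
    TwistedAlgebra c →ₗ[ℂ] TwistedAlgebra c →ₗ[ℂ] TwistedAlgebra c :=
  lift c fun a => lift c fun b => c.toFun a b • e c (a + b)

instance : Mul (TwistedAlgebra c) := ⟨fun x y => mulHom c x y⟩
instance : One (TwistedAlgebra c) := ⟨e c 0⟩

theorem mul_def (x y : TwistedAlgebra c) : x * y = mulHom c x y := rfl
theorem one_def : (1 : TwistedAlgebra c) = e c 0 := rfl

theorem e_mul_e (a b : A) : e c a * e c b = c.toFun a b • e c (a + b) := by
  simp [mul_def, mulHom]

theorem smul_mul (r : ℂ) (x y : TwistedAlgebra c) : (r • x) * y = r • (x * y) := by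
  simp [mul_def]

theorem mul_smul' (r : ℂ) (x y : TwistedAlgebra c) : x * (r • y) = r • (x * y) := by
  simp [mul_def]

theorem add_mul' (x y z : TwistedAlgebra c) : (x + y) * z = x * z + y * z := by
  simp [mul_def]

theorem mul_add' (x y z : TwistedAlgebra c) : x * (y + z) = x * y + x * z := by
  simp [mul_def]

theorem assoc_aux (x y z : TwistedAlgebra c) : x * y * z = x * (y * z) := by
  induction x using induction_on with
  | h0 => simp [mul_def]
  | hadd x x' h h' => simp only [add_mul', h, h']
  | he r a =>
    induction y using induction_on with
    | h0 => simp [mul_def]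
    | hadd y y' h h' => simp only [add_mul', mul_add', h, h']
    | he s b =>
      induction z using induction_on with
      | h0 => simp [mul_def]
      | hadd z z' h h' => simp only [mul_add', h, h']
      | he t d =>
        simp only [smul_mul, mul_smul', e_mul_e, smul_smul, add_assoc]
        congr 1
        linear_combination r * s * t * c.cocycle a b d

instance : Ring (TwistedAlgebra c) :=
  { (inferInstance : AddCommGroup (TwistedAlgebra c)),
    (inferInstance : Mul (TwistedAlgebra c)),
    (inferInstance : One (TwistedAlgebra c)) with
    left_distrib := mul_add'
    right_distrib := add_mul'
    zero_mul := fun x => by simp [mul_def]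
    mul_zero := fun x => by simp [mul_def]
    mul_assoc := assoc_aux
    one_mul := fun x => by
      have h : mulHom c (e c 0) = LinearMap.id :=
        hom_ext fun a => by simp [mulHom, c.zero_left]
      simpa [mul_def, one_def] using LinearMap.congr_fun h x
    mul_one := fun x => by
      have h : (mulHom c).flip (e c 0) = LinearMap.id :=
        hom_ext fun a => by simp [mulHom, c.zero_right]
      simpa [mul_def, one_def] using LinearMap.congr_fun h x }

instance : Algebra ℂ (TwistedAlgebra c) := Algebra.ofModule smul_mul mul_smul'

end TwistedAlgebra

open TwistedAlgebra

/-! ## The skew Laurent polynomial ring and its anti-involution -/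

section Skew

variable {G : Type*} [AddCommGroup G] (σ : AddChar G ℂ)

theorem char_ne_zero (α : G) : σ α ≠ 0 := by
  intro h
  have h1 : σ (α + -α) = 1 := by simp
  rw [AddChar.map_add_eq_mul, h, zero_mul] at h1
  exact zero_ne_one h1

theorem char_neg (α : G) : σ (-α) = (σ α)⁻¹ := by
  have h1 : σ (-α + α) = 1 := by simp
  rw [AddChar.map_add_eq_mul] at h1
  exact eq_inv_of_mul_eq_one_left h1

/-- The cocycle `((m, α), (n, β)) ↦ σ(α)^n` on `ℤ × G`. -/
def skewCocycle : TwoCocycle (ℤ × G) where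
  toFun x y := σ x.2 ^ y.1
  zero_left := by simp
  zero_right := by simp
  cocycle a b d := by
    simp only [Prod.snd_add, Prod.fst_add, AddChar.map_add_eq_mul,
      zpow_add₀ (char_ne_zero σ a.2), mul_zpow]
    ring

/-- The skew Laurent polynomial ring `R_σ` attached to a character `σ` of `G`: the complex
algebra with basis `t^m e^α` and `(t^m e^α) (t^n e^β) = σ(α)^n t^(m+n) e^(α+β)`,
that is, `e^α t^n = σ(α)^n t^n e^α`. -/
abbrev SkewLaurent := TwistedAlgebra (skewCocycle σ)

/-- The monomial `t^m e^α`. -/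
def mono (m : ℤ) (α : G) : SkewLaurent σ := e (skewCocycle σ) (m, α)

/-- The linear anti-involution with `t ↦ -t`, `e^α ↦ e^(-α)`, so that
`t^m e^α ↦ (-σ(α))^(-m) t^m e^(-α)`. -/
def bar : SkewLaurent σ →ₗ[ℂ] SkewLaurent σ :=
  lift (skewCocycle σ) fun x => (-σ x.2) ^ (-x.1) • mono σ x.1 (-x.2)

@[simp] theorem bar_mono (m : ℤ) (α : G) :
    bar σ (mono σ m α) = (-σ α) ^ (-m) • mono σ m (-α) := by
  simp [bar, mono]

theorem mono_mul_mono (m n : ℤ) (α β : G) :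
    mono σ m α * mono σ n β = σ α ^ n • mono σ (m + n) (α + β) := by
  rw [mono, mono, e_mul_e]
  rfl

theorem bar_bar (x : SkewLaurent σ) : bar σ (bar σ x) = x := by
  induction x using induction_on with
  | h0 => simp
  | hadd x y hx hy => simp [hx, hy]
  | he r a =>
    change bar σ (bar σ (r • mono σ a.1 a.2)) = r • mono σ a.1 a.2
    have h : (-σ a.2) ^ a.1 ≠ 0 := zpow_ne_zero _ (neg_ne_zero.2 (char_ne_zero σ a.2))
    have h' : (-(σ a.2)⁻¹) ^ a.1 = ((-σ a.2) ^ a.1)⁻¹ := by rw [← inv_zpow, inv_neg]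
    simp [char_neg, smul_smul, h', h]

theorem bar_mul (x y : SkewLaurent σ) : bar σ (x * y) = bar σ y * bar σ x := by
  induction x using induction_on with
  | h0 => simp
  | hadd x x' h h' => simp [add_mul, mul_add, h, h']
  | he r a =>
    induction y using induction_on with
    | h0 => simp
    | hadd y y' h h' => simp only [mul_add, map_add, add_mul, h, h']
    | he s b =>
      obtain ⟨m, α⟩ := a
      obtain ⟨n, β⟩ := b
      change bar σ ((r • mono σ m α) * (s • mono σ n β)) =
        bar σ (s • mono σ n β) * bar σ (r • mono σ m α)
      have hα := char_ne_zero σ α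
      have hβ := char_ne_zero σ β
      simp only [map_smul, bar_mono, smul_mul_smul_comm, mono_mul_mono, smul_smul, char_neg,
        AddChar.map_add_eq_mul, neg_add_rev, add_comm n m]
      rw [add_comm (-β) (-α)]
      congr 1
      simp only [neg_eq_neg_one_mul (σ _), neg_eq_neg_one_mul (σ _ * σ _), mul_zpow,
        zpow_add₀ hα, zpow_add₀ hβ, zpow_neg, inv_zpow,
        zpow_add₀ (show (-1 : ℂ) ≠ 0 by norm_num)]
      field_simp

/-! ## The central extension of the general linear Lie algebra -/

open Classical in
/-- The bilinear form on `R_σ` whose value on `(t^m e^α, t^n e^β)` is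
`m σ(α)^n` if `m + n = 0` and `σ(α) σ(β) = 1`, and `0` otherwise. -/
def cocycleForm : SkewLaurent σ →ₗ[ℂ] SkewLaurent σ →ₗ[ℂ] ℂ :=
  lift (skewCocycle σ) fun x => lift (skewCocycle σ) fun y =>
    if x.1 + y.1 = 0 ∧ σ x.2 * σ y.2 = 1 then (x.1 : ℂ) * σ x.2 ^ y.1 else 0

open Classical in
theorem cocycleForm_mono (m n : ℤ) (α β : G) : cocycleForm σ (mono σ m α) (mono σ n β) =
    if m + n = 0 ∧ σ α * σ β = 1 then (m : ℂ) * σ α ^ n else 0 := by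
  simp [cocycleForm, mono]

/-- The degree derivation `t^m e^α ↦ m t^m e^α`. -/
def degDer : SkewLaurent σ →ₗ[ℂ] SkewLaurent σ :=
  lift (skewCocycle σ) fun x => (x.1 : ℂ) • mono σ x.1 x.2

theorem degDer_mono (m : ℤ) (α : G) : degDer σ (mono σ m α) = (m : ℂ) • mono σ m α := by
  simp [degDer, mono]

open Classical in
/-- The trace form `t^m e^α ↦ δ_{m,0} δ_{σ(α),1}`. -/
def trForm : SkewLaurent σ →ₗ[ℂ] ℂ :=
  lift (skewCocycle σ) fun x => if x.1 = 0 ∧ σ x.2 = 1 then 1 else 0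

open Classical in
theorem trForm_mono (m : ℤ) (α : G) :
    trForm σ (mono σ m α) = if m = 0 ∧ σ α = 1 then 1 else 0 := by
  simp [trForm, mono]

/-- A property of pairs that is linear in both holds if it holds on monomials. -/
theorem skew_hom_ext₂ {W : Type*} [AddCommGroup W] [Module ℂ W]
    {f g : SkewLaurent σ →ₗ[ℂ] SkewLaurent σ →ₗ[ℂ] W}
    (h : ∀ m α n β, f (mono σ m α) (mono σ n β) = g (mono σ m α) (mono σ n β)) : f = g :=
  TwistedAlgebra.hom_ext fun a => TwistedAlgebra.hom_ext fun b => h a.1 a.2 b.1 b.2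

theorem cocycleForm_eq (x y : SkewLaurent σ) :
    cocycleForm σ x y = trForm σ (degDer σ x * y) := by
  have h : cocycleForm σ = ((LinearMap.mul ℂ (SkewLaurent σ)).comp (degDer σ)).compr₂
      (trForm σ) := by
    refine skew_hom_ext₂ σ fun m α n β => ?_
    simp [cocycleForm_mono, degDer_mono, mono_mul_mono, trForm_mono, AddChar.map_add_eq_mul]
  rw [h]; rfl

theorem trForm_mul_comm (x y : SkewLaurent σ) : trForm σ (x * y) = trForm σ (y * x) := by
  have h : (LinearMap.mul ℂ (SkewLaurent σ)).compr₂ (trForm σ) =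
      (LinearMap.mul ℂ (SkewLaurent σ)).flip.compr₂ (trForm σ) := by
    refine skew_hom_ext₂ σ fun m α n β => ?_
    simp only [LinearMap.compr₂_apply, LinearMap.mul_apply', LinearMap.flip_apply, mono_mul_mono,
      map_smul, trForm_mono, AddChar.map_add_eq_mul, smul_eq_mul, add_comm n m,
      mul_comm (σ β) (σ α)]
    split_ifs with hc
    · obtain ⟨h1, h2⟩ := hc
      obtain rfl : n = -m := by omega
      rw [eq_inv_of_mul_eq_one_right h2, zpow_neg, inv_zpow]
    · simp
  exact LinearMap.congr_fun (LinearMap.congr_fun h x) y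

theorem degDer_mul (x y : SkewLaurent σ) :
    degDer σ (x * y) = degDer σ x * y + x * degDer σ y := by
  have h : (LinearMap.mul ℂ (SkewLaurent σ)).compr₂ (degDer σ) =
      (LinearMap.mul ℂ (SkewLaurent σ)).comp (degDer σ) +
        (LinearMap.mul ℂ (SkewLaurent σ)).compl₂ (degDer σ) := by
    refine skew_hom_ext₂ σ fun m α n β => ?_
    simp only [LinearMap.compr₂_apply, LinearMap.mul_apply', LinearMap.add_apply,
      LinearMap.comp_apply, LinearMap.compl₂_apply, mono_mul_mono, map_smul, degDer_mono,
      LinearMap.smul_apply, smul_smul, ← add_smul]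
    congr 1
    push_cast
    ring
  exact LinearMap.congr_fun (LinearMap.congr_fun h x) y

theorem trForm_degDer (x : SkewLaurent σ) : trForm σ (degDer σ x) = 0 := by
  have h : (trForm σ).comp (degDer σ) = 0 := by
    refine TwistedAlgebra.hom_ext fun a => ?_
    change trForm σ (degDer σ (mono σ a.1 a.2)) = 0
    rw [degDer_mono, map_smul, trForm_mono]
    split_ifs with hc
    · simp [hc.1]
    · simp
  exact LinearMap.congr_fun h x

variable (ν : ℕ)

/-- The bilinear extension to matrices of
`(E_ij t^m e^α, E_kl t^n e^β) ↦ m δ_il δ_jk δ_{m+n,0} δ_{σ(α)σ(β),1} σ(α)^n`. -/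
def matrixCocycle (X Y : Matrix (Fin ν) (Fin ν) (SkewLaurent σ)) : ℂ :=
  ∑ i, ∑ j, cocycleForm σ (X i j) (Y j i)

theorem matrixCocycle_add_left (X X' Y : Matrix (Fin ν) (Fin ν) (SkewLaurent σ)) :
    matrixCocycle σ ν (X + X') Y = matrixCocycle σ ν X Y + matrixCocycle σ ν X' Y := by
  simp [matrixCocycle, Finset.sum_add_distrib]

theorem matrixCocycle_add_right (X Y Y' : Matrix (Fin ν) (Fin ν) (SkewLaurent σ)) :
    matrixCocycle σ ν X (Y + Y') = matrixCocycle σ ν X Y + matrixCocycle σ ν X Y' := by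
  simp [matrixCocycle, Finset.sum_add_distrib]

theorem matrixCocycle_smul_right (r : ℂ) (X Y : Matrix (Fin ν) (Fin ν) (SkewLaurent σ)) :
    matrixCocycle σ ν X (r • Y) = r * matrixCocycle σ ν X Y := by
  simp [matrixCocycle, Finset.mul_sum]

theorem matrixCocycle_self (X : Matrix (Fin ν) (Fin ν) (SkewLaurent σ)) :
    matrixCocycle σ ν X X = 0 := by
  have hsymm : ∀ x y : SkewLaurent σ, cocycleForm σ x y = -cocycleForm σ y x := by
    intro x y
    have h := trForm_degDer σ (x * y)
    rw [degDer_mul, map_add, trForm_mul_comm σ x] at h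
    rw [cocycleForm_eq, cocycleForm_eq]
    exact eq_neg_of_add_eq_zero_left h
  have h : matrixCocycle σ ν X X = -matrixCocycle σ ν X X := by
    unfold matrixCocycle
    conv_rhs => rw [Finset.sum_comm]
    simp only [← Finset.sum_neg_distrib]
    exact Finset.sum_congr rfl fun i _ => Finset.sum_congr rfl fun j _ => hsymm _ _
  exact self_eq_neg.1 h

theorem matrixCocycle_mul (X Y Z : Matrix (Fin ν) (Fin ν) (SkewLaurent σ)) :
    matrixCocycle σ ν (X * Y) Z = matrixCocycle σ ν X (Y * Z) + matrixCocycle σ ν Y (Z * X) := by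
  have key : ∀ x y z : SkewLaurent σ,
      cocycleForm σ (x * y) z = cocycleForm σ x (y * z) + cocycleForm σ y (z * x) := by
    intro x y z
    rw [cocycleForm_eq, cocycleForm_eq, cocycleForm_eq, degDer_mul, add_mul, map_add, mul_assoc,
      mul_assoc, trForm_mul_comm σ x, mul_assoc]
  have h1 : matrixCocycle σ ν (X * Y) Z =
      ∑ i, ∑ j, ∑ k, (cocycleForm σ (X i k) (Y k j * Z j i) +
        cocycleForm σ (Y k j) (Z j i * X i k)) := by
    simp only [matrixCocycle, Matrix.mul_apply, map_sum, LinearMap.sum_apply, key]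
  have h2 : matrixCocycle σ ν X (Y * Z) =
      ∑ i, ∑ j, ∑ k, cocycleForm σ (X i k) (Y k j * Z j i) := by
    simp only [matrixCocycle, Matrix.mul_apply, map_sum]
    exact Finset.sum_congr rfl fun i _ => Finset.sum_comm
  have h3 : matrixCocycle σ ν Y (Z * X) =
      ∑ i, ∑ j, ∑ k, cocycleForm σ (Y k j) (Z j i * X i k) := by
    simp only [matrixCocycle, Matrix.mul_apply, map_sum]
    have h4 : ∀ f : Fin ν → Fin ν → Fin ν → ℂ,
        ∑ k, ∑ j, ∑ i, f i j k = ∑ i, ∑ j, ∑ k, f i j k := by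
      intro f
      calc ∑ k, ∑ j, ∑ i, f i j k = ∑ k, ∑ i, ∑ j, f i j k :=
            Finset.sum_congr rfl fun _ _ => Finset.sum_comm
        _ = ∑ i, ∑ k, ∑ j, f i j k := Finset.sum_comm
        _ = ∑ i, ∑ j, ∑ k, f i j k := Finset.sum_congr rfl fun _ _ => Finset.sum_comm
    exact h4 fun i j k => cocycleForm σ (Y k j) (Z j i * X i k)
  rw [h1, h2, h3]
  simp only [Finset.sum_add_distrib]

theorem matrixCocycle_sub_left (X X' Y : Matrix (Fin ν) (Fin ν) (SkewLaurent σ)) :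
    matrixCocycle σ ν (X - X') Y = matrixCocycle σ ν X Y - matrixCocycle σ ν X' Y := by
  simp [matrixCocycle, Finset.sum_sub_distrib]

theorem matrixCocycle_sub_right (X Y Y' : Matrix (Fin ν) (Fin ν) (SkewLaurent σ)) :
    matrixCocycle σ ν X (Y - Y') = matrixCocycle σ ν X Y - matrixCocycle σ ν X Y' := by
  simp [matrixCocycle, Finset.sum_sub_distrib]

theorem matrixCocycle_swap (X Y : Matrix (Fin ν) (Fin ν) (SkewLaurent σ)) :
    matrixCocycle σ ν X Y = -matrixCocycle σ ν Y X := by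
  have h := matrixCocycle_self σ ν (X + Y)
  rw [matrixCocycle_add_left, matrixCocycle_add_right, matrixCocycle_add_right,
    matrixCocycle_self, matrixCocycle_self] at h
  linear_combination h

/-- The central extension of `gl_ν(R_σ)`, with underlying space `gl_ν(R_σ) ⊕ ℂ c`. -/
@[ext] structure GLHat where
  /-- the component in `gl_ν(R_σ)` -/
  mat : Matrix (Fin ν) (Fin ν) (SkewLaurent σ)
  /-- the coefficient of `c` -/
  cen : ℂ

namespace GLHat

variable {σ ν}

instance : Zero (GLHat σ ν) := ⟨⟨0, 0⟩⟩
instance : Add (GLHat σ ν) := ⟨fun x y => ⟨x.mat + y.mat, x.cen + y.cen⟩⟩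
instance : Neg (GLHat σ ν) := ⟨fun x => ⟨-x.mat, -x.cen⟩⟩
instance : SMul ℂ (GLHat σ ν) := ⟨fun r x => ⟨r • x.mat, r * x.cen⟩⟩

/-- The bracket is the commutator on `gl_ν(R_σ)` plus the two-cocycle times `c`. -/
instance : Bracket (GLHat σ ν) (GLHat σ ν) :=
  ⟨fun x y => ⟨x.mat * y.mat - y.mat * x.mat, matrixCocycle σ ν x.mat y.mat⟩⟩

@[simp] theorem zero_mat : (0 : GLHat σ ν).mat = 0 := rfl
@[simp] theorem zero_cen : (0 : GLHat σ ν).cen = 0 := rfl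
@[simp] theorem add_mat (x y : GLHat σ ν) : (x + y).mat = x.mat + y.mat := rfl
@[simp] theorem add_cen (x y : GLHat σ ν) : (x + y).cen = x.cen + y.cen := rfl
@[simp] theorem neg_mat (x : GLHat σ ν) : (-x).mat = -x.mat := rfl
@[simp] theorem neg_cen (x : GLHat σ ν) : (-x).cen = -x.cen := rfl
@[simp] theorem smul_mat (r : ℂ) (x : GLHat σ ν) : (r • x).mat = r • x.mat := rfl
@[simp] theorem smul_cen (r : ℂ) (x : GLHat σ ν) : (r • x).cen = r * x.cen := rfl
theorem lie_mat (x y : GLHat σ ν) : ⁅x, y⁆.mat = x.mat * y.mat - y.mat * x.mat := rfl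
theorem lie_cen (x y : GLHat σ ν) : ⁅x, y⁆.cen = matrixCocycle σ ν x.mat y.mat := rfl

instance : AddCommGroup (GLHat σ ν) where
  add_assoc x y z := GLHat.ext (by simp [add_assoc]) (by simp [add_assoc])
  zero_add x := GLHat.ext (by simp) (by simp)
  add_zero x := GLHat.ext (by simp) (by simp)
  add_comm x y := GLHat.ext (by simp [add_comm]) (by simp [add_comm])
  neg_add_cancel x := GLHat.ext (by simp) (by simp)
  nsmul := nsmulRec
  zsmul := zsmulRec

instance : Module ℂ (GLHat σ ν) where
  one_smul x := GLHat.ext (by simp) (by simp)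
  mul_smul r s x := GLHat.ext (by simp [mul_smul]) (by simp [mul_assoc])
  smul_zero r := GLHat.ext (by simp) (by simp)
  smul_add r x y := GLHat.ext (by simp) (by simp [mul_add])
  add_smul r s x := GLHat.ext (by simp [add_smul]) (by simp [add_mul])
  zero_smul x := GLHat.ext (by simp) (by simp)

instance : LieRing (GLHat σ ν) where
  add_lie x y z := by
    refine GLHat.ext ?_ ?_
    · simp only [lie_mat, add_mat, add_mul, mul_add]
      abel
    · simp only [lie_cen, add_mat, add_cen, matrixCocycle_add_left]
  lie_add x y z := by
    refine GLHat.ext ?_ ?_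
    · simp only [lie_mat, add_mat, add_mul, mul_add]
      abel
    · simp only [lie_cen, add_mat, add_cen, matrixCocycle_add_right]
  lie_self x := GLHat.ext (sub_self _) (matrixCocycle_self σ ν x.mat)
  leibniz_lie x y z := by
    refine GLHat.ext ?_ ?_
    · simp only [lie_mat, add_mat, sub_mul, mul_sub, mul_assoc]
      abel
    · simp only [lie_cen, lie_mat, add_cen, matrixCocycle_sub_left, matrixCocycle_sub_right,
        matrixCocycle_mul]
      rw [matrixCocycle_swap σ ν x.mat (z.mat * y.mat), matrixCocycle_mul]
      ring

instance : LieAlgebra ℂ (GLHat σ ν) where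
  lie_smul r x y := by
    refine GLHat.ext ?_ ?_
    · simp only [lie_mat, smul_mat, mul_smul_comm, smul_mul_assoc, smul_sub]
    · simp only [lie_cen, smul_mat, smul_cen, matrixCocycle_smul_right]

end GLHat

/-! ## The unitary Lie algebra and its elementary subalgebra -/

/-- The operation `X ↦ X^*` on matrices: transpose and apply the anti-involution. -/
def matStar (X : Matrix (Fin ν) (Fin ν) (SkewLaurent σ)) :
    Matrix (Fin ν) (Fin ν) (SkewLaurent σ) :=
  fun i j => bar σ (X j i)

theorem matStar_mul (X Y : Matrix (Fin ν) (Fin ν) (SkewLaurent σ)) :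
    matStar σ ν (X * Y) = matStar σ ν Y * matStar σ ν X := by
  ext1 i j
  simp [matStar, Matrix.mul_apply, bar_mul]

/-- The central extension `û_ν(R_σ, ¯)` of the unitary Lie algebra: the subalgebra
`{X | X^* = -X} ⊕ ℂ c` of the central extension of `gl_ν(R_σ)`. -/
def unitaryHat : LieSubalgebra ℂ (GLHat σ ν) where
  carrier := {x | matStar σ ν x.mat = -x.mat}
  zero_mem' := by
    ext1 i j
    change bar σ 0 = -0
    simp
  add_mem' := by
    intro x y hx hy
    ext1 i j
    have h1 := congrFun (congrFun hx i) j
    have h2 := congrFun (congrFun hy i) j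
    change bar σ (x.mat j i + y.mat j i) = -(x.mat i j + y.mat i j)
    change bar σ (x.mat j i) = -(x.mat i j) at h1
    change bar σ (y.mat j i) = -(y.mat i j) at h2
    rw [map_add, h1, h2, neg_add]
  smul_mem' := by
    intro r x hx
    ext1 i j
    have h1 := congrFun (congrFun hx i) j
    change bar σ (r • x.mat j i) = -(r • x.mat i j)
    change bar σ (x.mat j i) = -(x.mat i j) at h1
    rw [map_smul, h1, smul_neg]
  lie_mem' := by
    intro x y hx hy
    change matStar σ ν x.mat = -x.mat at hx
    change matStar σ ν y.mat = -y.mat at hy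
    change matStar σ ν (x.mat * y.mat - y.mat * x.mat) = -(x.mat * y.mat - y.mat * x.mat)
    have h : matStar σ ν (x.mat * y.mat - y.mat * x.mat) =
        matStar σ ν (x.mat * y.mat) - matStar σ ν (y.mat * x.mat) := by
      ext1 i j
      simp [matStar]
    rw [h, matStar_mul, matStar_mul, hx, hy]
    noncomm_ring

/-- The element `e_ij(m, α) = E_ij t^m e^α - E_ji \overline{t^m e^α}`. -/
def unitaryGen (i j : Fin ν) (m : ℤ) (α : G) : unitaryHat σ ν :=
  ⟨⟨Matrix.single i j (mono σ m α) - Matrix.single j i (bar σ (mono σ m α)), 0⟩, by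
    ext1 k l
    change bar σ (Matrix.single i j (mono σ m α) l k -
      Matrix.single j i (bar σ (mono σ m α)) l k) =
        -(Matrix.single i j (mono σ m α) k l - Matrix.single j i (bar σ (mono σ m α)) k l)
    simp only [Matrix.single_apply, map_sub, apply_ite (bar σ), bar_bar, map_zero, neg_sub]
    simp only [and_comm]⟩

/-- The central element `c`. -/
def unitaryCenter : unitaryHat σ ν :=
  ⟨⟨0, 1⟩, by
    ext1 i j
    change bar σ 0 = -0
    simp⟩

/-- The subalgebra of `û_ν(R_σ, ¯)` generated by the `e_ij(m, α)` with `i ≠ j`; this is the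
central extension of the elementary unitary Lie algebra. -/
def elementaryHat : LieSubalgebra ℂ (unitaryHat σ ν) :=
  LieSubalgebra.lieSpan ℂ (unitaryHat σ ν)
    {x | ∃ i j : Fin ν, i ≠ j ∧ ∃ (m : ℤ) (α : G), x = unitaryGen σ ν i j m α}

end Skew

/-! ## The Fock space -/

section Fock

variable (ν : ℕ)

/-- The group `Γ / 2Γ` for `Γ = ℤ^ν`. -/
abbrev GammaBar := Fin ν → ZMod 2

/-- The class in `Γ / 2Γ` of `ε_i`. -/
def epsBar (i : Fin ν) : GammaBar ν := Pi.single i 1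

/-- The signs `ε(ε_i, ε_j)`. -/
def epsSign (i j : Fin ν) : ℂ := if i ≤ j then 1 else -1

theorem sign_pow (s : ℂ) (hs : s = 1 ∨ s = -1) (x y z : ZMod 2) :
    s ^ (x.val * z.val) * s ^ (y.val * z.val) = s ^ ((x + y).val * z.val) ∧
    s ^ (z.val * x.val) * s ^ (z.val * y.val) = s ^ (z.val * (x + y).val) := by
  rcases hs with rfl | rfl
  · simp
  · have h : ∀ x y z : ZMod 2,
        (-1 : ℤ) ^ (x.val * z.val) * (-1) ^ (y.val * z.val) = (-1) ^ ((x + y).val * z.val) ∧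
        (-1 : ℤ) ^ (z.val * x.val) * (-1) ^ (z.val * y.val) = (-1) ^ (z.val * (x + y).val) := by
      decide
    exact ⟨by exact_mod_cast (h x y z).1, by exact_mod_cast (h x y z).2⟩

/-- The bimultiplicative cocycle
`ε(∑ m_i ε_i, ∑ n_j ε_j) = ∏_{i,j} ε(ε_i, ε_j)^(m_i n_j)` on `Γ / 2Γ`. -/
def latticeCocycle : TwoCocycle (GammaBar ν) where
  toFun a b := ∏ i, ∏ j, epsSign ν i j ^ ((a i).val * (b j).val)
  zero_left := by simp
  zero_right := by simp
  cocycle a b d := by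
    have hs : ∀ i j, epsSign ν i j = 1 ∨ epsSign ν i j = -1 := fun i j => by
      unfold epsSign; split_ifs <;> simp
    simp only [← Finset.prod_mul_distrib]
    refine Finset.prod_congr rfl fun i _ => Finset.prod_congr rfl fun j _ => ?_
    rw [Pi.add_apply, Pi.add_apply, ← (sign_pow _ (hs i j) (a i) (b i) (d j)).1,
      ← (sign_pow _ (hs i j) (b j) (d j) (a i)).2]
    ring

/-- The twisted group algebra `ℂ[Γ / 2Γ]`. -/
abbrev GroupAlg := TwistedAlgebra (latticeCocycle ν)

/-- The symmetric algebra `S(H⁻)`, as the polynomial algebra in the basis of `H⁻`: the variable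
`(i, k)` is `ε_i(-(2k+1))`. -/
abbrev SymAlg := MvPolynomial (Fin ν × ℕ) ℂ

/-- The Fock space `M = ℂ[Γ / 2Γ] ⊗ S(H⁻)`. -/
abbrev Fock := GroupAlg ν ⊗[ℂ] SymAlg ν

/-- The action of `ε_i(n)` on `S(H⁻)` for odd `n`: multiplication by the variable `ε_i(n)` if
`n < 0`, and `(n / 2) ∂ / ∂ε_i(-n)` if `n > 0`. It is set to be `0` for even `n`. -/
def epsSym (i : Fin ν) (n : ℤ) : Module.End ℂ (SymAlg ν) :=
  if Odd n then
    if n < 0 then LinearMap.mulLeft ℂ (MvPolynomial.X (i, n.natAbs / 2))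
    else ((n : ℂ) / 2) • (MvPolynomial.pderiv (i, n.natAbs / 2)).toLinearMap
  else 0

/-- The action of `α(n)` on the Fock space, for `α ∈ Γ`. -/
def heis (α : Fin ν → ℤ) (n : ℤ) : Module.End ℂ (Fock ν) :=
  ∑ i, (α i : ℂ) • LinearMap.lTensor (GroupAlg ν) (epsSym ν i n)

/-- The action of `e^a` on the Fock space, for `a ∈ Γ / 2Γ`. -/
def groupOp (a : GammaBar ν) : Module.End ℂ (Fock ν) :=
  LinearMap.rTensor (SymAlg ν) (LinearMap.mulLeft ℂ (e (latticeCocycle ν) a))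

/-- The exponential `∑ A^l / l!` of a formal power series `A` without constant term, over a not
necessarily commutative algebra. -/
def formalExp {R : Type*} [Ring R] [Algebra ℂ R] (A : PowerSeries R) : PowerSeries R :=
  PowerSeries.mk fun r =>
    ∑ l ∈ Finset.range (r + 1), ((l.factorial : ℂ)⁻¹) • PowerSeries.coeff r (A ^ l)

/-- `E_-(α, az) = exp(-2 ∑_{n < 0 odd} (α(n) / n) (az)^(-n))`, a power series in `z`. -/
def expMinus (α : Fin ν → ℤ) (a : ℂ) : PowerSeries (Module.End ℂ (Fock ν)) :=
  formalExp (PowerSeries.mk fun r =>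
    (-2 / ((-(r : ℤ) : ℤ) : ℂ) * a ^ r) • heis ν α (-(r : ℤ)))

/-- `E_+(α, az) = exp(-2 ∑_{n > 0 odd} (α(n) / n) (az)^(-n))`, a power series in `z⁻¹`. -/
def expPlus (α : Fin ν → ℤ) (a : ℂ) : PowerSeries (Module.End ℂ (Fock ν)) :=
  formalExp (PowerSeries.mk fun r => (-2 / (r : ℂ) * (a ^ r)⁻¹) • heis ν α (r : ℤ))

/-- The value on `v` of the coefficient of `z^(-n)` in
`E_-(ε_i, z) E_-(-ε_j, az) E_+(ε_i, z) E_+(-ε_j, az)`; for every `v` only finitely many terms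
of the sum are nonzero. -/
def bosonMode (i j : Fin ν) (a : ℂ) (n : ℤ) (v : Fock ν) : Fock ν :=
  ∑ᶠ r : {r : ℕ × ℕ // (r.2 : ℤ) - r.1 = n},
    PowerSeries.coeff r.1.1 (expMinus ν (Pi.single i 1) 1 * expMinus ν (-Pi.single j 1) a)
      (PowerSeries.coeff r.1.2 (expPlus ν (Pi.single i 1) 1 * expPlus ν (-Pi.single j 1) a) v)

open Classical in
/-- The value on `v` of the coefficient `x_ij(a, n)` of `z^(-n)` in the vertex operator
`X_ij(a, z)`. -/
def vertexMode (i j : Fin ν) (a : ℂ) (n : ℤ) (v : Fock ν) : Fock ν :=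
  if i ≠ j then epsSign ν i j • groupOp ν (epsBar ν i - epsBar ν j) (bosonMode ν i j a n v)
  else if a = 1 then (4 : ℂ) • heis ν (Pi.single i 1) n v
  else ((1 + a) / (1 - a)) • (bosonMode ν i j a n v - if n = 0 then v else 0)

/-- The element `w(ρ_1, …, ρ_ν) = w_1(ρ_1) ⋯ w_ν(ρ_ν)` of `ℂ[Γ / 2Γ]`, where `w_j(ρ)` is
`1 + √-1 ρ e^{ε_j}` for `j` odd and `1 + ρ e^{ε_j}` for `j` even. (Here `j` runs over `1, …, ν`;
the element `j` of `Fin ν` corresponds to the index `j + 1`.) -/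
def spinVector (ρ : Fin ν → ℤˣ) : GroupAlg ν :=
  (List.ofFn fun j : Fin ν =>
    (1 : GroupAlg ν) + ((if Even (j : ℕ) then Complex.I else 1) * ((ρ j : ℤ) : ℂ)) •
      e (latticeCocycle ν) (epsBar ν j)).prod

/-- The subspace `V_ν(γ)` of `ℂ[Γ / 2Γ]` for `γ = (γ_1, …, γ_{d+1})`, `d = ⌊ν / 2⌋`: the span of
the `w(ρ_1, …, ρ_ν)` with `ρ_1 = γ_1`, `ρ_{2j} ρ_{2j+1} = γ_{j+1}` for `1 ≤ j` and
`2j + 1 ≤ ν`, and, when `ν` is even, `ρ_ν = γ_{d+1}`. Indices are shifted by one. -/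
def spinModule (γ : Fin (ν / 2 + 1) → ℤˣ) : Submodule ℂ (GroupAlg ν) :=
  Submodule.span ℂ {w | ∃ ρ : Fin ν → ℤˣ, w = spinVector ν ρ ∧
    (∀ i : Fin ν, (i : ℕ) = 0 → ρ i = γ 0) ∧
    (∀ (j : Fin (ν / 2 + 1)) (i i' : Fin ν), 1 ≤ (j : ℕ) → (i : ℕ) + 1 = 2 * (j : ℕ) →
      (i' : ℕ) = 2 * (j : ℕ) → ρ i * ρ i' = γ j) ∧
    (Even ν → ∀ i : Fin ν, (i : ℕ) + 1 = ν → ρ i = γ (Fin.last (ν / 2)))}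

/-- The subspace `U ⊗ P` of `M`, for subspaces `U` of `ℂ[Γ / 2Γ]` and `P` of `S(H⁻)`. -/
def tensorSub (U : Submodule ℂ (GroupAlg ν)) (P : Submodule ℂ (SymAlg ν)) :
    Submodule ℂ (Fock ν) :=
  Submodule.map₂ (TensorProduct.mk ℂ (GroupAlg ν) (SymAlg ν)) U P

/-- The subspace `V_ν(γ) ⊗ S(H⁻)` of `M`. -/
def component (γ : Fin (ν / 2 + 1) → ℤˣ) : Submodule ℂ (Fock ν) :=
  tensorSub ν (spinModule ν γ) ⊤

/-- The subalgebra `S(H₀⁻)` of `S(H⁻)` generated by the subspace `H₀⁻` spanned by the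
`ε_i(m) - ε_j(m)`, `i ≠ j`, and the `ε_i(n)` with `n ∉ Nℤ`, for odd negative `m`, `n`. -/
def symZero (N : ℕ) : Subalgebra ℂ (SymAlg ν) :=
  Algebra.adjoin ℂ (Submodule.span ℂ
    ({x | ∃ (i j : Fin ν) (k : ℕ), i ≠ j ∧ x = MvPolynomial.X (i, k) - MvPolynomial.X (j, k)} ∪
      {x | ∃ (i : Fin ν) (k : ℕ), ¬ N ∣ 2 * k + 1 ∧ x = MvPolynomial.X (i, k)} :
      Set (SymAlg ν)) : Set (SymAlg ν))

/-- The subspace `V_ν(γ) ⊗ S(H₀⁻)` of `M`. -/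
def componentZero (N : ℕ) (γ : Fin (ν / 2 + 1) → ℤˣ) : Submodule ℂ (Fock ν) :=
  tensorSub ν (spinModule ν γ) (Subalgebra.toSubmodule (symZero ν N))

end Fock

/-! ## Representations -/

section Rep

variable {L M : Type*} [LieRing L] [LieAlgebra ℂ L] [AddCommGroup M] [Module ℂ M]

/-- `W` is a submodule of `M` for the restriction of the representation `ρ` to the Lie
subalgebra `K`. -/
def IsSubrep (ρ : L →ₗ⁅ℂ⁆ Module.End ℂ M) (K : LieSubalgebra ℂ L) (W : Submodule ℂ M) : Prop :=
  ∀ x ∈ K, ∀ w ∈ W, ρ x w ∈ W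

/-- `W` is an irreducible submodule of `M` for the restriction of `ρ` to `K`. -/
def IsIrreducibleSubrep (ρ : L →ₗ⁅ℂ⁆ Module.End ℂ M) (K : LieSubalgebra ℂ L)
    (W : Submodule ℂ M) : Prop :=
  IsSubrep ρ K W ∧ W ≠ ⊥ ∧ ∀ W' ≤ W, IsSubrep ρ K W' → W' = ⊥ ∨ W' = W

/-- `W` is a completely reducible submodule of `M` for the restriction of `ρ` to `K`: a direct
sum of irreducible submodules. -/
def IsCompletelyReducibleSubrep (ρ : L →ₗ⁅ℂ⁆ Module.End ℂ M) (K : LieSubalgebra ℂ L)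
    (W : Submodule ℂ M) : Prop :=
  IsSubrep ρ K W ∧ ∃ 𝒮 : Set (Submodule ℂ M),
    (∀ U ∈ 𝒮, IsIrreducibleSubrep ρ K U) ∧ sSupIndep 𝒮 ∧ sSup 𝒮 = W

end Rep

open Classical in
/-- `ρ` is the vertex representation of `û_ν(R_σ, ¯)` on the Fock space: `c` acts as `1 / 2`, and
`2 e_ij(m, α)` acts as `x_ij(σ(α), m)`, to which the scalar `(1 + σ(α)) / (1 - σ(α))` is added
if `i = j`, `σ(α) ≠ 1` and `m = 0`. -/
structure IsVertexRep {G : Type*} [AddCommGroup G] (σ : AddChar G ℂ) (ν : ℕ)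
    (ρ : unitaryHat σ ν →ₗ⁅ℂ⁆ Module.End ℂ (Fock ν)) : Prop where
  gen : ∀ (i j : Fin ν) (m : ℤ) (α : G) (v : Fock ν),
    ρ ((2 : ℂ) • unitaryGen σ ν i j m α) v = vertexMode ν i j (σ α) m v +
      if i = j ∧ σ α ≠ 1 ∧ m = 0 then ((1 + σ α) / (1 - σ α)) • v else 0
  center : ∀ v : Fock ν, ρ (unitaryCenter σ ν) v = (1 / 2 : ℂ) • v

end VertexUnitary

end

/-! The representation comes from a boson-fermion correspondence. The fields φ_i(z) = e^{ε_i}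
E_-(ε_i,z) E_+(ε_i,z) are twisted neutral fermions: moving E_+(ε_i,z) to the right of E_-(ε_i,w)
costs the factor c(x) = (1-x)/(1+x), x = w/z, whose expansions in x and in 1/x differ by a delta
function at x = -1, while for i ≠ j the Clifford relations of the e^{ε_i} give anticommutation
(`isNeutralFermion_fermion`). Only odd modes occur, so E_±(-ε_j,az) = E_±(ε_j,-az), and X_ij(a,z) is
the product φ_i(z)φ_j(-az). Its contraction for i = j is c(-a) = (1+a)/(1-a), the scalar added in
the statement; at the pole a = 1 a derivative takes over and yields 4ε_i(n)
(`vertexMode_add_eq_quadMode`).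

It remains to compute with quadratic expressions in abstract neutral fermions (`quadOp_commutator`).
A commutator consists of four quadratic terms and a finite anomaly caused by normal ordering. The
closed form `finsum_signCoeff` shows that the anomaly supplies exactly the scalars belonging to the
four terms, plus a multiple of m when the resulting parameter ab or b/a is 1; that multiple is the
cocycle. The symmetry `quadOp_symm` matches the anti-involution, so matrix units give a
representation of skew-hermitian matrices (`fermionRep`).

For submodules let N be the order of σ(G), read as 0 when infinite. An even N, and also 0, divides
no odd number, so S(H_0^-) is then all of S(H^-), and both irreducibility claims are the case
distinction of one statement about V ⊗ S(H_0^-). This space is stable because the exponents of the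
vertex operators involve only elements of H_0^- (`convMul_mem_symZero`). Conversely, commutators of
off-diagonal operators produce every Heisenberg operator attached to H_0^-
(`IsQuadStable.heis_sub_mem`). The annihilators lower a nonzero vector to some g ⊗ 1
(`exists_tmul_one_mem`), zero modes act on g through the even Clifford algebra, under which V is
irreducible (`spinModule_le`), and the creators then fill V ⊗ S(H_0^-).

For complete reducibility, multiplication by products b of the elements Σ_i ε_i(-n), N ∣ n, commutes
with the elementary subalgebra. Hence each b(V ⊗ S(H_0^-)) is zero or irreducible; these spaces add
up to V ⊗ S(H^-), and a sum of irreducibles is a direct sum of irreducibles. -/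

noncomputable section

namespace VertexUnitary

open TwistedAlgebra

/-! ## Formal exponentials -/

section FormalExp

theorem coeff_formalExp {R : Type*} [Ring R] [Algebra ℂ R] (A : PowerSeries R) (r : ℕ) :
    PowerSeries.coeff r (formalExp A) =
      ∑ l ∈ Finset.range (r + 1), ((l.factorial : ℂ)⁻¹) • PowerSeries.coeff r (A ^ l) := by
  simp [formalExp]

theorem map_formalExp {R S : Type*} [Ring R] [Algebra ℂ R] [Ring S] [Algebra ℂ S]
    (φ : R →ₐ[ℂ] S) (A : PowerSeries R) :
    PowerSeries.map φ.toRingHom (formalExp A) = formalExp (PowerSeries.map φ.toRingHom A) := by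
  ext r
  simp only [PowerSeries.coeff_map, coeff_formalExp, map_sum, ← map_pow]
  refine Finset.sum_congr rfl fun l _ => ?_
  exact map_smul φ _ _

theorem coeff_pow_mem {R : Type*} [Ring R] [Algebra ℂ R] (K : Subalgebra ℂ R)
    {A : PowerSeries R} (hA : ∀ r, PowerSeries.coeff r A ∈ K) (l r : ℕ) :
    PowerSeries.coeff r (A ^ l) ∈ K := by
  induction l generalizing r with
  | zero =>
    rw [pow_zero, PowerSeries.coeff_one]
    split_ifs
    · exact K.one_mem
    · exact K.zero_mem
  | succ l ih =>
    rw [pow_succ, PowerSeries.coeff_mul]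
    exact K.sum_mem fun p _ => K.mul_mem (ih _) (hA _)

theorem coeff_formalExp_mem {R : Type*} [Ring R] [Algebra ℂ R] (K : Subalgebra ℂ R)
    {A : PowerSeries R} (hA : ∀ r, PowerSeries.coeff r A ∈ K) (r : ℕ) :
    PowerSeries.coeff r (formalExp A) ∈ K := by
  rw [coeff_formalExp]
  exact K.sum_mem fun l _ => K.smul_mem (coeff_pow_mem K hA l r) _

variable {R : Type*} [CommRing R] [Algebra ℂ R]

open PowerSeries

omit [Algebra ℂ R] in
theorem coeff_pow_eq_zero {A : PowerSeries R} (h : constantCoeff A = 0) {r l : ℕ} (hrl : r < l) :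
    coeff r (A ^ l) = 0 := by
  obtain ⟨B, rfl⟩ := X_dvd_iff.2 h
  rw [mul_pow]
  exact X_pow_dvd_iff.1 (dvd_mul_right _ _) r hrl

/-- Without constant term, powers above the `r`-th do not reach degree `r`. One truncation therefore
serves all degrees up to `n`, which allows termwise differentiation. -/
theorem coeff_formalExp_of_le {A : PowerSeries R} (h : constantCoeff A = 0) {r n : ℕ}
    (hrn : r ≤ n) : coeff r (formalExp A) =
      coeff r (∑ l ∈ Finset.range (n + 1), ((l.factorial : ℂ)⁻¹) • A ^ l) := by
  rw [coeff_formalExp, map_sum]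
  have : ∀ l, coeff r (((l.factorial : ℂ)⁻¹) • A ^ l) =
      ((l.factorial : ℂ)⁻¹) • coeff r (A ^ l) := fun l => rfl
  simp only [this]
  refine Finset.sum_subset (Finset.range_mono (by omega)) fun l _ hl => ?_
  rw [coeff_pow_eq_zero h (by simpa using hl), smul_zero]

theorem constantCoeff_formalExp (A : PowerSeries R) : constantCoeff (formalExp A) = 1 := by
  rw [← coeff_zero_eq_constantCoeff_apply, coeff_formalExp]
  simp

theorem derivative_formalExp {A : PowerSeries R} (h : constantCoeff A = 0) :
    d⁄dX R (formalExp A) = d⁄dX R A * formalExp A := by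
  ext r
  have h1 : d⁄dX R (∑ l ∈ Finset.range (r + 1 + 1), ((l.factorial : ℂ)⁻¹) • A ^ l) =
      d⁄dX R A * ∑ l ∈ Finset.range (r + 1), ((l.factorial : ℂ)⁻¹) • A ^ l := by
    have hs : ∀ (c : ℂ) (f : PowerSeries R), d⁄dX R (c • f) = c • d⁄dX R f := by
      intro c f
      ext n
      rw [coeff_derivative]
      change c • coeff (n + 1) f * _ = c • coeff n (d⁄dX R f)
      rw [coeff_derivative, smul_mul_assoc]
    rw [map_sum, Finset.sum_range_succ', Finset.mul_sum]
    have h0 : d⁄dX R (((Nat.factorial 0 : ℂ)⁻¹) • A ^ 0) = 0 := by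
      rw [hs, pow_zero]; simp
    rw [h0, add_zero]
    refine Finset.sum_congr rfl fun l _ => ?_
    rw [hs, derivative_pow, Nat.factorial_succ, mul_smul_comm, Nat.add_sub_cancel]
    have h2 : ((l + 1 : ℕ) : PowerSeries R) * A ^ l * d⁄dX R A =
        ((l + 1 : ℕ) : ℂ) • (d⁄dX R A * A ^ l) := by
      rw [Nat.cast_smul_eq_nsmul, nsmul_eq_mul]; ring
    rw [h2, smul_smul]
    congr 1
    have h3 : ((l + 1 : ℕ) : ℂ) ≠ 0 := by exact_mod_cast Nat.succ_ne_zero l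
    have h4 : (l.factorial : ℂ) ≠ 0 := by exact_mod_cast l.factorial_ne_zero
    push_cast at h3 ⊢
    field_simp
  rw [coeff_derivative, coeff_formalExp_of_le h le_rfl, ← coeff_derivative, h1, coeff_mul, coeff_mul]
  refine Finset.sum_congr rfl fun p hp => ?_
  rw [coeff_formalExp_of_le h (n := r) (by
    have := Finset.HasAntidiagonal.mem_antidiagonal.1 hp; omega)]

/-- Degree `r + 1` of a solution is determined by the lower degrees because `r + 1` is invertible in
a complex algebra. Identities between exponentials are proved by letting both sides solve the same
equation. -/
theorem eq_of_derivative_eq_mul {F F' G : PowerSeries R} (h0 : constantCoeff F = constantCoeff F')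
    (h : d⁄dX R F = G * F) (h' : d⁄dX R F' = G * F') : F = F' := by
  ext r
  induction r using Nat.strong_induction_on with
  | _ r ih =>
    cases r with
    | zero => simpa using h0
    | succ r =>
      have h1 := congrArg (coeff r) h
      have h2 := congrArg (coeff r) h'
      rw [coeff_derivative, coeff_mul] at h1 h2
      have h3 : coeff (r + 1) F * ((r : R) + 1) = coeff (r + 1) F' * ((r : R) + 1) := by
        rw [h1, h2]
        refine Finset.sum_congr rfl fun p hp => ?_
        rw [ih p.2 (by have := Finset.HasAntidiagonal.mem_antidiagonal.1 hp; omega)]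
      have h4 : ((r : R) + 1) * algebraMap ℂ R ((r : ℂ) + 1)⁻¹ = 1 := by
        have h5 : ((r : R) + 1) = algebraMap ℂ R ((r : ℂ) + 1) := by simp
        rw [h5, ← map_mul, mul_inv_cancel₀ (by exact_mod_cast Nat.succ_ne_zero r), map_one]
      calc coeff (r + 1) F = coeff (r + 1) F * ((r : R) + 1) * algebraMap ℂ R ((r : ℂ) + 1)⁻¹ := by
            rw [mul_assoc, h4, mul_one]
        _ = _ := by rw [h3, mul_assoc, h4, mul_one]

theorem formalExp_add {A B : PowerSeries R} (hA : constantCoeff A = 0)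
    (hB : constantCoeff B = 0) : formalExp (A + B) = formalExp A * formalExp B := by
  refine eq_of_derivative_eq_mul (G := d⁄dX R A + d⁄dX R B) ?_ ?_ ?_
  · simp [constantCoeff_formalExp]
  · rw [derivative_formalExp (by simp [hA, hB]), map_add]
  · rw [Derivation.leibniz, derivative_formalExp hA, derivative_formalExp hB, smul_eq_mul,
      smul_eq_mul]
    ring

theorem formalExp_zero : formalExp (0 : PowerSeries R) = 1 := by
  refine eq_of_derivative_eq_mul (G := 0) ?_ ?_ ?_
  · simp [constantCoeff_formalExp]
  · rw [derivative_formalExp (by simp)]; simp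
  · simp

end FormalExp


section Schur

variable {ν : ℕ}

/-! ## Multiplication and differential operators on the Fock space -/

/-- The variable `ε_i(-r)` of the polynomial algebra, `0` for even `r`. -/
def oddVar (i : Fin ν) (r : ℕ) : SymAlg ν := if Odd r then MvPolynomial.X (i, r / 2) else 0

theorem oddVar_two_mul_add_one (i : Fin ν) (k : ℕ) :
    oddVar i (2 * k + 1) = MvPolynomial.X (i, k) := by
  rw [oddVar, if_pos (odd_two_mul_add_one k)]
  congr 2
  omega

/-- The derivation `ε_i(n)` of the polynomial algebra, for `n > 0`. -/
def oddDer (i : Fin ν) (r : ℕ) : Derivation ℂ (SymAlg ν) (SymAlg ν) :=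
  if Odd r then ((r : ℂ) / 2) • MvPolynomial.pderiv (i, r / 2) else 0

theorem oddDer_oddVar (i j : Fin ν) (r s : ℕ) :
    oddDer i r (oddVar j s) = if i = j ∧ r = s ∧ Odd r then MvPolynomial.C ((r : ℂ) / 2) else 0 := by
  unfold oddDer oddVar
  by_cases hr : Odd r
  · by_cases hs : Odd s
    · rw [if_pos hr, if_pos hs, Derivation.smul_apply, MvPolynomial.pderiv_X, Pi.single_apply]
      have h : (j, s / 2) = (i, r / 2) ↔ i = j ∧ r = s ∧ Odd r := by
        rw [Prod.mk.injEq]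
        obtain ⟨a, rfl⟩ := hr
        obtain ⟨b, rfl⟩ := hs
        constructor
        · rintro ⟨h1, h2⟩
          exact ⟨h1.symm, by omega, odd_two_mul_add_one a⟩
        · rintro ⟨h1, h2, -⟩
          exact ⟨h1.symm, by omega⟩
      simp only [h]
      split_ifs
      · rw [MvPolynomial.smul_eq_C_mul, mul_one]
      · simp
    · rw [if_neg hs, map_zero, if_neg]
      rintro ⟨-, rfl, h⟩
      exact hs h
  · rw [if_neg hr, Derivation.zero_apply, if_neg]
    exact fun h => hr h.2.2

/-- A commutator of derivations is a derivation, so it is enough to test variables; there the inner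
derivation already gives a constant. -/
theorem oddDer_comm (i j : Fin ν) (r s : ℕ) (p : SymAlg ν) :
    oddDer i r (oddDer j s p) = oddDer j s (oddDer i r p) := by
  have h : ⁅oddDer i r, oddDer j s⁆ = 0 := by
    refine MvPolynomial.derivation_ext fun x => ?_
    obtain ⟨l, k⟩ := x
    rw [Derivation.commutator_apply, ← oddVar_two_mul_add_one, oddDer_oddVar, oddDer_oddVar]
    split_ifs <;> simp
  have h1 := DFunLike.congr_fun h p
  rw [Derivation.commutator_apply] at h1
  exact sub_eq_zero.1 h1

theorem epsSym_neg (i : Fin ν) (r : ℕ) :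
    epsSym ν i (-(r : ℤ)) = LinearMap.mulLeft ℂ (oddVar i r) := by
  unfold epsSym oddVar
  by_cases hr : Odd r
  · have h0 : 0 < r := hr.pos
    have h1 : Odd (-(r : ℤ)) := by simpa using hr
    rw [if_pos h1, if_pos (by omega), if_pos hr]
    simp
  · have h1 : ¬ Odd (-(r : ℤ)) := by simpa using hr
    rw [if_neg h1, if_neg hr, LinearMap.mulLeft_zero_eq_zero]

theorem epsSym_pos (i : Fin ν) (r : ℕ) : epsSym ν i (r : ℤ) = (oddDer i r).toLinearMap := by
  unfold epsSym oddDer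
  by_cases hr : Odd r
  · have h1 : Odd (r : ℤ) := by simpa using hr
    rw [if_pos h1, if_neg (by omega), if_pos hr]
    simp
  · have h1 : ¬ Odd (r : ℤ) := by simpa using hr
    rw [if_neg h1, if_neg hr]
    rfl

/-- Multiplication by a polynomial on the Fock space. -/
def mulOp : SymAlg ν →ₐ[ℂ] Module.End ℂ (Fock ν) :=
  (Module.End.lTensorAlgHom ℂ (SymAlg ν) (GroupAlg ν)).comp (Algebra.lmul ℂ (SymAlg ν))

theorem mulOp_apply (p : SymAlg ν) :
    mulOp p = LinearMap.lTensor (GroupAlg ν) (LinearMap.mulLeft ℂ p) := rfl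

@[simp] theorem mulOp_tmul (p : SymAlg ν) (g : GroupAlg ν) (q : SymAlg ν) :
    mulOp p (g ⊗ₜ q) = g ⊗ₜ (p * q) := rfl

-- A polynomial algebra maps freely only into commutative algebras, so the target is first cut down
-- to the subalgebra generated by the commuting derivations.
open scoped IsMulCommutative in
theorem exists_symDiff : ∃ θ : SymAlg ν →ₐ[ℂ] Module.End ℂ (SymAlg ν),
    ∀ (i : Fin ν) (r : ℕ), θ (oddVar i r) = (oddDer i r).toLinearMap := by
  have hc : ∀ a ∈ Set.range (fun x : Fin ν × ℕ => (oddDer x.1 x.2).toLinearMap),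
      ∀ b ∈ Set.range (fun x : Fin ν × ℕ => (oddDer x.1 x.2).toLinearMap), a * b = b * a := by
    rintro _ ⟨x, rfl⟩ _ ⟨y, rfl⟩
    exact LinearMap.ext fun p => oddDer_comm _ _ _ _ p
  have := Algebra.isMulCommutative_adjoin ℂ hc
  refine ⟨(Algebra.adjoin ℂ (Set.range fun x : Fin ν × ℕ =>
    (oddDer x.1 x.2).toLinearMap)).val.comp (MvPolynomial.aeval fun x =>
      ⟨(oddDer x.1 (2 * x.2 + 1)).toLinearMap,
        Algebra.subset_adjoin ⟨(x.1, 2 * x.2 + 1), rfl⟩⟩), fun i r => ?_⟩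
  unfold oddVar
  by_cases hr : Odd r
  · rw [if_pos hr, AlgHom.comp_apply, MvPolynomial.aeval_X]
    have h1 : 2 * (r / 2) + 1 = r := by obtain ⟨a, rfl⟩ := hr; omega
    simp only [h1]
    rfl
  · rw [if_neg hr, map_zero, oddDer, if_neg hr]
    rfl

/-- The constant coefficient differential operator `p(ε_i(1), ε_i(3), …)` on the Fock space. -/
def diffOp : SymAlg ν →ₐ[ℂ] Module.End ℂ (Fock ν) :=
  (Module.End.lTensorAlgHom ℂ (SymAlg ν) (GroupAlg ν)).comp exists_symDiff.choose

theorem diffOp_oddVar (i : Fin ν) (r : ℕ) :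
    diffOp (oddVar i r) = LinearMap.lTensor (GroupAlg ν) (oddDer i r).toLinearMap := by
  unfold diffOp
  rw [AlgHom.comp_apply, exists_symDiff.choose_spec]
  rfl

@[simp] theorem diffOp_oddVar_tmul (i : Fin ν) (r : ℕ) (g : GroupAlg ν) (q : SymAlg ν) :
    diffOp (oddVar i r) (g ⊗ₜ q) = g ⊗ₜ oddDer i r q := by
  rw [diffOp_oddVar]; rfl

theorem heis_single (i : Fin ν) (n : ℤ) :
    heis ν (Pi.single i 1) n = LinearMap.lTensor (GroupAlg ν) (epsSym ν i n) := by
  unfold heis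
  rw [Finset.sum_eq_single i]
  · simp
  · intro j _ hj; simp [hj]
  · simp

theorem heis_neg (α : Fin ν → ℤ) (n : ℤ) : heis ν (-α) n = -heis ν α n := by
  unfold heis
  rw [← Finset.sum_neg_distrib]
  exact Finset.sum_congr rfl fun i _ => by
    rw [Pi.neg_apply, Int.cast_neg]
    exact neg_smul (α i : ℂ) (LinearMap.lTensor (GroupAlg ν) (epsSym ν i n) : Module.End ℂ (Fock ν))

theorem heis_single_neg (i : Fin ν) (r : ℕ) :
    heis ν (Pi.single i 1) (-(r : ℤ)) = mulOp (oddVar i r) := by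
  rw [heis_single, epsSym_neg, mulOp_apply]

theorem heis_single_pos (i : Fin ν) (r : ℕ) :
    heis ν (Pi.single i 1) (r : ℤ) = diffOp (oddVar i r) := by
  rw [heis_single, epsSym_pos, diffOp_oddVar]

theorem fock_hom_ext {W : Type*} [AddCommGroup W] [Module ℂ W] {f g : Fock ν →ₗ[ℂ] W}
    (h : ∀ a p, f (a ⊗ₜ p) = g (a ⊗ₜ p)) : f = g :=
  TensorProduct.ext' h

theorem diffOp_oddVar_mul_mulOp (i : Fin ν) (r : ℕ) (p : SymAlg ν) :
    diffOp (oddVar i r) * mulOp p = mulOp p * diffOp (oddVar i r) + mulOp (oddDer i r p) := by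
  refine fock_hom_ext fun g q => ?_
  simp only [Module.End.mul_apply, mulOp_tmul, diffOp_oddVar_tmul, LinearMap.add_apply,
    Derivation.leibniz, smul_eq_mul, ← TensorProduct.tmul_add, mul_comm q]

/-- Dual Leibniz rule: commuting a variable past `p(∂)` differentiates the symbol `p`. The induction
uses that the pairing `oddDer i r (oddVar j s)` is symmetric in the two index pairs and is a scalar,
on which `mulOp` and `diffOp` agree. -/
theorem diffOp_mul_mulOp_oddVar (i : Fin ν) (r : ℕ) (p : SymAlg ν) :
    diffOp p * mulOp (oddVar i r) = mulOp (oddVar i r) * diffOp p + diffOp (oddDer i r p) := by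
  induction p using MvPolynomial.induction_on with
  | C a =>
    have h1 : (MvPolynomial.C a : SymAlg ν) = algebraMap ℂ _ a := rfl
    rw [h1, AlgHom.commutes, Derivation.map_algebraMap, map_zero, add_zero]
    exact Algebra.commutes a _
  | add p q hp hq => rw [map_add, map_add, add_mul, mul_add, hp, hq, map_add]; abel
  | mul_X p x hp =>
    obtain ⟨j, k⟩ := x
    have h2 : diffOp (oddDer j (2 * k + 1) (oddVar i r)) = diffOp (ν := ν)
        (oddDer i r (oddVar j (2 * k + 1))) := by
      rw [oddDer_oddVar, oddDer_oddVar]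
      by_cases h : i = j ∧ r = 2 * k + 1 ∧ Odd r
      · obtain ⟨rfl, rfl, h3⟩ := h
        rfl
      · rw [if_neg h, if_neg]
        rintro ⟨rfl, rfl, h3⟩
        exact h ⟨rfl, rfl, h3⟩
    have h3 : mulOp (oddDer j (2 * k + 1) (oddVar i r)) =
        diffOp (oddDer j (2 * k + 1) (oddVar i r)) := by
      rw [oddDer_oddVar]
      split_ifs
      · have h1 : ∀ a : ℂ, (MvPolynomial.C a : SymAlg ν) = algebraMap ℂ _ a := fun _ => rfl
        rw [h1, AlgHom.commutes, AlgHom.commutes]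
      · simp
    rw [← oddVar_two_mul_add_one, map_mul, mul_assoc, diffOp_oddVar_mul_mulOp, mul_add,
      ← mul_assoc, hp, h3, h2, Derivation.leibniz, map_add, smul_eq_mul, smul_eq_mul, map_mul,
      mul_comm (oddVar j (2 * k + 1)), map_mul, add_mul, mul_assoc]
    abel

/-! ## The elementary Schur polynomials -/

/-- The exponent `2 ∑ ε_i(-n) z^n / n`, the sum over odd `n > 0`. -/
def oddExponent (i : Fin ν) : PowerSeries (SymAlg ν) :=
  PowerSeries.mk fun r => (2 / (r : ℂ)) • oddVar i r

/-- The series `E_-(ε_i, z)` as a power series over the polynomial algebra. -/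
def schurSeries (i : Fin ν) : PowerSeries (SymAlg ν) := formalExp (oddExponent i)

/-- The coefficient of `z^r` in `E_-(ε_i, z)`. -/
def schur (i : Fin ν) (r : ℤ) : SymAlg ν :=
  if r < 0 then 0 else PowerSeries.coeff r.toNat (schurSeries i)

open PowerSeries

theorem oddVar_zero (i : Fin ν) : oddVar i 0 = 0 := by simp [oddVar]

theorem constantCoeff_oddExponent (i : Fin ν) : constantCoeff (oddExponent i) = 0 := by
  rw [← coeff_zero_eq_constantCoeff_apply, oddExponent, coeff_mk, oddVar_zero, smul_zero]

theorem schur_of_neg (i : Fin ν) {r : ℤ} (hr : r < 0) : schur i r = 0 := if_pos hr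

@[simp] theorem schur_natCast (i : Fin ν) (r : ℕ) : schur i r = coeff r (schurSeries i) := by
  rw [schur, if_neg (by omega), Int.toNat_natCast]

theorem schur_zero (i : Fin ν) : schur i 0 = 1 := by
  have h := schur_natCast i 0
  rw [Nat.cast_zero] at h
  rw [h, coeff_zero_eq_constantCoeff_apply, schurSeries, constantCoeff_formalExp]

theorem X_mul_derivative_eq_mk {R : Type*} [CommRing R] (A : PowerSeries R) :
    X * d⁄dX R A = mk fun r => (r : R) * coeff r A := by
  ext1 r
  cases r with
  | zero => simp
  | succ r =>
    rw [mul_comm, coeff_succ_mul_X, coeff_derivative, coeff_mk]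
    push_cast
    ring

theorem X_mul_derivative_schurSeries (i : Fin ν) :
    X * d⁄dX (SymAlg ν) (schurSeries i) =
      mk (fun r => (2 : ℂ) • oddVar i r) * schurSeries i := by
  rw [schurSeries, derivative_formalExp (constantCoeff_oddExponent i), ← mul_assoc,
    X_mul_derivative_eq_mk]
  congr 2
  funext r
  rw [oddExponent, coeff_mk]
  have h3 : (r : SymAlg ν) = MvPolynomial.C (r : ℂ) := by simp
  rw [h3, ← MvPolynomial.smul_eq_C_mul, smul_smul]
  rcases eq_or_ne r 0 with rfl | hr
  · rw [oddVar_zero, smul_zero, smul_zero]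
  · congr 1
    have : (r : ℂ) ≠ 0 := by exact_mod_cast hr
    field_simp

theorem natCast_smul_coeff_schurSeries (i : Fin ν) (r : ℕ) :
    (r : ℂ) • coeff r (schurSeries i) = (2 : ℂ) • ∑ p ∈ Finset.HasAntidiagonal.antidiagonal r,
      oddVar i p.1 * coeff p.2 (schurSeries i) := by
  have h := congrArg (coeff r) (X_mul_derivative_schurSeries i)
  rw [X_mul_derivative_eq_mk, coeff_mk, coeff_mul] at h
  have h3 : (r : SymAlg ν) = MvPolynomial.C (r : ℂ) := by simp
  rw [h3, ← MvPolynomial.smul_eq_C_mul] at h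
  rw [h, Finset.smul_sum]
  exact Finset.sum_congr rfl fun p _ => by rw [coeff_mk, smul_mul_assoc]

theorem rescale_formalExp {R : Type*} [CommRing R] [Algebra ℂ R] (a : ℂ) (A : PowerSeries R) :
    rescale (algebraMap ℂ R a) (formalExp A) = formalExp (rescale (algebraMap ℂ R a) A) := by
  ext r
  simp only [coeff_rescale, coeff_formalExp, Finset.mul_sum]
  refine Finset.sum_congr rfl fun l _ => ?_
  rw [← map_pow (rescale _), coeff_rescale, mul_smul_comm]

theorem rescale_neg_oddExponent (i : Fin ν) (a : ℂ) :
    rescale (algebraMap ℂ (SymAlg ν) (-a)) (oddExponent i) =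
      -rescale (algebraMap ℂ (SymAlg ν) a) (oddExponent i) := by
  ext1 r
  rw [map_neg (coeff r), coeff_rescale, coeff_rescale, oddExponent, coeff_mk, oddVar]
  by_cases hr : Odd r
  · rw [map_neg, hr.neg_pow, neg_mul]
  · rw [if_neg hr]; simp

/-- The exponent is an odd function of z, so E_-(ε_i,-z) is the inverse of E_-(ε_i,z). -/
theorem schurSeries_mul_rescale (i : Fin ν) :
    schurSeries i * rescale (-1) (schurSeries i) = 1 := by
  have h1 : (-1 : SymAlg ν) = algebraMap ℂ _ (-1) := by simp
  rw [h1, schurSeries, rescale_formalExp, rescale_neg_oddExponent, map_one, rescale_one,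
    RingHom.id_apply, ← formalExp_add (constantCoeff_oddExponent i)
      (by simp [constantCoeff_oddExponent]), add_neg_cancel, formalExp_zero]

theorem sum_antidiagonal_schurSeries (i : Fin ν) (r : ℕ) :
    ∑ p ∈ Finset.HasAntidiagonal.antidiagonal r, (-1 : ℂ) ^ p.2 •
      (coeff p.1 (schurSeries i) * coeff p.2 (schurSeries i)) = if r = 0 then 1 else 0 := by
  have h := congrArg (coeff r) (schurSeries_mul_rescale i)
  rw [coeff_mul, coeff_one] at h
  rw [← h]
  refine Finset.sum_congr rfl fun p _ => ?_
  rw [coeff_rescale, MvPolynomial.smul_eq_C_mul]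
  simp only [map_pow, map_neg, map_one]
  ring

/-- These are the coefficients of S(z) times (zS')(-z), for S the Schur series: the logarithmic
derivative at -z, an odd function, times S(z)S(-z) = 1. -/
theorem sum_antidiagonal_schurSeries' (i : Fin ν) (r : ℕ) :
    ∑ p ∈ Finset.HasAntidiagonal.antidiagonal r, ((p.2 : ℂ) * (-1 : ℂ) ^ p.2) •
      (coeff p.1 (schurSeries i) * coeff p.2 (schurSeries i)) = (-2 : ℂ) • oddVar i r := by
  have h2 : rescale (-1) (mk fun r => (2 : ℂ) • oddVar i r) = mk fun r => (-2 : ℂ) • oddVar i r := by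
    ext1 n
    rw [coeff_rescale, coeff_mk, coeff_mk, oddVar]
    by_cases hn : Odd n
    · rw [hn.neg_one_pow, neg_one_mul, neg_smul]
    · rw [if_neg hn]; simp
  have h3 : schurSeries i * rescale (-1) (mk fun r => (r : SymAlg ν) * coeff r (schurSeries i)) =
      mk fun r => (-2 : ℂ) • oddVar i r := by
    rw [← X_mul_derivative_eq_mk, X_mul_derivative_schurSeries, map_mul, h2, mul_left_comm,
      schurSeries_mul_rescale, mul_one]
  have h := congrArg (coeff r) h3
  rw [coeff_mul, coeff_mk] at h
  rw [← h]
  refine Finset.sum_congr rfl fun p _ => ?_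
  rw [coeff_rescale, coeff_mk, MvPolynomial.smul_eq_C_mul]
  simp only [map_mul, map_pow, map_neg, map_one, map_natCast]
  ring

/-- A derivation D multiplies exp A by D A, and here D A is z^n because (n/2)(2/n) = 1. Rigorously,
the difference of the two sides satisfies the same first-order equation as the Schur series and has
constant term 0. -/
theorem oddDer_coeff_schurSeries (i j : Fin ν) (n : ℕ) :
    mk (fun r => oddDer i n (coeff r (schurSeries j))) =
      (if i = j ∧ Odd n then X ^ n else 0) * schurSeries j := by
  set c : PowerSeries (SymAlg ν) := if i = j ∧ Odd n then X ^ n else 0 with hc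
  set D : PowerSeries (SymAlg ν) → PowerSeries (SymAlg ν) :=
    fun F => mk fun r => oddDer i n (coeff r F) with hD
  have hmul : ∀ F G, D (F * G) = D F * G + F * D G := by
    intro F G
    ext1 r
    simp only [hD, coeff_mk, map_add, coeff_mul, map_sum, ← Finset.sum_add_distrib]
    refine Finset.sum_congr rfl fun p _ => ?_
    rw [Derivation.leibniz, smul_eq_mul, smul_eq_mul]
    ring
  have hder : ∀ F, d⁄dX (SymAlg ν) (D F) = D (d⁄dX (SymAlg ν) F) := by
    intro F
    ext1 r
    simp only [hD, coeff_mk, coeff_derivative]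
    rw [Derivation.leibniz]
    have h3 : ((r : SymAlg ν) + 1) = algebraMap ℂ _ ((r : ℂ) + 1) := by simp
    rw [h3, Derivation.map_algebraMap, smul_zero, zero_add, smul_eq_mul, mul_comm]
  have hA : D (oddExponent j) = c := by
    ext1 r
    simp only [hD, coeff_mk, oddExponent, hc]
    rw [Derivation.map_smul, oddDer_oddVar]
    by_cases h : i = j ∧ Odd n
    · rw [if_pos h, coeff_X_pow]
      by_cases hr : r = n
      · subst hr
        rw [if_pos ⟨h.1, rfl, h.2⟩, if_pos rfl, MvPolynomial.smul_eq_C_mul, ← map_mul]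
        have : (r : ℂ) ≠ 0 := by exact_mod_cast h.2.pos.ne'
        rw [← map_one MvPolynomial.C]
        congr 1
        field_simp
      · rw [if_neg (fun h' => hr h'.2.1.symm), if_neg hr, smul_zero]
    · rw [if_neg (fun h' => h ⟨h'.1, h'.2.2⟩), if_neg h, smul_zero, map_zero]
  have h := derivative_formalExp (constantCoeff_oddExponent j)
  change d⁄dX _ (schurSeries j) = _ * schurSeries j at h
  have key : D (schurSeries j) - c * schurSeries j = 0 := by
    refine eq_of_derivative_eq_mul (G := d⁄dX _ (oddExponent j)) ?_ ?_ (by simp)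
    · have h1 : constantCoeff (D (schurSeries j)) = 0 := by
        rw [← coeff_zero_eq_constantCoeff_apply]
        simp only [hD, coeff_mk]
        rw [coeff_zero_eq_constantCoeff_apply, schurSeries, constantCoeff_formalExp,
          Derivation.map_one_eq_zero]
      have h2 : constantCoeff c = 0 := by
        rw [hc]
        split_ifs with h'
        · simp [h'.2.pos.ne']
        · simp
      rw [map_sub, map_mul, h1, h2]; simp
    · rw [map_sub, hder, h, hmul, ← hder, hA, Derivation.leibniz, smul_eq_mul, smul_eq_mul, h]
      ring
  exact sub_eq_zero.1 key

theorem oddDer_schur (i j : Fin ν) (n : ℕ) (r : ℤ) :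
    oddDer i n (schur j r) = if i = j ∧ Odd n then schur j (r - n) else 0 := by
  rcases lt_or_ge r 0 with hr | hr
  · rw [schur_of_neg j hr, schur_of_neg j (r := r - n) (by omega), map_zero, ite_self]
  · lift r to ℕ using hr
    have h := congrArg (coeff r) (oddDer_coeff_schurSeries i j n)
    rw [coeff_mk] at h
    rw [schur_natCast, h]
    split_ifs
    · rw [coeff_X_pow_mul']
      split_ifs with hn
      · have : ((r : ℤ) - n) = ((r - n : ℕ) : ℤ) := by omega
        rw [this, schur_natCast]
      · rw [schur_of_neg j (by omega)]
    · simp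

end Schur


/-! ## Annihilation operators and normal ordering -/

section Euler

open PowerSeries

variable {R : Type*} [Ring R] [Algebra ℂ R]

/-- The Euler operator `z d/dz` on power series over a not necessarily commutative algebra. -/
def eulerOp (F : PowerSeries R) : PowerSeries R := mk fun r => (r : ℂ) • coeff r F

theorem eulerOp_mul (F G : PowerSeries R) : eulerOp (F * G) = eulerOp F * G + F * eulerOp G := by
  ext1 r
  simp only [eulerOp, coeff_mk, map_add, coeff_mul, Finset.smul_sum, ← Finset.sum_add_distrib]
  refine Finset.sum_congr rfl fun p hp => ?_
  rw [← Finset.HasAntidiagonal.mem_antidiagonal.1 hp, smul_mul_assoc, mul_smul_comm, ← add_smul]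
  push_cast
  rfl

/-- Uniqueness over noncommutative coefficients. Since `H` has no constant term, degree `r` of `H *
F` involves only lower degrees of `F`. -/
theorem eq_of_eulerOp_eq {F F' H : PowerSeries R} (hH : coeff 0 H = 0)
    (h0 : coeff 0 F = coeff 0 F') (h : eulerOp F = H * F) (h' : eulerOp F' = H * F') : F = F' := by
  ext1 r
  induction r using Nat.strong_induction_on with
  | _ r ih =>
    rcases eq_or_ne r 0 with rfl | hr
    · exact h0
    · have h1 := congrArg (coeff r) h
      have h2 := congrArg (coeff r) h'
      simp only [eulerOp, coeff_mk, coeff_mul] at h1 h2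
      have h3 : (r : ℂ) • coeff r F = (r : ℂ) • coeff r F' := by
        rw [h1, h2]
        refine Finset.sum_congr rfl fun p hp => ?_
        have hp' := Finset.HasAntidiagonal.mem_antidiagonal.1 hp
        rcases eq_or_ne p.1 0 with h4 | h4
        · rw [h4, hH, zero_mul, zero_mul]
        · rw [ih p.2 (by omega)]
      exact smul_right_injective R (show (r : ℂ) ≠ 0 by exact_mod_cast hr) h3

/-- Moving a series which solves `z dT/dz = H T` past an element `x`. -/
theorem mul_C_eq_of_eulerOp {T H L : PowerSeries R} {x : R} (hH : coeff 0 H = 0)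
    (hT0 : coeff 0 T = 1) (hL0 : coeff 0 L = x) (hT : eulerOp T = H * T)
    (hL : eulerOp L = H * L - L * H) : T * C x = L * T := by
  refine eq_of_eulerOp_eq hH ?_ ?_ ?_
  · rw [coeff_mul_C, coeff_mul]
    simp [hT0, hL0]
  · have h1 : eulerOp (C x) = 0 := by
      ext1 r
      simp only [eulerOp, coeff_mk, coeff_C]
      split_ifs with h
      · simp [h]
      · simp
    rw [eulerOp_mul, hT, h1, mul_zero, add_zero, mul_assoc]
  · rw [eulerOp_mul, hT, hL, sub_mul, mul_assoc, mul_assoc, sub_add_cancel]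

end Euler

/-! ### Modes of E_+ and their exchange relation with E_- -/

section Tau

variable {ν : ℕ}

/-- The coefficient of `z^(-s)` in `E_+(ε_i, z)`. -/
def tau (i : Fin ν) (s : ℤ) : Module.End ℂ (Fock ν) := ((-1 : ℂ) ^ s) • diffOp (schur i s)

theorem tau_of_neg (i : Fin ν) {s : ℤ} (hs : s < 0) : tau i s = 0 := by
  rw [tau, schur_of_neg i hs, map_zero, smul_zero]

theorem tau_zero (i : Fin ν) : tau i 0 = 1 := by
  rw [tau, schur_zero, map_one, zpow_zero, one_smul]

theorem tau_comm (i j : Fin ν) (s t : ℤ) : tau i s * tau j t = tau j t * tau i s := by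
  simp only [tau, smul_mul_smul_comm, ← map_mul]
  rw [mul_comm (schur i s), mul_comm ((-1 : ℂ) ^ s)]

/-- The coefficients of `(1 - x) / (1 + x)` if `i = j` and of `1` otherwise. -/
def pairCoeff (i j : Fin ν) (t : ℤ) : ℂ :=
  if t < 0 then 0 else if t = 0 then 1 else if i = j then 2 * (-1) ^ t else 0

theorem pairCoeff_of_neg (i j : Fin ν) {t : ℤ} (ht : t < 0) : pairCoeff i j t = 0 := if_pos ht

theorem pairCoeff_zero (i j : Fin ν) : pairCoeff i j 0 = 1 := by simp [pairCoeff]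

theorem pairCoeff_of_ne {i j : Fin ν} (h : i ≠ j) (t : ℤ) :
    pairCoeff i j t = if t = 0 then 1 else 0 := by
  unfold pairCoeff
  by_cases ht : t = 0
  · subst ht; simp
  · simp [h, ht]

/-- Coefficients of x d/dx log((1-x)/(1+x)) = -2(x + x³ + x⁵ + ⋯). The odd weights are invariant
under a shift by two, whence the two-step induction. -/
theorem pairCoeff_rec (i j : Fin ν) (s : ℕ) : (s : ℂ) * pairCoeff i j s =
    -2 * ∑ p ∈ Finset.HasAntidiagonal.antidiagonal s,
      (if i = j ∧ Odd p.1 then 1 else 0) * pairCoeff i j (p.2 : ℕ) := by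
  by_cases h : i = j
  swap
  · have h1 : ∀ a : ℕ, (if i = j ∧ Odd a then (1 : ℂ) else 0) = 0 :=
      fun a => if_neg fun h' => h h'.1
    simp only [h1, zero_mul, Finset.sum_const_zero, mul_zero, pairCoeff_of_ne h]
    rcases eq_or_ne s 0 with rfl | hs
    · simp
    · simp [hs]
  subst h
  have hf : ∀ b : ℕ, pairCoeff i i ((b + 1 : ℕ) : ℤ) = 2 * (-1) ^ (b + 1) := by
    intro b
    unfold pairCoeff
    rw [if_neg (by omega), if_neg (by omega), if_pos rfl, zpow_natCast]
  simp only [true_and]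
  induction s using Nat.twoStepInduction with
  | zero => simp
  | one =>
    rw [Finset.Nat.sum_antidiagonal_succ, Finset.Nat.antidiagonal_zero, Finset.sum_singleton]
    rw [hf 0]
    simp [pairCoeff_zero]
  | more s ih _ =>
    rw [Finset.Nat.sum_antidiagonal_succ, Finset.Nat.sum_antidiagonal_succ]
    have h2 : ∀ a : ℕ, Odd (a + 1 + 1) ↔ Odd a := fun a => by
      rw [Nat.odd_add_one, Nat.odd_add_one, not_not]
    simp only [h2]
    have h3 : -2 * (∑ p ∈ Finset.HasAntidiagonal.antidiagonal s,
        (if Odd p.1 then (1 : ℂ) else 0) * pairCoeff i i (p.2 : ℕ)) = 2 * s * (-1) ^ s := by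
      rw [← ih]
      rcases s with _ | s
      · simp
      · rw [hf]; ring
    rw [hf, hf, mul_add, mul_add, h3]
    simp
    ring

theorem tau_rec (i : Fin ν) (s : ℕ) : (s : ℂ) • tau i s =
    (-2 : ℂ) • ∑ p ∈ Finset.HasAntidiagonal.antidiagonal s,
      diffOp (oddVar i p.1) * tau i (p.2 : ℕ) := by
  have h := congrArg diffOp (natCast_smul_coeff_schurSeries i s)
  rw [map_smul, map_smul, map_sum, ← schur_natCast] at h
  rw [tau, smul_comm, h, smul_comm, Finset.smul_sum, Finset.smul_sum, Finset.smul_sum]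
  refine Finset.sum_congr rfl fun p hp => ?_
  rw [map_mul, tau, schur_natCast, mul_smul_comm, smul_smul, smul_smul,
    ← Finset.HasAntidiagonal.mem_antidiagonal.1 hp]
  by_cases h1 : Odd p.1
  · congr 1
    rw [zpow_natCast, zpow_natCast, pow_add, h1.neg_one_pow]
    ring
  · rw [oddVar, if_neg h1, map_zero, zero_mul, smul_zero, smul_zero]

/-- The exchange relation E_+(ε_i,z)E_-(ε_j,w) = c(w/z) E_-(ε_j,w)E_+(ε_i,z), with c = 1 for i ≠ j.
The series `L` is the candidate for the conjugate of `mulOp (schur j r)` by `T`; its equation zL' =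
[H,L] comes down to `pairCoeff_rec`, because ε_i(n) lowers the index of `schur` by n when i = j and
n is odd. -/
theorem tau_mul_mulOp_schur_natCast (i j : Fin ν) (s : ℕ) (r : ℤ) :
    tau i s * mulOp (schur j r) = ∑ p ∈ Finset.HasAntidiagonal.antidiagonal s,
      pairCoeff i j (p.1 : ℕ) • (mulOp (schur j (r - (p.1 : ℕ))) * tau i (p.2 : ℕ)) := by
  set T : PowerSeries (Module.End ℂ (Fock ν)) := PowerSeries.mk fun s => tau i s with hT
  set H : PowerSeries (Module.End ℂ (Fock ν)) :=
    PowerSeries.mk fun s => (-2 : ℂ) • diffOp (oddVar i s) with hH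
  set L : PowerSeries (Module.End ℂ (Fock ν)) :=
    PowerSeries.mk fun s => pairCoeff i j s • mulOp (schur j (r - s)) with hL
  have key : T * PowerSeries.C (mulOp (schur j r)) = L * T := by
    refine mul_C_eq_of_eulerOp (H := H) ?_ ?_ ?_ ?_ ?_
    · rw [hH, PowerSeries.coeff_mk, oddVar_zero, map_zero, smul_zero]
    · rw [hT, PowerSeries.coeff_mk, Nat.cast_zero, tau_zero]
    · rw [hL, PowerSeries.coeff_mk, Nat.cast_zero, pairCoeff_zero, one_smul, sub_zero]
    · ext1 s
      rw [eulerOp, PowerSeries.coeff_mk, PowerSeries.coeff_mul, hT, PowerSeries.coeff_mk, tau_rec,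
        Finset.smul_sum]
      exact Finset.sum_congr rfl fun p _ => by
        rw [hH, PowerSeries.coeff_mk, PowerSeries.coeff_mk, smul_mul_assoc]
    · ext1 s
      have h1 : PowerSeries.coeff s (L * H) = ∑ p ∈ Finset.HasAntidiagonal.antidiagonal s,
          PowerSeries.coeff p.2 L * PowerSeries.coeff p.1 H := by
        rw [PowerSeries.coeff_mul, ← Finset.Nat.sum_antidiagonal_swap]
        rfl
      rw [map_sub, h1, PowerSeries.coeff_mul, ← Finset.sum_sub_distrib, eulerOp,
        PowerSeries.coeff_mk, hL, PowerSeries.coeff_mk, smul_smul, pairCoeff_rec, Finset.mul_sum,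
        Finset.sum_smul]
      refine Finset.sum_congr rfl fun p hp => ?_
      rw [hH, PowerSeries.coeff_mk, PowerSeries.coeff_mk, smul_mul_smul_comm, smul_mul_smul_comm,
        diffOp_oddVar_mul_mulOp, oddDer_schur, smul_add, mul_comm (pairCoeff i j _) (-2 : ℂ),
        add_sub_cancel_left, ← Finset.HasAntidiagonal.mem_antidiagonal.1 hp]
      by_cases h : i = j ∧ Odd p.1
      · rw [if_pos h, if_pos h, one_mul]
        congr 3
        push_cast
        ring
      · rw [if_neg h, if_neg h, zero_mul, mul_zero, zero_smul, map_zero, smul_zero]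
  have h := congrArg (PowerSeries.coeff s) key
  rw [PowerSeries.coeff_mul_C, hT, PowerSeries.coeff_mk, PowerSeries.coeff_mul] at h
  rw [h]
  exact Finset.sum_congr rfl fun p _ => by
    rw [hL, PowerSeries.coeff_mk, PowerSeries.coeff_mk, smul_mul_assoc]

theorem tau_mulOp_schur_apply (i j : Fin ν) (s r : ℤ) (v : Fock ν) :
    tau i s (mulOp (schur j r) v) =
      ∑ᶠ t : ℤ, pairCoeff i j t • mulOp (schur j (r - t)) (tau i (s - t) v) := by
  rcases lt_or_ge s 0 with hs | hs
  · rw [tau_of_neg i hs, LinearMap.zero_apply, finsum_eq_zero_of_forall_eq_zero]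
    intro t
    rcases lt_or_ge t 0 with ht | ht
    · rw [pairCoeff_of_neg i j ht, zero_smul]
    · rw [tau_of_neg i (show s - t < 0 by omega), LinearMap.zero_apply, map_zero, smul_zero]
  · lift s to ℕ using hs
    have h := LinearMap.congr_fun (tau_mul_mulOp_schur_natCast i j s r) v
    rw [Module.End.mul_apply] at h
    rw [h, Finset.Nat.sum_antidiagonal_eq_sum_range_succ_mk, LinearMap.sum_apply]
    rw [finsum_eq_sum_of_support_subset (s := (Finset.range (s + 1)).map Nat.castEmbedding),
      Finset.sum_map]
    · refine Finset.sum_congr rfl fun t ht => ?_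
      have h2 : ((s - t : ℕ) : ℤ) = (s : ℤ) - t := by
        have := Finset.mem_range.1 ht; omega
      simp only [h2, Nat.castEmbedding_apply, LinearMap.smul_apply, Module.End.mul_apply]
    · intro t ht
      rw [Function.mem_support] at ht
      have h0 : 0 ≤ t := by
        by_contra h0
        exact ht (by rw [pairCoeff_of_neg i j (by omega), zero_smul])
      have h1 : t ≤ s := by
        by_contra h1
        exact ht (by rw [tau_of_neg i (by omega), LinearMap.zero_apply, map_zero, smul_zero])
      lift t to ℕ using h0
      simp only [Finset.coe_map, Set.mem_image, Finset.mem_coe, Finset.mem_range]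
      exact ⟨t, by omega, rfl⟩

theorem tau_mul_mulOp_oddVar (i j : Fin ν) (s : ℤ) (n : ℕ) :
    tau i s * mulOp (oddVar j n) = mulOp (oddVar j n) * tau i s -
      if j = i ∧ Odd n then tau i (s - n) else 0 := by
  rw [tau, smul_mul_assoc, diffOp_mul_mulOp_oddVar, oddDer_schur, smul_add, mul_smul_comm]
  split_ifs with h
  · have h1 : (-1 : ℂ) ^ (s - n) = -(-1) ^ s := by
      rw [zpow_sub₀ (by norm_num), zpow_natCast, h.2.neg_one_pow, div_neg, div_one]
    refine LinearMap.ext fun v => ?_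
    rw [tau, h1, LinearMap.add_apply, LinearMap.sub_apply, LinearMap.smul_apply (-(-1) ^ s),
      neg_smul, sub_neg_eq_add, LinearMap.smul_apply _ (diffOp _)]
  · rw [map_zero, smul_zero, add_zero, sub_zero]

theorem diffOp_oddVar_one (i : Fin ν) (r : ℕ) (g : GroupAlg ν) :
    diffOp (oddVar i r) (g ⊗ₜ (1 : SymAlg ν)) = 0 := by
  rw [diffOp_oddVar_tmul, Derivation.map_one_eq_zero, TensorProduct.tmul_zero]

theorem tau_tmul_one (i : Fin ν) {s : ℤ} (hs : s ≠ 0) (g : GroupAlg ν) :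
    tau i s (g ⊗ₜ (1 : SymAlg ν)) = 0 := by
  rcases lt_or_ge s 0 with h | h
  · rw [tau_of_neg i h, LinearMap.zero_apply]
  · lift s to ℕ using h
    have hs' : (s : ℂ) ≠ 0 := by exact_mod_cast hs
    induction s using Nat.strong_induction_on with
    | _ s ih =>
      have h1 := LinearMap.congr_fun (tau_rec i s) (g ⊗ₜ (1 : SymAlg ν))
      rw [LinearMap.smul_apply, LinearMap.smul_apply, LinearMap.sum_apply,
        Finset.sum_eq_zero, smul_zero] at h1
      · exact (smul_eq_zero.1 h1).resolve_left hs'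
      · intro p hp
        have hp' := Finset.HasAntidiagonal.mem_antidiagonal.1 hp
        rw [Module.End.mul_apply]
        rcases eq_or_ne p.2 0 with h2 | h2
        · rw [h2, Nat.cast_zero, tau_zero]
          exact diffOp_oddVar_one _ _ _
        · rcases eq_or_ne p.1 0 with h3 | h3
          · rw [h3, oddVar_zero, map_zero, LinearMap.zero_apply]
          · rw [ih p.2 (by omega) (by exact_mod_cast h2) (by exact_mod_cast h2), map_zero]

/-- Multiplication by ε_j(-n) raises the bound by at most n, by `tau_mul_mulOp_oddVar`. This local
nilpotence is what makes the `finsum`s of modes honest finite sums. -/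
theorem exists_tau_eq_zero (v : Fock ν) : ∃ d : ℤ, ∀ i s, d < s → tau i s v = 0 := by
  induction v using TensorProduct.induction_on with
  | zero => exact ⟨0, fun i s _ => map_zero _⟩
  | add v w hv hw =>
    obtain ⟨d, hd⟩ := hv
    obtain ⟨e, he⟩ := hw
    refine ⟨max d e, fun i s hs => ?_⟩
    rw [map_add, hd i s (lt_of_le_of_lt (le_max_left _ _) hs),
      he i s (lt_of_le_of_lt (le_max_right _ _) hs), add_zero]
  | tmul g p =>
    induction p using MvPolynomial.induction_on with
    | C a =>
      refine ⟨0, fun i s hs => ?_⟩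
      have h1 : (MvPolynomial.C a : SymAlg ν) = a • 1 := by
        rw [MvPolynomial.smul_eq_C_mul, mul_one]
      rw [h1, TensorProduct.tmul_smul, map_smul, tau_tmul_one i hs.ne', smul_zero]
    | add p q hp hq =>
      obtain ⟨d, hd⟩ := hp
      obtain ⟨e, he⟩ := hq
      refine ⟨max d e, fun i s hs => ?_⟩
      rw [TensorProduct.tmul_add, map_add, hd i s (lt_of_le_of_lt (le_max_left _ _) hs),
        he i s (lt_of_le_of_lt (le_max_right _ _) hs), add_zero]
    | mul_X p x hp =>
      obtain ⟨d, hd⟩ := hp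
      obtain ⟨j, k⟩ := x
      refine ⟨d + (2 * k + 1 : ℕ), fun i s hs => ?_⟩
      have h1 : g ⊗ₜ[ℂ] (p * MvPolynomial.X (j, k)) =
          mulOp (oddVar j (2 * k + 1)) (g ⊗ₜ[ℂ] p) := by
        rw [mulOp_tmul, oddVar_two_mul_add_one, mul_comm]
      rw [h1, ← Module.End.mul_apply, tau_mul_mulOp_oddVar, LinearMap.sub_apply,
        Module.End.mul_apply, hd i s (by omega), map_zero, zero_sub, neg_eq_zero]
      split_ifs
      · exact hd i _ (by omega)
      · rfl

end Tau


/-! ## The group algebra part -/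

section Group

variable {ν : ℕ}

theorem latticeCocycle_single (i j : Fin ν) :
    (latticeCocycle ν).toFun (epsBar ν i) (epsBar ν j) = epsSign ν i j := by
  change ∏ k, ∏ l, epsSign ν k l ^ ((epsBar ν i k).val * (epsBar ν j l).val) = _
  rw [Finset.prod_eq_single i, Finset.prod_eq_single j]
  · simp [epsBar, ZMod.val_one]
  · intro l _ hl; simp [epsBar, hl]
  · simp
  · intro k _ hk; simp [epsBar, hk]
  · simp

theorem epsBar_add_self (i : Fin ν) : epsBar ν i + epsBar ν i = 0 := by
  funext k
  exact CharTwo.add_self_eq_zero _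

theorem epsSign_self (i : Fin ν) : epsSign ν i i = 1 := by simp [epsSign]

theorem epsSign_add_epsSign {i j : Fin ν} (h : i ≠ j) : epsSign ν i j + epsSign ν j i = 0 := by
  unfold epsSign
  rcases lt_or_gt_of_ne h with h | h
  · rw [if_pos h.le, if_neg (not_le.2 h)]; norm_num
  · rw [if_neg (not_le.2 h), if_pos h.le]; norm_num

/-- The basis element `e^(ε_i)` of the group algebra. -/
def eps (i : Fin ν) : GroupAlg ν := e (latticeCocycle ν) (epsBar ν i)

theorem eps_mul_eps (i j : Fin ν) :
    eps i * eps j = epsSign ν i j • e (latticeCocycle ν) (epsBar ν i + epsBar ν j) := by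
  rw [eps, eps, e_mul_e, latticeCocycle_single]

theorem eps_mul_self (i : Fin ν) : eps i * eps i = 1 := by
  rw [eps_mul_eps, epsBar_add_self, epsSign_self, one_smul]; rfl

theorem eps_anticomm {i j : Fin ν} (h : i ≠ j) : eps i * eps j + eps j * eps i = 0 := by
  rw [eps_mul_eps, eps_mul_eps, add_comm (epsBar ν j), ← add_smul, epsSign_add_epsSign h, zero_smul]

/-- Modulo 2Γ a difference is a sum, so the sign and the lattice element in X_ij combine to a
product of two Clifford generators. -/
theorem epsSign_smul_e_sub (i j : Fin ν) :
    epsSign ν i j • e (latticeCocycle ν) (epsBar ν i - epsBar ν j) = eps i * eps j := by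
  rw [eps_mul_eps]
  congr 2
  funext k
  exact CharTwo.sub_eq_add _ _

/-- The action of an element of the group algebra on the Fock space. -/
def leftOp (x : GroupAlg ν) : Module.End ℂ (Fock ν) :=
  LinearMap.rTensor (SymAlg ν) (LinearMap.mulLeft ℂ x)

@[simp] theorem leftOp_tmul (x g : GroupAlg ν) (p : SymAlg ν) :
    leftOp x (g ⊗ₜ p) = (x * g) ⊗ₜ p := rfl

theorem leftOp_mul_apply (x y : GroupAlg ν) (v : Fock ν) :
    leftOp (x * y) v = leftOp x (leftOp y v) := by
  have h : leftOp (x * y) = leftOp x * leftOp y := fock_hom_ext fun g p => by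
    rw [Module.End.mul_apply, leftOp_tmul, leftOp_tmul, leftOp_tmul, mul_assoc]
  rw [h, Module.End.mul_apply]

theorem leftOp_one_apply (v : Fock ν) : leftOp 1 v = v := by
  have h : leftOp (ν := ν) 1 = LinearMap.id := fock_hom_ext fun g p => by
    rw [leftOp_tmul, one_mul, LinearMap.id_apply]
  rw [h, LinearMap.id_apply]

theorem leftOp_add_apply (x y : GroupAlg ν) (v : Fock ν) :
    leftOp (x + y) v = leftOp x v + leftOp y v := by
  have h : leftOp (x + y) = leftOp x + leftOp y := fock_hom_ext fun g p => by
    rw [LinearMap.add_apply, leftOp_tmul, leftOp_tmul, leftOp_tmul, add_mul, TensorProduct.add_tmul]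
  rw [h, LinearMap.add_apply]

theorem leftOp_smul_apply (c : ℂ) (x : GroupAlg ν) (v : Fock ν) :
    leftOp (c • x) v = c • leftOp x v := by
  have h : leftOp (c • x) = c • leftOp x := fock_hom_ext fun g p => by
    rw [LinearMap.smul_apply, leftOp_tmul, leftOp_tmul, smul_mul_assoc, TensorProduct.smul_tmul']
  rw [h, LinearMap.smul_apply]

theorem leftOp_lTensor (x : GroupAlg ν) (T : Module.End ℂ (SymAlg ν)) (v : Fock ν) :
    leftOp x (LinearMap.lTensor (GroupAlg ν) T v) =
      LinearMap.lTensor (GroupAlg ν) T (leftOp x v) := by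
  rw [leftOp, ← LinearMap.comp_apply, LinearMap.rTensor_comp_lTensor,
    ← LinearMap.lTensor_comp_rTensor]
  rfl

theorem leftOp_mulOp (x : GroupAlg ν) (p : SymAlg ν) (v : Fock ν) :
    leftOp x (mulOp p v) = mulOp p (leftOp x v) := leftOp_lTensor x _ v

theorem leftOp_diffOp (x : GroupAlg ν) (p : SymAlg ν) (v : Fock ν) :
    leftOp x (diffOp p v) = diffOp p (leftOp x v) := leftOp_lTensor x _ v

theorem leftOp_tau (x : GroupAlg ν) (i : Fin ν) (s : ℤ) (v : Fock ν) :
    leftOp x (tau i s v) = tau i s (leftOp x v) := by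
  rw [tau, LinearMap.smul_apply, map_smul, leftOp_diffOp, LinearMap.smul_apply]

end Group

/-! ## Finite sums over the integers -/

section FiniteSupport

theorem hasFiniteSupport_of_mem_Icc {ι M : Type*} [Preorder ι] [LocallyFiniteOrder ι] [Zero M]
    {f : ι → M} (a b : ι) (h : ∀ x, f x ≠ 0 → a ≤ x ∧ x ≤ b) : f.HasFiniteSupport :=
  (Set.finite_Icc a b).subset fun x hx => h x hx

theorem exists_ne_zero_of_finsum_ne_zero {ι M : Type*} [AddCommMonoid M] {f : ι → M}
    (h : ∑ᶠ x, f x ≠ 0) : ∃ x, f x ≠ 0 := by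
  by_contra! h'
  exact h (finsum_eq_zero_of_forall_eq_zero h')

end FiniteSupport

/-! ## The twisted neutral fermions -/

section Fermion

variable {ν : ℕ}

theorem schur_nonneg {i : Fin ν} {r : ℤ} {v : Fock ν} (h : mulOp (schur i r) v ≠ 0) : 0 ≤ r := by
  by_contra h'
  exact h (by rw [schur_of_neg i (by omega), map_zero, LinearMap.zero_apply])

theorem tau_nonneg {i : Fin ν} {r : ℤ} {v : Fock ν} (h : tau i r v ≠ 0) : 0 ≤ r := by
  by_contra h'
  exact h (by rw [tau_of_neg i (by omega), LinearMap.zero_apply])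

theorem arg_ne_zero {M N : Type*} [AddCommMonoid M] [Module ℂ M] [AddCommMonoid N] [Module ℂ N]
    {f : M →ₗ[ℂ] N} {v : M} (h : f v ≠ 0) : v ≠ 0 := by
  rintro rfl
  exact h (map_zero f)

/-- Annihilation operators commute, so either of the two can be made to act first. -/
theorem tau_tau_le {d : ℤ} {v : Fock ν} (hd : ∀ i s, d < s → tau i s v = 0) {i j : Fin ν} {s t : ℤ}
    (h : tau i s (tau j t v) ≠ 0) : s ≤ d ∧ t ≤ d := by
  constructor
  · by_contra h'
    refine h ?_
    rw [← Module.End.mul_apply, tau_comm, Module.End.mul_apply, hd i s (by omega), map_zero]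
  · by_contra h'
    exact h (by rw [hd j t (by omega), map_zero])

/-- The coefficient of `z^(-k)` in `E_-(ε_i, z) E_+(ε_i, z)`. -/
def halfVertex (i : Fin ν) (k : ℤ) : Module.End ℂ (Fock ν) where
  toFun v := ∑ᶠ r : ℤ, mulOp (schur i r) (tau i (k + r) v)
  map_add' v w := by
    have h : ∀ v : Fock ν,
        (fun r : ℤ => mulOp (schur i r) (tau i (k + r) v)).HasFiniteSupport := by
      intro v
      obtain ⟨d, hd⟩ := exists_tau_eq_zero v
      refine hasFiniteSupport_of_mem_Icc 0 (d - k) fun r hr => ⟨schur_nonneg hr, ?_⟩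
      by_contra h'
      exact arg_ne_zero hr (hd _ _ (by omega))
    rw [← finsum_add_distrib (h v) (h w)]
    exact finsum_congr fun r => by rw [map_add, map_add]
  map_smul' c v := by
    rw [RingHom.id_apply, smul_finsum]
    exact finsum_congr fun r => by rw [map_smul, map_smul]

theorem halfVertex_apply (i : Fin ν) (k : ℤ) (v : Fock ν) :
    halfVertex i k v = ∑ᶠ r : ℤ, mulOp (schur i r) (tau i (k + r) v) := rfl

theorem halfVertex_eq_zero {d : ℤ} {v : Fock ν} (hd : ∀ i s, d < s → tau i s v = 0) (i : Fin ν)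
    {k : ℤ} (hk : d < k) : halfVertex i k v = 0 := by
  rw [halfVertex_apply]
  refine finsum_eq_zero_of_forall_eq_zero fun r => ?_
  by_contra h
  exact arg_ne_zero h (hd _ _ (by have := schur_nonneg h; omega))

theorem leftOp_halfVertex (x : GroupAlg ν) (i : Fin ν) (k : ℤ) (v : Fock ν) :
    leftOp x (halfVertex i k v) = halfVertex i k (leftOp x v) := by
  obtain ⟨d, hd⟩ := exists_tau_eq_zero v
  rw [halfVertex_apply, halfVertex_apply, map_finsum]
  · exact finsum_congr fun r => by rw [leftOp_mulOp, leftOp_tau]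
  · refine hasFiniteSupport_of_mem_Icc 0 (d - k) fun r hr => ⟨schur_nonneg hr, ?_⟩
    by_contra h'
    exact arg_ne_zero hr (hd _ _ (by omega))

/-- The coefficient of `z^(-k) w^(-l)` in
`E_-(ε_i, z) E_-(ε_j, w) E_+(ε_i, z) E_+(ε_j, w)`, evaluated at a vector. -/
def normalPair (i j : Fin ν) (k l : ℤ) (v : Fock ν) : Fock ν :=
  ∑ᶠ x : ℤ × ℤ, mulOp (schur i x.1) (mulOp (schur j x.2) (tau i (k + x.1) (tau j (l + x.2) v)))

theorem normalPair_eq_zero {d : ℤ} {v : Fock ν} (hd : ∀ i s, d < s → tau i s v = 0)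
    (i j : Fin ν) {k l : ℤ} (hkl : d < k ∨ d < l) : normalPair i j k l v = 0 := by
  refine finsum_eq_zero_of_forall_eq_zero fun x => ?_
  by_contra h
  have h1 := schur_nonneg h
  have h2 := schur_nonneg (arg_ne_zero h)
  have h3 := tau_tau_le hd (arg_ne_zero (arg_ne_zero h))
  omega

theorem mulOp_comm (p q : SymAlg ν) (v : Fock ν) : mulOp p (mulOp q v) = mulOp q (mulOp p v) := by
  rw [← Module.End.mul_apply, ← map_mul, mul_comm, map_mul, Module.End.mul_apply]

theorem normalPair_symm (i j : Fin ν) (k l : ℤ) (v : Fock ν) :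
    normalPair i j k l v = normalPair j i l k v := by
  unfold normalPair
  rw [← finsum_comp_equiv (Equiv.prodComm ℤ ℤ)]
  refine finsum_congr fun x => ?_
  rw [mulOp_comm, ← Module.End.mul_apply (tau i _), tau_comm]
  rfl

theorem normalPair_support {d : ℤ} {v : Fock ν} (hd : ∀ i s, d < s → tau i s v = 0)
    (i j : Fin ν) (k l : ℤ) (c : ℤ → ℂ) :
    (fun t : ℤ => c t • normalPair i j (k - t) (l + t) v).HasFiniteSupport := by
  refine hasFiniteSupport_of_mem_Icc (k - d) (d - l) fun t ht => ?_
  by_contra h'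
  refine ht ?_
  rw [normalPair_eq_zero hd i j (by omega), smul_zero]

/-- Only the inner pair, E_+ of the left factor and E_- of the right one, has to be exchanged, at
the cost of `pairCoeff`. -/
theorem halfVertex_halfVertex (i j : Fin ν) (k l : ℤ) (v : Fock ν) :
    halfVertex i k (halfVertex j l v) =
      ∑ᶠ t : ℤ, pairCoeff i j t • normalPair i j (k - t) (l + t) v := by
  obtain ⟨d, hd⟩ := exists_tau_eq_zero v
  set F : ℤ × ℤ × ℤ → Fock ν := fun y => pairCoeff i j y.1 •
    mulOp (schur i y.2.1) (mulOp (schur j y.2.2)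
      (tau i (k - y.1 + y.2.1) (tau j (l + y.1 + y.2.2) v))) with hF
  have hFs : F.HasFiniteSupport := by
    refine hasFiniteSupport_of_mem_Icc (0, 0, 0) (d - l, 2 * d - k - l, d - l) ?_
    rintro ⟨t, r, r'⟩ h
    simp only [hF] at h
    have h0 : 0 ≤ t := by
      by_contra h0
      exact h (by rw [pairCoeff_of_neg i j (by omega), zero_smul])
    have h := right_ne_zero_of_smul h
    have h1 := schur_nonneg h
    have h2 := schur_nonneg (arg_ne_zero h)
    have h3 := tau_tau_le hd (arg_ne_zero (arg_ne_zero h))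
    simp only [Prod.mk_le_mk]
    omega
  have hR : ∑ᶠ t : ℤ, pairCoeff i j t • normalPair i j (k - t) (l + t) v = ∑ᶠ y, F y := by
    rw [finsum_curry F hFs]
    refine finsum_congr fun t => ?_
    rw [normalPair, smul_finsum]
  have hL : halfVertex i k (halfVertex j l v) =
      ∑ᶠ (r : ℤ) (r' : ℤ) (t : ℤ), F (t, r, r' - t) := by
    rw [halfVertex_apply]
    refine finsum_congr fun r => ?_
    rw [halfVertex_apply, map_finsum, map_finsum]
    · refine finsum_congr fun r' => ?_
      rw [tau_mulOp_schur_apply, map_finsum]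
      · refine finsum_congr fun t => ?_
        simp only [hF]
        rw [map_smul, show k - t + r = k + r - t by ring, show l + t + (r' - t) = l + r' by ring]
      · refine hasFiniteSupport_of_mem_Icc 0 (k + r) fun t ht => ?_
        have h := right_ne_zero_of_smul ht
        have h2 := tau_nonneg (arg_ne_zero h)
        refine ⟨?_, by omega⟩
        by_contra h0
        exact ht (by rw [pairCoeff_of_neg i j (by omega), zero_smul])
    · refine hasFiniteSupport_of_mem_Icc 0 (d - l) fun r' h => ?_
      have h := arg_ne_zero h
      have h1 := schur_nonneg h
      refine ⟨h1, ?_⟩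
      by_contra h'
      exact arg_ne_zero h (hd _ _ (by omega))
    · refine hasFiniteSupport_of_mem_Icc 0 (d - l) fun r' h => ?_
      have h1 := schur_nonneg h
      refine ⟨h1, ?_⟩
      by_contra h'
      exact arg_ne_zero h (hd _ _ (by omega))
  -- The left side sums over (r, r', t) with creation index r' - t in the second factor; the
  -- bijection absorbs this shift.
  let E : ℤ × ℤ × ℤ ≃ ℤ × ℤ × ℤ :=
    { toFun := fun y => (y.2.2, y.1, y.2.1 - y.2.2)
      invFun := fun y => (y.2.1, y.2.2 + y.1, y.1)
      left_inv := fun y => by ext <;> simp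
      right_inv := fun y => by ext <;> simp }
  rw [hL, hR, ← finsum_comp_equiv E, finsum_curry₃ (fun y => F (E y)) (hFs.comp_of_injective E.injective)]
  rfl

/-- The modes of the twisted neutral fermion `e^(ε_i) E_-(ε_i, z) E_+(ε_i, z)`. -/
def fermion (i : Fin ν) (k : ℤ) : Module.End ℂ (Fock ν) := leftOp (eps i) * halfVertex i k

theorem fermion_eq_zero {d : ℤ} {v : Fock ν} (hd : ∀ i s, d < s → tau i s v = 0) (i : Fin ν)
    {k : ℤ} (hk : d < k) : fermion i k v = 0 := by
  rw [fermion, Module.End.mul_apply, halfVertex_eq_zero hd i hk, map_zero]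

theorem fermion_fermion (i j : Fin ν) (k l : ℤ) (v : Fock ν) :
    fermion i k (fermion j l v) = leftOp (eps i * eps j)
      (∑ᶠ t : ℤ, pairCoeff i j t • normalPair i j (k - t) (l + t) v) := by
  rw [fermion, fermion, Module.End.mul_apply, Module.End.mul_apply, ← leftOp_halfVertex,
    halfVertex_halfVertex, leftOp_mul_apply]

theorem fermion_fermion_self (i : Fin ν) (k l : ℤ) (v : Fock ν) :
    fermion i k (fermion i l v) =
      ∑ᶠ t : ℤ, pairCoeff i i t • normalPair i i (k - t) (l + t) v := by
  rw [fermion_fermion, eps_mul_self, leftOp_one_apply]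

theorem fermion_fermion_of_ne {i j : Fin ν} (h : i ≠ j) (k l : ℤ) (v : Fock ν) :
    fermion i k (fermion j l v) = leftOp (eps i * eps j) (normalPair i j k l v) := by
  rw [fermion_fermion, finsum_eq_single _ 0]
  · rw [pairCoeff_zero, one_smul, sub_zero, add_zero]
  · intro t ht
    rw [pairCoeff_of_ne h, if_neg ht, zero_smul]

/-! ## Diagonal sums of normally ordered products -/

/-- The convolution of the creation coefficients, weighted in the second factor. -/
def convMul (i j : Fin ν) (b : ℤ → ℂ) (r : ℕ) : SymAlg ν :=
  ∑ p ∈ Finset.HasAntidiagonal.antidiagonal r, b (p.2 : ℕ) • (schur i (p.1 : ℕ) * schur j (p.2 : ℕ))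

/-- The convolution of the annihilation coefficients, weighted in the second factor. -/
def convTau (i j : Fin ν) (a : ℤ → ℂ) (s : ℕ) : Module.End ℂ (Fock ν) :=
  ∑ p ∈ Finset.HasAntidiagonal.antidiagonal s, a (p.2 : ℕ) • (tau i (p.1 : ℕ) * tau j (p.2 : ℕ))

theorem sum_antidiagonal_eq_finsum {M : Type*} [AddCommMonoid M] (f : ℤ → ℤ → M)
    (hf : ∀ x y, f x y ≠ 0 → 0 ≤ x ∧ 0 ≤ y) (r : ℕ) :
    ∑ p ∈ Finset.HasAntidiagonal.antidiagonal r, f (p.1 : ℕ) (p.2 : ℕ) =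
      ∑ᶠ y : ℤ, f (r - y) y := by
  rw [← Finset.Nat.sum_antidiagonal_swap, Finset.Nat.sum_antidiagonal_eq_sum_range_succ_mk,
    finsum_eq_sum_of_support_subset (s := (Finset.range (r + 1)).map Nat.castEmbedding),
    Finset.sum_map]
  · refine Finset.sum_congr rfl fun t ht => ?_
    have h2 : ((r - t : ℕ) : ℤ) = (r : ℤ) - t := by
      have := Finset.mem_range.1 ht; omega
    simp only [Prod.fst_swap, Prod.snd_swap, h2, Nat.castEmbedding_apply]
  · intro t ht
    obtain ⟨h1, h2⟩ := hf _ _ ht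
    lift t to ℕ using h2
    simp only [Finset.coe_map, Set.mem_image, Finset.mem_coe, Finset.mem_range]
    exact ⟨t, by omega, rfl⟩

/-- The modes in `bosonMode` are indexed by pairs of naturals with given difference. The first entry
determines the pair and ranges over the integers satisfying both inequalities. -/
theorem finsum_subtype_eq_finsum_int {M : Type*} [AddCommMonoid M] (m : ℤ) (f : ℤ → M)
    (hf : ∀ x, f x ≠ 0 → 0 ≤ x ∧ 0 ≤ m + x) :
    ∑ᶠ r : {r : ℕ × ℕ // (r.2 : ℤ) - r.1 = m}, f (r.1.1 : ℕ) = ∑ᶠ x : ℤ, f x := by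
  have hinj : Function.Injective
      (fun r : {r : ℕ × ℕ // (r.2 : ℤ) - r.1 = m} => ((r.1.1 : ℕ) : ℤ)) := by
    rintro ⟨⟨a, b⟩, h⟩ ⟨⟨a', b'⟩, h'⟩ h''
    simp only [Subtype.mk.injEq, Prod.mk.injEq] at h'' ⊢
    dsimp only at h h'
    omega
  rw [← finsum_mem_range (f := f) hinj, ← finsum_mem_univ f]
  refine finsum_mem_inter_support_eq' _ _ _ fun x hx => ⟨fun _ => Set.mem_univ _, fun _ => ?_⟩
  obtain ⟨h1, h2⟩ := hf x hx
  lift x to ℕ using h1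
  exact ⟨⟨(x, (m + x).toNat), by dsimp only; omega⟩, rfl⟩

/-- The summands of `normalPair i j (m - l) l`, indexed by `(l, r, r')`. -/
def normalTriple (i j : Fin ν) (m : ℤ) (v : Fock ν) (y : ℤ × ℤ × ℤ) : Fock ν :=
  mulOp (schur i y.2.1) (mulOp (schur j y.2.2)
    (tau i (m - y.1 + y.2.1) (tau j (y.1 + y.2.2) v)))

theorem normalTriple_support (i j : Fin ν) (m : ℤ) (v : Fock ν) (w : ℤ × ℤ × ℤ → ℂ) :
    (fun y => w y • normalTriple i j m v y).HasFiniteSupport := by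
  obtain ⟨d, hd⟩ := exists_tau_eq_zero v
  refine hasFiniteSupport_of_mem_Icc (m - d, 0, 0) (d, 2 * d - m, 2 * d - m) ?_
  rintro ⟨t, r, r'⟩ h
  have h := right_ne_zero_of_smul h
  have h1 := schur_nonneg h
  have h2 := schur_nonneg (arg_ne_zero h)
  have h3 := tau_tau_le hd (arg_ne_zero (arg_ne_zero h))
  dsimp only at h1 h2 h3
  simp only [Prod.mk_le_mk]
  omega

theorem finsum_smul_normalPair (i j : Fin ν) (c : ℤ → ℂ) (m : ℤ) (v : Fock ν) :
    ∑ᶠ l : ℤ, c l • normalPair i j (m - l) l v = ∑ᶠ y, c y.1 • normalTriple i j m v y := by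
  rw [finsum_curry _ (normalTriple_support i j m v fun y => c y.1)]
  refine finsum_congr fun l => ?_
  rw [normalPair, smul_finsum]
  rfl

/-- In terms of the annihilation index s = l + r' and the total creation degree R = r + r' the
weight splits as a(s)b(r'), so the diagonal sum becomes creation convolutions applied to
annihilation convolutions. This is the shape of the coefficients of E_-E_-E_+E_+. -/
theorem finsum_normalTriple (i j : Fin ν) (a b : ℤ → ℂ) (m : ℤ) (v : Fock ν) :
    ∑ᶠ y : ℤ × ℤ × ℤ, (a (y.1 + y.2.2) * b y.2.2) • normalTriple i j m v y =
    ∑ᶠ r : {r : ℕ × ℕ // (r.2 : ℤ) - r.1 = m},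
      mulOp (convMul i j b r.1.1) (convTau i j a r.1.2 v) := by
  obtain ⟨d, hd⟩ := exists_tau_eq_zero v
  set F : ℤ × ℤ × ℤ → Fock ν := fun y => (a (y.1 + y.2.2) * b y.2.2) • mulOp (schur i y.2.1)
      (mulOp (schur j y.2.2) (tau i (m - y.1 + y.2.1) (tau j (y.1 + y.2.2) v))) with hF
  have hFs : F.HasFiniteSupport :=
    normalTriple_support i j m v fun y => a (y.1 + y.2.2) * b y.2.2
  have hmul : ∀ r : ℕ, ∀ w : Fock ν, mulOp (convMul i j b r) w =
      ∑ᶠ y : ℤ, b y • mulOp (schur i (r - y)) (mulOp (schur j y) w) := by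
    intro r w
    rw [← sum_antidiagonal_eq_finsum (fun x y => b y • mulOp (schur i x) (mulOp (schur j y) w)),
      convMul, map_sum, LinearMap.sum_apply]
    · exact Finset.sum_congr rfl fun p _ => by
        rw [map_smul, map_mul, LinearMap.smul_apply, Module.End.mul_apply]
    · intro x y h
      have h := right_ne_zero_of_smul h
      exact ⟨schur_nonneg h, schur_nonneg (arg_ne_zero h)⟩
  have htau : ∀ s : ℕ, convTau i j a s v = ∑ᶠ y : ℤ, a y • tau i (s - y) (tau j y v) := by
    intro r
    rw [← sum_antidiagonal_eq_finsum (fun x y => a y • tau i x (tau j y v)),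
      convTau, LinearMap.sum_apply]
    · rfl
    · intro x y h
      have h := right_ne_zero_of_smul h
      exact ⟨tau_nonneg h, tau_nonneg (arg_ne_zero h)⟩
  have hL : ∑ᶠ y : ℤ × ℤ × ℤ, (a (y.1 + y.2.2) * b y.2.2) • normalTriple i j m v y = ∑ᶠ y, F y :=
    rfl
  have hR : ∑ᶠ r : {r : ℕ × ℕ // (r.2 : ℤ) - r.1 = m},
      mulOp (convMul i j b r.1.1) (convTau i j a r.1.2 v) =
      ∑ᶠ (R : ℤ) (y : ℤ) (s : ℤ), F (s - y, R - y, y) := by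
    rw [← finsum_subtype_eq_finsum_int m (fun R => ∑ᶠ (y : ℤ) (s : ℤ), F (s - y, R - y, y))]
    · refine finsum_congr fun r => ?_
      rw [hmul]
      refine finsum_congr fun y => ?_
      rw [htau, map_finsum, map_finsum, smul_finsum]
      · refine finsum_congr fun s => ?_
        simp only [hF, map_smul, smul_smul]
        rw [show m - (s - y) + (r.1.1 - y) = r.1.2 - s by have := r.2; omega, sub_add_cancel,
          mul_comm]
      · refine hasFiniteSupport_of_mem_Icc 0 d fun s h => ?_
        have h := right_ne_zero_of_smul (arg_ne_zero h)
        exact ⟨tau_nonneg (arg_ne_zero h), (tau_tau_le hd h).2⟩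
      · refine hasFiniteSupport_of_mem_Icc 0 d fun s h => ?_
        have h := right_ne_zero_of_smul h
        exact ⟨tau_nonneg (arg_ne_zero h), (tau_tau_le hd h).2⟩
    · intro R h
      obtain ⟨y, hy⟩ := exists_ne_zero_of_finsum_ne_zero h
      obtain ⟨s, hs⟩ := exists_ne_zero_of_finsum_ne_zero hy
      simp only [hF] at hs
      have h := right_ne_zero_of_smul hs
      have h1 := schur_nonneg h
      have h2 := schur_nonneg (arg_ne_zero h)
      have h3 := tau_nonneg (arg_ne_zero (arg_ne_zero h))
      have h4 := tau_nonneg (arg_ne_zero (arg_ne_zero (arg_ne_zero h)))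
      omega
  let E : ℤ × ℤ × ℤ ≃ ℤ × ℤ × ℤ :=
    { toFun := fun y => (y.2.2 - y.2.1, y.1 - y.2.1, y.2.1)
      invFun := fun y => (y.2.1 + y.2.2, y.2.2, y.1 + y.2.2)
      left_inv := fun y => by ext <;> simp
      right_inv := fun y => by ext <;> simp }
  rw [hL, hR, ← finsum_comp_equiv E, finsum_curry₃ (fun y => F (E y)) (hFs.comp_of_injective E.injective)]
  rfl

end Fermion


/-! ### Abstract neutral fermions and normally ordered quadratic expressions -/

section Wick

variable {ν : ℕ} {M : Type*} [AddCommGroup M] [Module ℂ M]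

/-- Operators satisfying the anticommutation relations of the modes of twisted neutral fermions,
such that every vector is annihilated by almost all positive modes. -/
structure IsNeutralFermion (φ : Fin ν → ℤ → Module.End ℂ M) : Prop where
  car : ∀ i j k l v, φ i k (φ j l v) + φ j l (φ i k v) =
    (if i = j ∧ k + l = 0 then 2 * (-1 : ℂ) ^ k else 0) • v
  fin : ∀ v, ∃ d : ℤ, 0 ≤ d ∧ ∀ i k, d < k → φ i k v = 0

/-- The vacuum expectation value of the product of the modes `φ i k` and `φ j l`. -/
def contraction (i j : Fin ν) (k l : ℤ) : ℂ := if i = j ∧ k + l = 0 then pairCoeff i i k else 0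

/-- The normally ordered product of two modes. -/
def wick (φ : Fin ν → ℤ → Module.End ℂ M) (i j : Fin ν) (k l : ℤ) (v : M) : M :=
  φ i k (φ j l v) - contraction i j k l • v

/-- The Möbius function `(1 + a) / (1 - a)`, which is `0` at `1`. -/
def mobius (a : ℂ) : ℂ := (1 + a) / (1 - a)

/-- The mode of `φ i (z) φ j (-a z)`, regularized in case `i = j`. -/
def quadMode (φ : Fin ν → ℤ → Module.End ℂ M) (i j : Fin ν) (a : ℂ) (m : ℤ) (v : M) : M :=
  ∑ᶠ l : ℤ, (-a) ^ (-l) • wick φ i j (m - l) l v + (if i = j ∧ m = 0 then mobius a else 0) • v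

/-- The rational function c(x) = (1-x)/(1+x) satisfies c(1/x) = -c(x), so its two expansions add up
to something supported at the pole x = -1: twice a delta function, the source of the anticommutator.
-/
theorem pairCoeff_add_neg (i : Fin ν) (t : ℤ) :
    pairCoeff i i t + pairCoeff i i (-t) = 2 * (-1) ^ t := by
  unfold pairCoeff
  rcases lt_trichotomy t 0 with h | h | h
  · rw [if_pos h, if_neg (by omega), if_neg (by omega), if_pos rfl, zpow_neg, ← inv_zpow]
    norm_num
  · subst h; norm_num
  · rw [if_neg (by omega), if_neg (by omega), if_pos rfl, if_pos (by omega), add_zero]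

/-- Coefficientwise form of (1+x)c(x) = 1-x. -/
theorem pairCoeff_add_sub_one (i : Fin ν) (t : ℤ) :
    pairCoeff i i t + pairCoeff i i (t - 1) =
      (if t = 0 then 1 else 0) - (if t = 1 then 1 else 0) := by
  unfold pairCoeff
  rcases lt_trichotomy t 0 with h | h | h
  · rw [if_pos h, if_pos (by omega), if_neg (by omega), if_neg (by omega)]; norm_num
  · subst h; norm_num
  · rcases eq_or_ne t 1 with rfl | h1
    · norm_num
    · rw [if_neg (by omega), if_neg (by omega), if_pos rfl, if_neg (by omega), if_neg (by omega),
        if_pos rfl, if_neg (by omega), if_neg h1, zpow_sub_one₀ (by norm_num)]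
      ring

theorem contraction_add_swap (i j : Fin ν) (k l : ℤ) :
    contraction i j k l + contraction j i l k =
      if i = j ∧ k + l = 0 then 2 * (-1 : ℂ) ^ k else 0 := by
  unfold contraction
  by_cases h : i = j ∧ k + l = 0
  · obtain ⟨rfl, h⟩ := h
    rw [if_pos ⟨rfl, h⟩, if_pos ⟨rfl, by omega⟩, if_pos ⟨rfl, h⟩,
      show l = -k by omega, pairCoeff_add_neg]
  · rw [if_neg h, if_neg h, if_neg (fun h' => h ⟨h'.1.symm, by omega⟩), add_zero]

theorem IsNeutralFermion.wick_swap {φ : Fin ν → ℤ → Module.End ℂ M} (hφ : IsNeutralFermion φ)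
    (i j : Fin ν) (k l : ℤ) (v : M) : wick φ i j k l v = -wick φ j i l k v := by
  have h := hφ.car i j k l v
  rw [← contraction_add_swap, add_smul] at h
  unfold wick
  rw [eq_neg_iff_add_eq_zero, sub_add_sub_comm, h, sub_self]

theorem wick_eq_zero_right {φ : Fin ν → ℤ → Module.End ℂ M} {d : ℤ} {v : M} (hd0 : 0 ≤ d)
    (hd : ∀ i k, d < k → φ i k v = 0) (i j : Fin ν) {k l : ℤ} (h : d < l) :
    wick φ i j k l v = 0 := by
  rw [wick, hd j l h, map_zero, zero_sub, neg_eq_zero, contraction]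
  split_ifs with h'
  -- Here `0 ≤ d < l` and `k + l = 0` force `k < 0`, where the contraction vanishes.
  · rw [pairCoeff_of_neg _ _ (by omega), zero_smul]
  · rw [zero_smul]

/-- The bare product need not vanish for large `k`; the normally ordered one does, by antisymmetry.
This is the reason for normal ordering the infinite sums. -/
theorem IsNeutralFermion.wick_eq_zero {φ : Fin ν → ℤ → Module.End ℂ M} (hφ : IsNeutralFermion φ)
    {d : ℤ} {v : M} (hd0 : 0 ≤ d) (hd : ∀ i k, d < k → φ i k v = 0) (i j : Fin ν) {k l : ℤ}
    (h : d < k ∨ d < l) : wick φ i j k l v = 0 := by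
  rcases h with h | h
  · rw [hφ.wick_swap, wick_eq_zero_right hd0 hd j i h, neg_zero]
  · exact wick_eq_zero_right hd0 hd i j h

theorem IsNeutralFermion.wick_support {φ : Fin ν → ℤ → Module.End ℂ M} (hφ : IsNeutralFermion φ)
    (i j : Fin ν) (m : ℤ) (v : M) (c : ℤ → ℂ) :
    (fun l : ℤ => c l • wick φ i j (m - l) l v).HasFiniteSupport := by
  obtain ⟨d, hd0, hd⟩ := hφ.fin v
  refine hasFiniteSupport_of_mem_Icc (m - d) d fun l hl => ?_
  by_contra h'
  exact hl (by rw [hφ.wick_eq_zero hd0 hd i j (by omega), smul_zero])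

end Wick

/-! ### Vertex operators as quadratic expressions in the fermions -/

section Realization

variable {ν : ℕ}

theorem convMul_neg_one (i : Fin ν) (r : ℕ) :
    convMul i i (fun x => (-1) ^ x) r = if r = 0 then 1 else 0 := by
  rw [← sum_antidiagonal_schurSeries i r, convMul]
  exact Finset.sum_congr rfl fun p _ => by rw [schur_natCast, schur_natCast, zpow_natCast]

theorem convMul_neg_one' (i : Fin ν) (r : ℕ) :
    convMul i i (fun x => x * (-1) ^ x) r = (-2 : ℂ) • oddVar i r := by
  rw [← sum_antidiagonal_schurSeries' i r, convMul]
  exact Finset.sum_congr rfl fun p _ => by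
    rw [schur_natCast, schur_natCast, zpow_natCast, Int.cast_natCast]

theorem convTau_eq (i j : Fin ν) (a : ℤ → ℂ) (s : ℕ) :
    convTau i j a s = (-1 : ℂ) ^ s • diffOp (convMul i j a s) := by
  rw [convTau, convMul, map_sum, Finset.smul_sum]
  refine Finset.sum_congr rfl fun p hp => ?_
  rw [tau, tau, smul_mul_smul_comm, map_smul, map_mul, smul_comm,
    ← Finset.HasAntidiagonal.mem_antidiagonal.1 hp, pow_add, zpow_natCast, zpow_natCast]

theorem convTau_neg_one (i : Fin ν) (s : ℕ) (v : Fock ν) :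
    convTau i i (fun x => (-1) ^ x) s v = if s = 0 then v else 0 := by
  rw [convTau_eq, convMul_neg_one]
  split_ifs with h
  · rw [h, pow_zero, one_smul, map_one, Module.End.one_apply]
  · rw [map_zero, smul_zero, LinearMap.zero_apply]

theorem convTau_neg_one' (i : Fin ν) (s : ℕ) :
    convTau i i (fun x => x * (-1) ^ x) s = (2 : ℂ) • diffOp (oddVar i s) := by
  rw [convTau_eq, convMul_neg_one', map_smul, smul_smul]
  by_cases h : Odd s
  · rw [h.neg_one_pow]; norm_num
  · rw [oddVar, if_neg h, map_zero, smul_zero, smul_zero]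

/-- Evaluation of the normally ordered product at w = -z, where E_-(z)E_-(-z) and E_+(z)E_+(-z) are
both 1. -/
theorem finsum_neg_one_normalPair (i : Fin ν) (m : ℤ) (v : Fock ν) :
    ∑ᶠ l : ℤ, (-1 : ℂ) ^ l • normalPair i i (m - l) l v = if m = 0 then v else 0 := by
  have h1 : ∀ y : ℤ × ℤ × ℤ, (-1 : ℂ) ^ y.1 = (-1) ^ (y.1 + y.2.2) * (-1) ^ y.2.2 := by
    intro y
    rw [zpow_add₀ (by norm_num), mul_assoc, ← mul_zpow]
    norm_num
  rw [finsum_smul_normalPair]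
  simp only [h1]
  rw [finsum_normalTriple i i (fun x => (-1) ^ x) (fun x => (-1) ^ x)]
  have h2 : ∀ r : {r : ℕ × ℕ // (r.2 : ℤ) - r.1 = m}, r.1 ≠ (0, 0) →
      mulOp (convMul i i (fun x => (-1) ^ x) r.1.1)
        (convTau i i (fun x => (-1) ^ x) r.1.2 v) = 0 := by
    rintro ⟨⟨r, s⟩, h⟩ h'
    rw [convMul_neg_one, convTau_neg_one]
    rcases eq_or_ne r 0 with rfl | hr
    · rcases eq_or_ne s 0 with rfl | hs
      · exact absurd rfl h'
      · rw [if_neg hs, map_zero]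
    · rw [if_neg hr, map_zero, LinearMap.zero_apply]
  split_ifs with hm
  · subst hm
    rw [finsum_eq_single _ ⟨(0, 0), by simp⟩]
    · rw [convMul_neg_one, convTau_neg_one, if_pos rfl, if_pos rfl, map_one, Module.End.one_apply]
    · intro r hr
      exact h2 r fun h => hr (Subtype.ext h)
  · refine finsum_eq_zero_of_forall_eq_zero fun r => h2 r fun h => hm ?_
    have := r.2
    rw [h] at this
    simpa using this.symm

/-- First derivative in w of the normally ordered product at w = -z. The product itself is 1 there,
so only the logarithmic derivative survives, and that is the Heisenberg field. -/
theorem finsum_mul_neg_one_normalPair (i : Fin ν) (m : ℤ) (v : Fock ν) :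
    ∑ᶠ l : ℤ, ((l : ℂ) * (-1 : ℂ) ^ l) • normalPair i i (m - l) l v =
      (2 : ℂ) • heis ν (Pi.single i 1) m v := by
  -- Writing l = (l + r') - r' separates the derivative of the annihilation factor from that of the
  -- creation factor.
  have h1 : ∀ y : ℤ × ℤ × ℤ, ((y.1 : ℂ) * (-1 : ℂ) ^ y.1) • normalTriple i i m v y =
      ((((y.1 + y.2.2 : ℤ) : ℂ) * (-1) ^ (y.1 + y.2.2)) * (-1) ^ y.2.2) • normalTriple i i m v y -
      ((-1) ^ (y.1 + y.2.2) * ((y.2.2 : ℂ) * (-1) ^ y.2.2)) • normalTriple i i m v y := by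
    intro y
    have h0 : (-1 : ℂ) ^ y.1 = (-1) ^ (y.1 + y.2.2) * (-1) ^ y.2.2 := by
      rw [zpow_add₀ (by norm_num), mul_assoc, ← mul_zpow]
      norm_num
    rw [← sub_smul, h0]
    congr 1
    push_cast
    ring
  rw [finsum_smul_normalPair]
  simp only [h1]
  rw [finsum_sub_distrib (normalTriple_support _ _ _ _ _) (normalTriple_support _ _ _ _ _),
    finsum_normalTriple i i (fun x => x * (-1) ^ x) (fun x => (-1) ^ x),
    finsum_normalTriple i i (fun x => (-1) ^ x) (fun x => x * (-1) ^ x)]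
  have h2 : ∀ r : {r : ℕ × ℕ // (r.2 : ℤ) - r.1 = m},
      mulOp (convMul i i (fun x => (-1) ^ x) r.1.1)
        (convTau i i (fun x => x * (-1) ^ x) r.1.2 v) =
      if r.1.1 = 0 then (2 : ℂ) • diffOp (oddVar i r.1.2) v else 0 := by
    intro r
    rw [convMul_neg_one, convTau_neg_one']
    split_ifs
    · rw [map_one, Module.End.one_apply, LinearMap.smul_apply]
    · rw [map_zero, LinearMap.zero_apply]
  have h3 : ∀ r : {r : ℕ × ℕ // (r.2 : ℤ) - r.1 = m},
      mulOp (convMul i i (fun x => x * (-1) ^ x) r.1.1)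
        (convTau i i (fun x => (-1) ^ x) r.1.2 v) =
      if r.1.2 = 0 then (-2 : ℂ) • mulOp (oddVar i r.1.1) v else 0 := by
    intro r
    rw [convMul_neg_one', convTau_neg_one]
    split_ifs
    · rw [map_smul, LinearMap.smul_apply]
    · rw [map_zero]
  simp only [h2, h3]
  rcases le_or_gt 0 m with hm | hm
  · lift m to ℕ using hm
    rw [finsum_eq_single _ ⟨(0, m), by simp⟩, finsum_eq_zero_of_forall_eq_zero, if_pos rfl, sub_zero,
      heis_single_pos]
    · intro r
      have := r.2
      split_ifs with h
      · rw [show r.1.1 = 0 by omega, oddVar_zero, map_zero, LinearMap.zero_apply, smul_zero]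
      · rfl
    · intro r hr
      rw [if_neg]
      intro h
      have := r.2
      exact hr (Subtype.ext (Prod.ext h (by dsimp only; omega)))
  · obtain ⟨n, rfl⟩ : ∃ n : ℕ, m = -(n : ℤ) := ⟨m.natAbs, by omega⟩
    rw [finsum_eq_zero_of_forall_eq_zero, finsum_eq_single _ ⟨(n, 0), by simp⟩, if_pos rfl, zero_sub,
      heis_single_neg, ← neg_smul, neg_neg]
    · intro r hr
      rw [if_neg]
      intro h
      have := r.2
      exact hr (Subtype.ext (Prod.ext (by dsimp only; omega) h))
    · intro r
      have := r.2
      rw [if_neg (by omega)]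

/-- For i = j both orders expand in the same `normalPair` terms, with coefficients c_t and c_{-t};
their sum 2(-1)^t leaves the diagonal sum evaluated by `finsum_neg_one_normalPair`. For i ≠ j there
is no contraction and the Clifford generators anticommute. -/
theorem isNeutralFermion_fermion : IsNeutralFermion (fermion (ν := ν)) where
  fin v := by
    obtain ⟨d, hd⟩ := exists_tau_eq_zero v
    exact ⟨max 0 d, le_max_left _ _, fun i k hk =>
      fermion_eq_zero hd i (lt_of_le_of_lt (le_max_right _ _) hk)⟩
  car i j k l v := by
    by_cases h : i = j
    swap
    · rw [if_neg (fun h' => h h'.1), zero_smul, fermion_fermion_of_ne h,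
        fermion_fermion_of_ne (Ne.symm h), normalPair_symm j i, ← leftOp_add_apply, eps_anticomm h,
        leftOp, LinearMap.mulLeft_zero_eq_zero, LinearMap.rTensor_zero, LinearMap.zero_apply]
    subst h
    obtain ⟨d, hd⟩ := exists_tau_eq_zero v
    have h1 : fermion i l (fermion i k v) =
        ∑ᶠ t : ℤ, pairCoeff i i (-t) • normalPair i i (k - t) (l + t) v := by
      rw [fermion_fermion_self, ← finsum_comp_equiv (Equiv.neg ℤ)]
      refine finsum_congr fun t => ?_
      rw [normalPair_symm, Equiv.neg_apply, sub_neg_eq_add, ← sub_eq_add_neg]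
    rw [h1, fermion_fermion_self, ← finsum_add_distrib (normalPair_support hd _ _ _ _ _)
      (normalPair_support hd _ _ _ _ _)]
    simp only [← add_smul, pairCoeff_add_neg]
    rw [← finsum_comp_equiv (Equiv.subRight l)]
    have h2 : ∀ t : ℤ, (2 * (-1 : ℂ) ^ (Equiv.subRight l t)) •
        normalPair i i (k - Equiv.subRight l t) (l + Equiv.subRight l t) v =
        (2 * (-1 : ℂ) ^ (-l)) • ((-1 : ℂ) ^ t • normalPair i i (k + l - t) t v) := by
      intro t
      rw [Equiv.subRight_apply, smul_smul, sub_eq_add_neg t l, zpow_add₀ (by norm_num),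
        show k - (t + -l) = k + l - t by ring, show l + (t + -l) = t by ring]
      congr 1
      ring
    simp only [h2]
    rw [← smul_finsum, finsum_neg_one_normalPair]
    by_cases h : k + l = 0
    · rw [if_pos h, if_pos ⟨trivial, h⟩, show k = -l by omega]
    · rw [if_neg h, if_neg (fun h' => h h'.2), smul_zero, zero_smul]

theorem quadMode_of_ne {i j : Fin ν} (h : i ≠ j) (a : ℂ) (m : ℤ) (v : Fock ν) :
    quadMode fermion i j a m v =
      leftOp (eps i * eps j) (∑ᶠ l : ℤ, (-a) ^ (-l) • normalPair i j (m - l) l v) := by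
  obtain ⟨d, hd⟩ := exists_tau_eq_zero v
  rw [quadMode, if_neg (fun h' => h h'.1), zero_smul, add_zero, map_finsum]
  · refine finsum_congr fun l => ?_
    rw [wick, fermion_fermion_of_ne h, contraction, if_neg (fun h' => h h'.1), zero_smul, sub_zero,
      map_smul]
  · refine hasFiniteSupport_of_mem_Icc (m - d) d fun l hl => ?_
    by_contra h'
    exact hl (by rw [normalPair_eq_zero hd i j (by omega), smul_zero])

/-- The normally ordered product without its constant term. -/
def reducedPair (i : Fin ν) (k l : ℤ) (v : Fock ν) : Fock ν :=
  normalPair i i k l v - (if k = 0 ∧ l = 0 then 1 else 0 : ℂ) • v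

/-- With x = w/z, the product φ(z)φ(w) is c(x) times the normally ordered exponential N, and its
contraction is c(x), so the Wick product is c(x)(N-1). Multiplying by 1+x gives (1-x)(N-1); in
modes, x is the shift (k,l) ↦ (k-1,l+1). -/
theorem wick_add_wick (i : Fin ν) (k l : ℤ) (v : Fock ν) :
    wick fermion i i k l v + wick fermion i i (k - 1) (l + 1) v =
      reducedPair i k l v - reducedPair i (k - 1) (l + 1) v := by
  obtain ⟨d, hd⟩ := exists_tau_eq_zero v
  have h1 : fermion i (k - 1) (fermion i (l + 1) v) =
      ∑ᶠ t : ℤ, pairCoeff i i (t - 1) • normalPair i i (k - t) (l + t) v := by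
    rw [fermion_fermion_self, ← finsum_comp_equiv (Equiv.subRight (1 : ℤ))]
    refine finsum_congr fun t => ?_
    rw [Equiv.subRight_apply, show k - 1 - (t - 1) = k - t by ring,
      show l + 1 + (t - 1) = l + t by ring]
  have h2 : fermion i k (fermion i l v) + fermion i (k - 1) (fermion i (l + 1) v) =
      normalPair i i k l v - normalPair i i (k - 1) (l + 1) v := by
    rw [h1, fermion_fermion_self, ← finsum_add_distrib (normalPair_support hd _ _ _ _ _)
      (normalPair_support hd _ _ _ _ _)]
    simp only [← add_smul, pairCoeff_add_sub_one, sub_smul]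
    rw [finsum_sub_distrib (normalPair_support hd _ _ _ _ _) (normalPair_support hd _ _ _ _ _),
      finsum_eq_single _ 0, finsum_eq_single _ 1]
    · simp
    · intro t ht; rw [if_neg ht, zero_smul]
    · intro t ht; rw [if_neg ht, zero_smul]
  have h3 : contraction i i k l + contraction i i (k - 1) (l + 1) =
      (if k = 0 ∧ l = 0 then 1 else 0) - (if k - 1 = 0 ∧ l + 1 = 0 then 1 else 0) := by
    unfold contraction
    by_cases h : k + l = 0
    · rw [if_pos ⟨rfl, h⟩, if_pos ⟨rfl, by omega⟩, pairCoeff_add_sub_one]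
      congr 1
      · exact if_congr (by omega) rfl rfl
      · exact if_congr (by omega) rfl rfl
    · rw [if_neg (fun h' => h h'.2), if_neg (fun h' => h (by omega)), if_neg (by omega),
        if_neg (by omega)]
      norm_num
  unfold wick reducedPair
  rw [sub_add_sub_comm, h2, ← add_smul, h3, sub_smul]
  abel

theorem reducedPair_support (i : Fin ν) (m : ℤ) (v : Fock ν) (c : ℤ → ℂ) :
    (fun l : ℤ => c l • reducedPair i (m - l) l v).HasFiniteSupport := by
  obtain ⟨d, hd⟩ := exists_tau_eq_zero v
  refine hasFiniteSupport_of_mem_Icc (min (m - d) 0) (max d 0) fun l hl => ?_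
  by_contra h'
  refine hl ?_
  rw [reducedPair, normalPair_eq_zero hd i i (by omega), if_neg (by omega), zero_smul, sub_zero,
    smul_zero]

theorem finsum_reducedPair (i : Fin ν) (m : ℤ) (v : Fock ν) (c : ℤ → ℂ) :
    ∑ᶠ l : ℤ, c l • reducedPair i (m - l) l v =
      ∑ᶠ l : ℤ, c l • normalPair i i (m - l) l v - (if m = 0 then c 0 else 0) • v := by
  obtain ⟨d, hd⟩ := exists_tau_eq_zero v
  simp only [reducedPair, smul_sub, smul_smul]
  rw [finsum_sub_distrib]
  · congr 1
    rw [finsum_eq_single _ 0]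
    · by_cases h : m = 0 <;> simp [h]
    · intro l hl
      rw [if_neg (by omega), mul_zero, zero_smul]
  · refine hasFiniteSupport_of_mem_Icc (m - d) d fun l hl => ?_
    by_contra h'
    exact hl (by rw [normalPair_eq_zero hd i i (by omega), smul_zero])
  · refine hasFiniteSupport_of_mem_Icc 0 0 fun l hl => ?_
    by_contra h'
    exact hl (by rw [if_neg (by omega), mul_zero, zero_smul])

/-- Summation of `wick_add_wick` against a weight. -/
theorem finsum_wick_eq_finsum_reducedPair (i : Fin ν) (m : ℤ) (v : Fock ν) (c : ℤ → ℂ) :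
    ∑ᶠ l : ℤ, (c l + c (l - 1)) • wick fermion i i (m - l) l v =
      ∑ᶠ l : ℤ, (c l - c (l - 1)) • reducedPair i (m - l) l v := by
  have hw := fun c => isNeutralFermion_fermion.wick_support i i m v c
  have h1 : ∀ F : ℤ → ℤ → Fock ν, ∑ᶠ l : ℤ, c (l - 1) • F (m - l) l =
      ∑ᶠ l : ℤ, c l • F (m - l - 1) (l + 1) := by
    intro F
    rw [← finsum_comp_equiv (Equiv.addRight (1 : ℤ))]
    refine finsum_congr fun l => ?_
    rw [Equiv.coe_addRight, add_sub_cancel_right, ← sub_sub]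
  have h2 : ∀ F : ℤ → ℤ → Fock ν, (∀ c : ℤ → ℂ, (fun l => c l • F (m - l) l).HasFiniteSupport) →
      (fun l => c l • F (m - l - 1) (l + 1)).HasFiniteSupport := by
    intro F hF
    have := (hF fun l => c (l - 1)).comp_of_injective (Equiv.addRight (1 : ℤ)).injective
    refine this.subset fun l hl => ?_
    rw [Function.mem_support] at hl ⊢
    simpa [← sub_sub] using hl
  simp only [add_smul, sub_smul]
  rw [finsum_add_distrib (hw _) (hw _),
    finsum_sub_distrib (reducedPair_support i m v _) (reducedPair_support i m v _),
    h1 (fun k l => wick fermion i i k l v), h1 (fun k l => reducedPair i k l v),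
    ← finsum_add_distrib (hw _) (h2 (fun k l => wick fermion i i k l v) hw),
    ← finsum_sub_distrib (reducedPair_support i m v _)
      (h2 (fun k l => reducedPair i k l v) (reducedPair_support i m v))]
  exact finsum_congr fun l => by rw [← smul_add, wick_add_wick, smul_sub]

/-- For the geometric weight c_l = (-a)^{-l} the sum and difference with c_{l-1} are (1-a)c_l and
(1+a)c_l. Division by 1-a produces `mobius a`, and the scalar in `quadMode` cancels the -1 contained
in `reducedPair`. -/
theorem quadMode_self {a : ℂ} (ha0 : a ≠ 0) (ha : a ≠ 1) (i : Fin ν) (m : ℤ) (v : Fock ν) :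
    quadMode fermion i i a m v =
      mobius a • ∑ᶠ l : ℤ, (-a) ^ (-l) • normalPair i i (m - l) l v := by
  have h := finsum_wick_eq_finsum_reducedPair i m v fun l => (-a) ^ (-l)
  have h1 : ∀ l : ℤ, (-a) ^ (-(l - 1)) = (-a) ^ (-l) * (-a) := by
    intro l
    rw [show -(l - 1) = -l + 1 by ring, zpow_add_one₀ (neg_ne_zero.2 ha0)]
  have h2 : ∀ l : ℤ, (-a) ^ (-l) + (-a) ^ (-l) * (-a) = (1 - a) * (-a) ^ (-l) := fun l => by ring
  have h3 : ∀ l : ℤ, (-a) ^ (-l) - (-a) ^ (-l) * (-a) = (1 + a) * (-a) ^ (-l) := fun l => by ring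
  simp only [h1, h2, h3, mul_smul] at h
  rw [← smul_finsum, ← smul_finsum, finsum_reducedPair] at h
  have h4 : (1 - a) ≠ 0 := sub_ne_zero.2 (Ne.symm ha)
  have h5 : ∑ᶠ l : ℤ, (-a) ^ (-l) • wick fermion i i (m - l) l v = mobius a •
      (∑ᶠ l : ℤ, (-a) ^ (-l) • normalPair i i (m - l) l v -
        (if m = 0 then (-a) ^ (-0 : ℤ) else 0) • v) := by
    rw [mobius, div_eq_inv_mul, mul_smul, ← h, smul_smul, inv_mul_cancel₀ h4, one_smul]
  rw [quadMode, h5, smul_sub, smul_smul]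
  by_cases hm : m = 0 <;> simp [hm]

/-- The division by 1-a is impossible here. The weight l(-1)^l, a derivative of the geometric one,
is used instead: its sum with the shifted weight is (-1)^l, and the difference brings in the first
derivative of the normally ordered product. -/
theorem quadMode_self_one (i : Fin ν) (m : ℤ) (v : Fock ν) :
    quadMode fermion i i 1 m v = (4 : ℂ) • heis ν (Pi.single i 1) m v := by
  obtain ⟨d, hd⟩ := exists_tau_eq_zero v
  have h := finsum_wick_eq_finsum_reducedPair i m v fun l => (l : ℂ) * (-1) ^ l
  have h1 : ∀ l : ℤ, (-1 : ℂ) ^ (l - 1) = -(-1) ^ l := by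
    intro l
    rw [zpow_sub_one₀ (by norm_num)]; norm_num
  have h2 : ∀ l : ℤ, (l : ℂ) * (-1) ^ l + ((l - 1 : ℤ) : ℂ) * (-1) ^ (l - 1) = (-1) ^ l := by
    intro l; rw [h1]; push_cast; ring
  have h3 : ∀ l : ℤ, (l : ℂ) * (-1) ^ l - ((l - 1 : ℤ) : ℂ) * (-1) ^ (l - 1) =
      2 * ((l : ℂ) * (-1) ^ l) - (-1) ^ l := by
    intro l; rw [h1]; push_cast; ring
  have h4 : ∀ l : ℤ, (-1 : ℂ) ^ (-l) = (-1) ^ l := by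
    intro l; rw [zpow_neg, ← inv_zpow]; norm_num
  simp only [h2, h3, sub_smul, mul_smul (2 : ℂ)] at h
  have hs : ∀ c : ℤ → ℂ, (fun l : ℤ => c l • reducedPair i (m - l) l v).HasFiniteSupport :=
    reducedPair_support i m v
  rw [finsum_sub_distrib ((hs fun l => 2 * ((l : ℂ) * (-1) ^ l)).subset
      (by simp only [mul_smul (2 : ℂ)]; exact subset_rfl)) (hs _),
    ← smul_finsum, finsum_reducedPair, finsum_reducedPair, finsum_mul_neg_one_normalPair,
    finsum_neg_one_normalPair] at h
  rw [quadMode]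
  simp only [h4]
  rw [h, mobius]
  by_cases hm : m = 0
  · simp [hm, smul_smul]; norm_num
  · simp [hm, smul_smul]; norm_num

theorem expMinus_eq {α : Fin ν → ℤ} {i : Fin ν} {a b : ℂ} (h : ∀ r : ℕ,
    (a ^ r) • heis ν α (-(r : ℤ)) = b ^ r • heis ν (Pi.single i 1) (-(r : ℤ))) :
    expMinus ν α a = PowerSeries.map mulOp.toRingHom
      (PowerSeries.rescale (algebraMap ℂ (SymAlg ν) b) (schurSeries i)) := by
  rw [schurSeries, rescale_formalExp, map_formalExp, expMinus]
  congr 1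
  ext1 r
  rw [PowerSeries.coeff_mk, PowerSeries.coeff_map, PowerSeries.coeff_rescale, oddExponent,
    PowerSeries.coeff_mk, mul_smul, h, heis_single_neg, ← map_pow, ← Algebra.smul_def, smul_smul]
  change _ = mulOp (b ^ r • (2 / (r : ℂ)) • oddVar i r)
  rw [map_smul, map_smul, smul_smul]
  congr 1
  push_cast
  rw [neg_div_neg_eq, mul_comm]

theorem expPlus_eq {α : Fin ν → ℤ} {i : Fin ν} {a b : ℂ} (h : ∀ r : ℕ,
    (-(a ^ r)⁻¹) • heis ν α (r : ℤ) = b ^ r • heis ν (Pi.single i 1) (r : ℤ)) :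
    expPlus ν α a = PowerSeries.map diffOp.toRingHom
      (PowerSeries.rescale (algebraMap ℂ (SymAlg ν) b) (schurSeries i)) := by
  rw [schurSeries, rescale_formalExp, map_formalExp, expPlus]
  congr 1
  ext1 r
  rw [PowerSeries.coeff_mk, PowerSeries.coeff_map, PowerSeries.coeff_rescale, oddExponent,
    PowerSeries.coeff_mk, ← map_pow, ← Algebra.smul_def]
  change _ = diffOp (b ^ r • (2 / (r : ℂ)) • oddVar i r)
  rw [map_smul, map_smul, smul_comm, ← heis_single_pos, ← h, smul_smul]
  congr 1
  ring

theorem coeff_map_rescale {R : Type*} [Ring R] [Algebra ℂ R] (φ : SymAlg ν →ₐ[ℂ] R) (b : ℂ)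
    (i : Fin ν) (r : ℕ) : PowerSeries.coeff r (PowerSeries.map φ.toRingHom
      (PowerSeries.rescale (algebraMap ℂ (SymAlg ν) b) (schurSeries i))) =
      b ^ r • φ (schur i r) := by
  rw [PowerSeries.coeff_map, PowerSeries.coeff_rescale, schur_natCast, ← map_pow,
    ← Algebra.smul_def]
  exact map_smul φ _ _

theorem heis_smul_of_even {α : Fin ν → ℤ} {n : ℤ} (hn : ¬ Odd n) : heis ν α n = 0 := by
  unfold heis
  refine Finset.sum_eq_zero fun i _ => ?_
  rw [epsSym, if_neg hn, LinearMap.lTensor_zero, smul_zero]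

/-- Since only odd modes are nonzero, changing the sign of the lattice vector is the same as
changing the sign of the argument. This is why powers of -a, not of a, appear in the fermionic sums.
-/
theorem pow_smul_heis_neg (j : Fin ν) (c : ℂ) (r : ℕ) {n : ℤ} (hn : Odd n ↔ Odd r) :
    c ^ r • heis ν (-Pi.single j 1) n = (-c) ^ r • heis ν (Pi.single j 1) n := by
  refine LinearMap.ext fun v => ?_
  by_cases hr : Odd r
  · rw [heis_neg, hr.neg_pow, LinearMap.smul_apply, LinearMap.smul_apply, LinearMap.neg_apply,
      smul_neg, neg_smul]
  · rw [heis_smul_of_even (by rwa [hn]), heis_smul_of_even (by rwa [hn])]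
    rfl

theorem coeff_expMinus_mul (i j : Fin ν) (a : ℂ) (r : ℕ) :
    PowerSeries.coeff r (expMinus ν (Pi.single i 1) 1 * expMinus ν (-Pi.single j 1) a) =
      mulOp (convMul i j (fun x => (-a) ^ x) r) := by
  rw [expMinus_eq (i := i) (b := 1) fun r => rfl, expMinus_eq (i := j) (b := -a) fun r =>
    pow_smul_heis_neg j a r (by simp), PowerSeries.coeff_mul, convMul, map_sum]
  refine Finset.sum_congr rfl fun p _ => ?_
  rw [coeff_map_rescale, coeff_map_rescale, one_pow, one_smul, map_smul, map_mul, mul_smul_comm,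
    zpow_natCast]

theorem coeff_expPlus_mul (i j : Fin ν) (a : ℂ) (s : ℕ) :
    PowerSeries.coeff s (expPlus ν (Pi.single i 1) 1 * expPlus ν (-Pi.single j 1) a) =
      convTau i j (fun x => (-a) ^ (-x)) s := by
  have h1 : ∀ r : ℕ, (-((1 : ℂ) ^ r)⁻¹) • heis ν (Pi.single i 1) (r : ℤ) =
      (-1 : ℂ) ^ r • heis ν (Pi.single i 1) (r : ℤ) := by
    intro r
    by_cases hr : Odd r
    · rw [hr.neg_one_pow, one_pow, inv_one]
    · rw [heis_smul_of_even (by simpa using hr), smul_zero, smul_zero]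
  have h2 : ∀ r : ℕ, (-((a : ℂ) ^ r)⁻¹) • heis ν (-Pi.single j 1) (r : ℤ) =
      (a⁻¹) ^ r • heis ν (Pi.single j 1) (r : ℤ) := by
    intro r
    refine LinearMap.ext fun v => ?_
    rw [heis_neg, LinearMap.smul_apply, LinearMap.smul_apply, LinearMap.neg_apply, smul_neg,
      neg_smul, neg_neg, inv_pow]
  rw [expPlus_eq (i := i) (b := -1) h1, expPlus_eq (i := j) (b := a⁻¹) h2,
    PowerSeries.coeff_mul, convTau]
  refine Finset.sum_congr rfl fun p _ => ?_
  rw [coeff_map_rescale, coeff_map_rescale, tau, tau, smul_mul_smul_comm, smul_mul_smul_comm,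
    smul_smul, zpow_natCast, zpow_natCast, zpow_neg, zpow_natCast]
  congr 1
  rw [neg_pow a, mul_inv, ← inv_pow, ← inv_pow]
  have : ((-1 : ℂ)⁻¹) ^ p.2 * (-1) ^ p.2 = 1 := by rw [← mul_pow]; norm_num
  linear_combination (-((-1 : ℂ) ^ p.1 * a⁻¹ ^ p.2)) * this

theorem bosonMode_eq (i j : Fin ν) {a : ℂ} (ha : a ≠ 0) (m : ℤ) (v : Fock ν) :
    bosonMode ν i j a m v = ∑ᶠ l : ℤ, (-a) ^ (-l) • normalPair i j (m - l) l v := by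
  have h1 : ∀ y : ℤ × ℤ × ℤ, (-a) ^ (-y.1) = (-a) ^ (-(y.1 + y.2.2)) * (-a) ^ y.2.2 := by
    intro y
    rw [← zpow_add₀ (neg_ne_zero.2 ha)]
    congr 1
    ring
  rw [finsum_smul_normalPair]
  simp only [h1]
  rw [finsum_normalTriple i j (fun x => (-a) ^ (-x)) (fun x => (-a) ^ x), bosonMode]
  exact finsum_congr fun r => by rw [coeff_expMinus_mul, coeff_expPlus_mul]

/-- The vertex operators are the quadratic expressions in the fermions. -/
theorem vertexMode_add_eq_quadMode (i j : Fin ν) {a : ℂ} (ha : a ≠ 0) (m : ℤ) (v : Fock ν) :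
    vertexMode ν i j a m v + (if i = j ∧ a ≠ 1 ∧ m = 0 then ((1 + a) / (1 - a)) • v else 0) =
      quadMode fermion i j a m v := by
  unfold vertexMode
  by_cases h : i = j
  · subst h
    rw [if_neg (not_not.2 rfl)]
    by_cases h1 : a = 1
    · subst h1
      rw [if_pos rfl, if_neg (by simp), add_zero, quadMode_self_one]
    · rw [if_neg h1, quadMode_self ha h1, bosonMode_eq i i ha, mobius]
      by_cases hm : m = 0
      · rw [if_pos hm, if_pos ⟨rfl, h1, hm⟩, smul_sub, sub_add_cancel]
      · rw [if_neg hm, if_neg (fun h' => hm h'.2.2), sub_zero, add_zero]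
  · rw [if_pos h, if_neg (fun h' => h h'.1), add_zero, quadMode_of_ne h, bosonMode_eq i j ha,
      ← epsSign_smul_e_sub, leftOp_smul_apply]
    rfl

end Realization


/-! ## Commutators of quadratic expressions in fermions -/

section Quadratic

variable {ν : ℕ} {M : Type*} [AddCommGroup M] [Module ℂ M]
  {φ : Fin ν → ℤ → Module.End ℂ M}

theorem wick_add (i j : Fin ν) (k l : ℤ) (v w : M) :
    wick φ i j k l (v + w) = wick φ i j k l v + wick φ i j k l w := by
  simp only [wick, map_add, smul_add]
  abel

theorem wick_smul (i j : Fin ν) (k l : ℤ) (c : ℂ) (v : M) :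
    wick φ i j k l (c • v) = c • wick φ i j k l v := by
  simp only [wick, map_smul, smul_sub, smul_comm c]

/-- The operator `quadMode`. -/
def quadOp (hφ : IsNeutralFermion φ) (i j : Fin ν) (a : ℂ) (m : ℤ) : Module.End ℂ M where
  toFun := quadMode φ i j a m
  map_add' v w := by
    have h : ∑ᶠ l : ℤ, (-a) ^ (-l) • wick φ i j (m - l) l (v + w) =
        ∑ᶠ l : ℤ, (-a) ^ (-l) • wick φ i j (m - l) l v +
          ∑ᶠ l : ℤ, (-a) ^ (-l) • wick φ i j (m - l) l w := by
      rw [← finsum_add_distrib (hφ.wick_support i j m v _) (hφ.wick_support i j m w _)]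
      exact finsum_congr fun l => by rw [wick_add, smul_add]
    simp only [quadMode, h, smul_add]
    abel
  map_smul' c v := by
    have h : ∑ᶠ l : ℤ, (-a) ^ (-l) • wick φ i j (m - l) l (c • v) =
        c • ∑ᶠ l : ℤ, (-a) ^ (-l) • wick φ i j (m - l) l v := by
      rw [smul_finsum]
      exact finsum_congr fun l => by rw [wick_smul, smul_comm]
    simp only [quadMode, h, smul_add, RingHom.id_apply, smul_comm c]

theorem quadOp_apply (hφ : IsNeutralFermion φ) (i j : Fin ν) (a : ℂ) (m : ℤ) (v : M) :
    quadOp hφ i j a m v = ∑ᶠ l : ℤ, (-a) ^ (-l) • wick φ i j (m - l) l v +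
      (if i = j ∧ m = 0 then mobius a else 0) • v := rfl

theorem mobius_inv {a : ℂ} (ha : a ≠ 0) : mobius a⁻¹ = -mobius a := by
  unfold mobius
  rcases eq_or_ne a 1 with rfl | h
  · norm_num
  · have h1 : (1 - a) ≠ 0 := sub_ne_zero.2 (Ne.symm h)
    have h2 : (1 - a⁻¹) ≠ 0 := sub_ne_zero.2 fun h' => h (inv_eq_one.1 h'.symm)
    rw [eq_comm, ← neg_div, div_eq_div_iff h1 h2]
    field_simp
    ring

/-- Reindexing by l ↦ m - l and antisymmetry of the Wick product; the scalars agree by `mobius_inv`.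
The factor (-a)^{-m} is the one in `bar`. -/
theorem quadOp_symm (hφ : IsNeutralFermion φ) (i j : Fin ν) {a : ℂ} (ha : a ≠ 0) (m : ℤ) (v : M) :
    quadOp hφ i j a m v = -((-a) ^ (-m) • quadOp hφ j i a⁻¹ m v) := by
  rw [quadOp_apply, quadOp_apply, smul_add, neg_add]
  congr 1
  · rw [smul_finsum, ← finsum_neg_distrib, ← finsum_comp_equiv (Equiv.subLeft m)]
    refine finsum_congr fun l => ?_
    rw [Equiv.subLeft_apply, sub_sub_cancel, hφ.wick_swap, smul_neg, smul_smul]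
    congr 2
    rw [neg_sub, zpow_sub₀ (neg_ne_zero.2 ha), ← inv_neg, inv_zpow', neg_neg, zpow_neg,
      mul_comm, div_eq_mul_inv]
  · by_cases h : i = j ∧ m = 0
    · obtain ⟨rfl, rfl⟩ := h
      simp [mobius_inv ha]
    · rw [if_neg h, if_neg (fun h' => h ⟨h'.1.symm, h'.2⟩)]
      simp

/-- Termwise [AB,C] = A{B,C} - {A,C}B. Both anticommutators are scalars that are nonzero for at most
one l, and the normal ordering constants drop out. -/
theorem quadOp_commutator_fermion (hφ : IsNeutralFermion φ) (i j k : Fin ν) {a : ℂ} (ha : a ≠ 0)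
    (m n : ℤ) (v : M) :
    quadOp hφ i j a m (φ k n v) = φ k n (quadOp hφ i j a m v) +
      ((if j = k then 2 * a ^ n else 0) • φ i (m + n) v -
        (if i = k then 2 * ((-1) ^ n * (-a) ^ (-m - n)) else 0) • φ j (m + n) v) := by
  have hterm : ∀ l : ℤ, wick φ i j (m - l) l (φ k n v) =
      φ k n (wick φ i j (m - l) l v) +
      ((if j = k ∧ l + n = 0 then 2 * (-1 : ℂ) ^ l else 0) • φ i (m - l) v -
        (if i = k ∧ m - l + n = 0 then 2 * (-1 : ℂ) ^ (m - l) else 0) • φ j l v) := by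
    intro l
    have h1 := congrArg (φ i (m - l)) (hφ.car j k l n v)
    have h2 := hφ.car i k (m - l) n (φ j l v)
    rw [map_add, map_smul] at h1
    rw [wick, wick, map_sub, map_smul, ← h1, ← h2]
    abel
  have hs1 : (fun l : ℤ => (-a) ^ (-l) • φ k n (wick φ i j (m - l) l v)).HasFiniteSupport := by
    refine (hφ.wick_support i j m v fun l => (-a) ^ (-l)).subset fun l hl => ?_
    rw [Function.mem_support] at hl ⊢
    intro h0
    apply hl
    rw [← map_smul, h0, map_zero]
  have hs2 : (fun l : ℤ => (-a) ^ (-l) • (if j = k ∧ l + n = 0 then 2 * (-1 : ℂ) ^ l else 0) •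
      φ i (m - l) v).HasFiniteSupport :=
    hasFiniteSupport_of_mem_Icc (-n) (-n) fun l hl => by
      by_contra h'
      exact hl (by rw [if_neg (by omega), zero_smul, smul_zero])
  have hs3 : (fun l : ℤ => (-a) ^ (-l) • (if i = k ∧ m - l + n = 0 then 2 * (-1 : ℂ) ^ (m - l)
      else 0) • φ j l v).HasFiniteSupport :=
    hasFiniteSupport_of_mem_Icc (m + n) (m + n) fun l hl => by
      by_contra h'
      exact hl (by rw [if_neg (by omega), zero_smul, smul_zero])
  have hs4 : (fun l : ℤ => (-a) ^ (-l) • (if j = k ∧ l + n = 0 then 2 * (-1 : ℂ) ^ l else 0) •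
      φ i (m - l) v - (-a) ^ (-l) • (if i = k ∧ m - l + n = 0 then 2 * (-1 : ℂ) ^ (m - l)
      else 0) • φ j l v).HasFiniteSupport := hs2.sub hs3
  rw [quadOp_apply, quadOp_apply, map_add, map_smul, map_finsum _ (hφ.wick_support i j m v _)]
  simp only [hterm, smul_add, smul_sub, map_smul]
  have hf1 : ∑ᶠ l : ℤ, (-a) ^ (-l) • (if j = k ∧ l + n = 0 then 2 * (-1 : ℂ) ^ l else 0) •
      φ i (m - l) v = (if j = k then 2 * a ^ n else 0) • φ i (m + n) v := by
    rw [finsum_eq_single _ (-n), sub_neg_eq_add, neg_neg, smul_smul, neg_add_cancel]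
    · congr 1
      by_cases h : j = k
      · rw [if_pos ⟨h, rfl⟩, if_pos h, neg_eq_neg_one_mul a, mul_zpow, zpow_neg]
        have : ((-1 : ℂ) ^ n) ≠ 0 := zpow_ne_zero _ (by norm_num)
        field_simp
      · rw [if_neg (fun h' => h h'.1), if_neg h, mul_zero]
    · intro l hl
      rw [if_neg (by omega), zero_smul, smul_zero]
  have hf2 : ∑ᶠ l : ℤ, (-a) ^ (-l) • (if i = k ∧ m - l + n = 0 then 2 * (-1 : ℂ) ^ (m - l)
      else 0) • φ j l v =
      (if i = k then 2 * ((-1) ^ n * (-a) ^ (-m - n)) else 0) • φ j (m + n) v := by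
    rw [finsum_eq_single _ (m + n), smul_smul, show m - (m + n) + n = 0 by ring]
    · congr 1
      by_cases h : i = k
      · rw [if_pos ⟨h, rfl⟩, if_pos h, show m - (m + n) = -n by ring, neg_add', zpow_neg (-1 : ℂ),
          ← inv_zpow (-1 : ℂ) n]
        norm_num
        ring
      · rw [if_neg (fun h' => h h'.1), if_neg h, mul_zero]
    · intro l hl
      rw [if_neg (by omega), zero_smul, smul_zero]
  rw [finsum_add_distrib hs1 hs4, finsum_sub_distrib hs2 hs3, hf1, hf2]
  abel

/-- The function `1 + sign` on the integers. -/
def signCoeff (t : ℤ) : ℂ := if t < 0 then 0 else if t = 0 then 1 else 2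

theorem pairCoeff_eq_signCoeff (i : Fin ν) (t : ℤ) : pairCoeff i i t = (-1) ^ t * signCoeff t := by
  unfold pairCoeff signCoeff
  split_ifs with h1 h2
  · simp
  · simp [h2]
  · ring
  · exact absurd rfl ‹_›

theorem signCoeff_support (x : ℂ) (m : ℤ) :
    (fun s : ℤ => x ^ s * (signCoeff s - signCoeff (s - m))).HasFiniteSupport := by
  refine hasFiniteSupport_of_mem_Icc (min 0 m) (max 0 m) fun s hs => ?_
  by_contra h'
  refine hs ?_
  rw [mul_eq_zero]
  right
  unfold signCoeff
  split_ifs <;> first | omega | simp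

/-- Raising m by one adds x^m + x^{m+1}, which for x ≠ 1 telescopes to the Möbius term. At x = 1
each step adds 2 and the sum is 2m; the central term of the Lie algebra originates here. -/
theorem finsum_signCoeff {x : ℂ} (hx : x ≠ 0) (m : ℤ) :
    ∑ᶠ s : ℤ, x ^ s * (signCoeff s - signCoeff (s - m)) =
      mobius x * (1 - x ^ m) + if x = 1 then 2 * (m : ℂ) else 0 := by
  have hstep : ∀ m : ℤ, ∑ᶠ s : ℤ, x ^ s * (signCoeff s - signCoeff (s - (m + 1))) =
      ∑ᶠ s : ℤ, x ^ s * (signCoeff s - signCoeff (s - m)) + (x ^ m + x ^ (m + 1)) := by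
    intro m
    have h1 : ∑ᶠ s : ℤ, x ^ s * (signCoeff (s - m) - signCoeff (s - (m + 1))) =
        x ^ m + x ^ (m + 1) := by
      rw [finsum_eq_sum_of_support_subset (s := {m, m + 1}), Finset.sum_pair (by omega)]
      · have h2 : signCoeff (m - m) - signCoeff (m - (m + 1)) = 1 := by
          rw [sub_self, sub_add_cancel_left]; norm_num [signCoeff]
        have h3 : signCoeff (m + 1 - m) - signCoeff (m + 1 - (m + 1)) = 1 := by
          rw [sub_self, add_sub_cancel_left]; norm_num [signCoeff]
        rw [h2, h3, mul_one, mul_one]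
      · intro s hs
        by_contra h'
        simp only [Finset.coe_pair, Set.mem_insert_iff, Set.mem_singleton_iff, not_or] at h'
        refine hs ?_
        rw [mul_eq_zero]
        right
        unfold signCoeff
        split_ifs <;> first | omega | simp
    rw [← h1, ← finsum_add_distrib (signCoeff_support x m)]
    · exact finsum_congr fun s => by ring
    · refine hasFiniteSupport_of_mem_Icc m (m + 1) fun s hs => ?_
      by_contra h'
      refine hs ?_
      rw [mul_eq_zero]
      right
      unfold signCoeff
      split_ifs <;> first | omega | simp
  have hstep' : ∀ m : ℤ, (mobius x * (1 - x ^ (m + 1)) + if x = 1 then 2 * ((m + 1 : ℤ) : ℂ) else 0) =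
      (mobius x * (1 - x ^ m) + if x = 1 then 2 * (m : ℂ) else 0) + (x ^ m + x ^ (m + 1)) := by
    intro m
    rw [zpow_add_one₀ hx]
    by_cases h : x = 1
    · subst h
      simp [mobius]
      ring
    · have h1 : (1 - x) ≠ 0 := sub_ne_zero.2 (Ne.symm h)
      rw [if_neg h, if_neg h, mobius]
      field_simp
      ring
  induction m using Int.induction_on with
  | zero => simp [mobius]
  | succ m ih => rw [hstep, hstep', ih]
  | pred m ih =>
    have h1 := hstep (-m - 1)
    have h2 := hstep' (-m - 1)
    rw [sub_add_cancel] at h1 h2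
    rw [h1, h2] at ih
    exact add_right_cancel ih

/-- The coefficients are arranged so that each of the four terms belongs to a diagonal sum with
parameter ab or a⁻¹b, the last two with summation index shifted by m. -/
theorem commutator_wick (hφ : IsNeutralFermion φ) (i j p q : Fin ν) {a b : ℂ} (ha : a ≠ 0)
    (hb : b ≠ 0) (m n l : ℤ) (v : M) :
    (-b) ^ (-l) • (quadOp hφ i j a m (wick φ p q (n - l) l v) -
        wick φ p q (n - l) l (quadOp hφ i j a m v)) =
      ((if j = p then 2 * a ^ n else 0) * (-(a * b)) ^ (-l)) • φ i (m + n - l) (φ q l v) -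
      ((if i = p then 2 * ((-a) ^ (-m) * a ^ (-n)) else 0) * (-(a⁻¹ * b)) ^ (-l)) •
        φ j (m + n - l) (φ q l v) +
      ((if j = q then 2 * ((-a) ^ (-m) * b ^ m) else 0) * (-(a⁻¹ * b)) ^ (-(m + l))) •
        φ p (n - l) (φ i (m + l) v) -
      ((if i = q then 2 * b ^ m else 0) * (-(a * b)) ^ (-(m + l))) •
        φ p (n - l) (φ j (m + l) v) := by
  have ha1 : (-1 : ℂ) ≠ 0 := by norm_num
  have hsq : ∀ t : ℤ, (-1 : ℂ) ^ (-t) = (-1) ^ t := by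
    intro t; rw [zpow_neg, ← inv_zpow]; norm_num
  have hne : ∀ x : ℂ, ∀ t : ℤ, (-x) ^ t = (-1) ^ t * x ^ t := by
    intro x t; rw [neg_eq_neg_one_mul, mul_zpow]
  have hs : ∀ t : ℤ, (-1 : ℂ) ^ t * (-1) ^ t = 1 := by
    intro t; rw [← mul_zpow]; norm_num
  have e1 : (-b) ^ (-l) * a ^ (n - l) = a ^ n * (-(a * b)) ^ (-l) := by
    rw [hne b, hne (a * b), mul_zpow, sub_eq_add_neg n l, zpow_add₀ ha]; ring
  have e2 : (-b) ^ (-l) * ((-1) ^ (n - l) * (-a) ^ (-m - (n - l))) =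
      ((-a) ^ (-m) * a ^ (-n)) * (-(a⁻¹ * b)) ^ (-l) := by
    rw [hne b, hne a, hne a, hne (a⁻¹ * b), mul_zpow a⁻¹, show -m - (n - l) = -m + (-n + l) by ring,
      zpow_add₀ ha, zpow_add₀ ha, zpow_add₀ ha1, zpow_add₀ ha1, inv_zpow', neg_neg,
      sub_eq_add_neg n l, zpow_add₀ ha1, hsq, hsq, hsq]
    linear_combination (((-1 : ℂ) ^ l) * b ^ (-l) * (-1) ^ m * a ^ (-m) * a ^ (-n) * a ^ l) *
      (hs n * (-1) ^ l * (-1) ^ l + hs l)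
  have e3 : (-b) ^ (-l) * a ^ l = ((-a) ^ (-m) * b ^ m) * (-(a⁻¹ * b)) ^ (-(m + l)) := by
    rw [hne b, hne a, hne (a⁻¹ * b), mul_zpow a⁻¹, inv_zpow', neg_neg, zpow_add₀ ha, neg_add,
      zpow_add₀ ha1, zpow_add₀ hb, hsq, hsq, zpow_neg a m, zpow_neg b m]
    have h1 : a ^ m ≠ 0 := zpow_ne_zero _ ha
    have h2 : b ^ m ≠ 0 := zpow_ne_zero _ hb
    field_simp
    linear_combination -hs m
  have e4 : (-b) ^ (-l) * ((-1) ^ l * (-a) ^ (-m - l)) = b ^ m * (-(a * b)) ^ (-(m + l)) := by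
    rw [hne b, hne a, hne (a * b), mul_zpow a, show -m - l = -(m + l) by ring, neg_add,
      zpow_add₀ ha1, zpow_add₀ hb, hsq, hsq, zpow_neg b m]
    have h2 : b ^ m ≠ 0 := zpow_ne_zero _ hb
    field_simp
    linear_combination hs l
  have h1 : quadOp hφ i j a m (wick φ p q (n - l) l v) -
        wick φ p q (n - l) l (quadOp hφ i j a m v) =
      (if j = p then 2 * a ^ (n - l) else 0) • φ i (m + n - l) (φ q l v) -
      (if i = p then 2 * ((-1) ^ (n - l) * (-a) ^ (-m - (n - l))) else 0) •
        φ j (m + n - l) (φ q l v) +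
      (if j = q then 2 * a ^ l else 0) • φ p (n - l) (φ i (m + l) v) -
      (if i = q then 2 * ((-1) ^ l * (-a) ^ (-m - l)) else 0) •
        φ p (n - l) (φ j (m + l) v) := by
    rw [wick, wick, map_sub, map_smul, quadOp_commutator_fermion hφ i j p ha,
      quadOp_commutator_fermion hφ i j q ha, map_add, map_sub, map_smul, map_smul,
      show m + (n - l) = m + n - l by ring]
    abel
  rw [h1, smul_sub, smul_add, smul_sub, smul_smul, smul_smul, smul_smul, smul_smul]
  congr 1
  · congr 1
    · congr 1
      · congr 1
        split_ifs
        · linear_combination 2 * e1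
        · ring
      · congr 1
        split_ifs
        · linear_combination 2 * e2
        · ring
    · congr 1
      split_ifs
      · linear_combination 2 * e3
      · ring
  · congr 1
    split_ifs
    · linear_combination 2 * e4
    · ring

theorem contraction_sum_aux (i : Fin ν) {x : ℂ} (hx : x ≠ 0) (m l : ℤ) :
    (-x) ^ (-l) * pairCoeff i i (-l) - x ^ m * ((-x) ^ (-(m + l)) * pairCoeff i i (-(m + l))) =
      x ^ (-l) * (signCoeff (-l) - signCoeff (-l - m)) := by
  have h1 : ∀ t : ℤ, (-x) ^ t * pairCoeff i i t = x ^ t * signCoeff t := by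
    intro t
    rw [pairCoeff_eq_signCoeff, neg_eq_neg_one_mul, mul_zpow]
    have : (-1 : ℂ) ^ t * (-1) ^ t = 1 := by rw [← mul_zpow]; norm_num
    linear_combination (x ^ t * signCoeff t) * this
  rw [h1, h1, ← mul_assoc, ← zpow_add₀ hx, show m + -(m + l) = -l by ring,
    show -(m + l) = -l - m by ring, mul_sub]

/-- Each of the two contraction series may be infinite. Their difference is finite because
`signCoeff` takes equal values at s and s - m when s lies outside the range between 0 and m. -/
theorem contraction_sum_support (i : Fin ν) {x : ℂ} (hx : x ≠ 0) (m : ℤ) :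
    (fun l : ℤ => (-x) ^ (-l) * pairCoeff i i (-l) -
      x ^ m * ((-x) ^ (-(m + l)) * pairCoeff i i (-(m + l)))).HasFiniteSupport := by
  simp only [contraction_sum_aux i hx]
  exact (signCoeff_support x m).comp_of_injective (Equiv.neg ℤ).injective

theorem contraction_sum (i : Fin ν) {x : ℂ} (hx : x ≠ 0) (m : ℤ) :
    ∑ᶠ l : ℤ, ((-x) ^ (-l) * pairCoeff i i (-l) -
      x ^ m * ((-x) ^ (-(m + l)) * pairCoeff i i (-(m + l)))) =
      mobius x * (1 - x ^ m) + if x = 1 then 2 * (m : ℂ) else 0 := by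
  simp only [contraction_sum_aux i hx]
  rw [← finsum_signCoeff hx, ← finsum_comp_equiv (Equiv.neg ℤ)]
  simp only [Equiv.neg_apply, neg_neg]

/-- The finite sum of the constants arising from a pair of contractions. -/
theorem contraction_pair (i j p q : Fin ν) {x : ℂ} (hx : x ≠ 0) (m n : ℤ) {c c' u u' : ℂ}
    (hc : c = if j = p then u else 0) (hc' : c' = if i = q then u' else 0)
    (hu : m + n = 0 → u' = u * x ^ m) :
    (fun l : ℤ => c * (-x) ^ (-l) * contraction i q (m + n - l) l -
      c' * (-x) ^ (-(m + l)) * contraction p j (n - l) (m + l)).HasFiniteSupport ∧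
    ∑ᶠ l : ℤ, (c * (-x) ^ (-l) * contraction i q (m + n - l) l -
      c' * (-x) ^ (-(m + l)) * contraction p j (n - l) (m + l)) =
    if i = q ∧ j = p ∧ m + n = 0 then u * (mobius x * (1 - x ^ m) + if x = 1 then 2 * (m : ℂ) else 0)
      else 0 := by
  by_cases h : i = q ∧ j = p ∧ m + n = 0
  · obtain ⟨rfl, rfl, h⟩ := h
    have h1 : ∀ l : ℤ, c * (-x) ^ (-l) * contraction i i (m + n - l) l -
        c' * (-x) ^ (-(m + l)) * contraction j j (n - l) (m + l) =
        u * ((-x) ^ (-l) * pairCoeff i i (-l) -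
          x ^ m * ((-x) ^ (-(m + l)) * pairCoeff i i (-(m + l)))) := by
      intro l
      rw [hc, hc', if_pos rfl, if_pos rfl, hu h, contraction, contraction, if_pos ⟨rfl, by omega⟩,
        if_pos ⟨rfl, by omega⟩, show m + n - l = -l by omega, show n - l = -(m + l) by omega]
      have h2 : pairCoeff j j (-(m + l)) = pairCoeff i i (-(m + l)) := by
        rw [pairCoeff_eq_signCoeff, pairCoeff_eq_signCoeff]
      rw [h2]
      ring
    simp only [h1]
    rw [if_pos ⟨trivial, trivial, h⟩]
    constructor
    · exact (contraction_sum_support i hx m).subset fun l hl => right_ne_zero_of_mul hl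
    · rw [← mul_finsum, contraction_sum i hx]
  · have h1 : ∀ l : ℤ, c * (-x) ^ (-l) * contraction i q (m + n - l) l -
        c' * (-x) ^ (-(m + l)) * contraction p j (n - l) (m + l) = 0 := by
      intro l
      have h2 : ¬ (i = q ∧ m + n - l + l = 0 ∧ j = p) := fun h' => h ⟨h'.1, h'.2.2, by omega⟩
      have h3 : ¬ (p = j ∧ n - l + (m + l) = 0 ∧ i = q) := fun h' => h ⟨h'.2.2, h'.1.symm, by omega⟩
      have h4 : c * contraction i q (m + n - l) l = 0 := by
        rw [hc, contraction]
        split_ifs with k1 k2 <;> try simp only [mul_zero, zero_mul]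
        exact absurd ⟨k2.1, k2.2, k1⟩ h2
      have h5 : c' * contraction p j (n - l) (m + l) = 0 := by
        rw [hc', contraction]
        split_ifs with k1 k2 <;> try simp only [mul_zero, zero_mul]
        exact absurd ⟨k2.1, k2.2, k1⟩ h3
      linear_combination (-x) ^ (-l) * h4 - (-x) ^ (-(m + l)) * h5
    simp only [h1]
    rw [if_neg h]
    exact ⟨by simp [Function.HasFiniteSupport], finsum_zero⟩

/-- The commutator of two quadratic expressions. -/
theorem quadOp_commutator (hφ : IsNeutralFermion φ) (i j p q : Fin ν) {a b : ℂ} (ha : a ≠ 0)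
    (hb : b ≠ 0) (m n : ℤ) (v : M) :
    quadOp hφ i j a m (quadOp hφ p q b n v) - quadOp hφ p q b n (quadOp hφ i j a m v) =
      (if j = p then 2 * a ^ n else 0) • quadOp hφ i q (a * b) (m + n) v -
      (if i = p then 2 * ((-a) ^ (-m) * a ^ (-n)) else 0) • quadOp hφ j q (a⁻¹ * b) (m + n) v +
      (if j = q then 2 * ((-a) ^ (-m) * b ^ m) else 0) • quadOp hφ p i (a⁻¹ * b) (m + n) v -
      (if i = q then 2 * b ^ m else 0) • quadOp hφ p j (a * b) (m + n) v +
      (4 * ((if i = q ∧ j = p ∧ m + n = 0 ∧ a * b = 1 then (m : ℂ) * a ^ n else 0) -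
        if j = q ∧ i = p ∧ m + n = 0 ∧ a⁻¹ * b = 1 then (-a) ^ (-m) * ((m : ℂ) * a⁻¹ ^ n) else 0)) •
          v := by
  have hx : a * b ≠ 0 := mul_ne_zero ha hb
  have hy : a⁻¹ * b ≠ 0 := mul_ne_zero (inv_ne_zero ha) hb
  set c1 : ℂ := if j = p then 2 * a ^ n else 0 with hc1
  set c2 : ℂ := if i = p then 2 * ((-a) ^ (-m) * a ^ (-n)) else 0 with hc2
  set c3 : ℂ := if j = q then 2 * ((-a) ^ (-m) * b ^ m) else 0 with hc3
  set c4 : ℂ := if i = q then 2 * b ^ m else 0 with hc4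
  set x := a * b with hxd
  set y := a⁻¹ * b with hyd
  set u := 2 * a ^ n with hud
  set w := 2 * ((-a) ^ (-m) * a ^ (-n)) with hwd
  have hu : m + n = 0 → 2 * b ^ m = u * x ^ m := by
    intro h
    rw [hud, hxd, mul_zpow, show n = -m by omega, zpow_neg]
    have := zpow_ne_zero m ha
    field_simp
  have hw : m + n = 0 → 2 * ((-a) ^ (-m) * b ^ m) = w * y ^ m := by
    intro h
    rw [hwd, hyd, mul_zpow, show n = -m by omega, neg_neg, inv_zpow]
    have := zpow_ne_zero m ha
    field_simp
  obtain ⟨hS1, hS1'⟩ := contraction_pair i j p q hx m n hc1 hc4 hu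
  obtain ⟨hS2, hS2'⟩ := contraction_pair j i p q hy m n hc2 hc3 hw
  have hlhs : quadOp hφ i j a m (quadOp hφ p q b n v) - quadOp hφ p q b n (quadOp hφ i j a m v) =
      ∑ᶠ l : ℤ, (-b) ^ (-l) • (quadOp hφ i j a m (wick φ p q (n - l) l v) -
        wick φ p q (n - l) l (quadOp hφ i j a m v)) := by
    have h1 : (fun l : ℤ => (-b) ^ (-l) • quadOp hφ i j a m (wick φ p q (n - l) l v)).HasFiniteSupport := by
      refine (hφ.wick_support p q n v fun l => (-b) ^ (-l)).subset fun l hl => ?_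
      rw [Function.mem_support] at hl ⊢
      intro h0
      apply hl
      rw [← map_smul, h0, map_zero]
    simp only [smul_sub]
    rw [finsum_sub_distrib h1 (hφ.wick_support p q n _ _), quadOp_apply hφ p q b n v,
      quadOp_apply hφ p q b n, map_add, map_smul, map_finsum _ (hφ.wick_support p q n v _)]
    simp only [map_smul]
    abel
  -- Each product is normally ordered. The contractions of the first and fourth terms are kept
  -- together, as are those of the second and third, since finiteness is guaranteed only for these
  -- differences.
  have hterm : ∀ l : ℤ, (-b) ^ (-l) • (quadOp hφ i j a m (wick φ p q (n - l) l v) -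
        wick φ p q (n - l) l (quadOp hφ i j a m v)) =
      (((c1 * (-x) ^ (-l)) • wick φ i q (m + n - l) l v -
        (c2 * (-y) ^ (-l)) • wick φ j q (m + n - l) l v) +
      ((c3 * (-y) ^ (-(m + l))) • wick φ p i (m + n - (m + l)) (m + l) v -
        (c4 * (-x) ^ (-(m + l))) • wick φ p j (m + n - (m + l)) (m + l) v)) +
      ((c1 * (-x) ^ (-l) * contraction i q (m + n - l) l -
        c4 * (-x) ^ (-(m + l)) * contraction p j (n - l) (m + l)) • v -
      (c2 * (-y) ^ (-l) * contraction j q (m + n - l) l -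
        c3 * (-y) ^ (-(m + l)) * contraction p i (n - l) (m + l)) • v) := by
    intro l
    rw [commutator_wick hφ i j p q ha hb, show m + n - (m + l) = n - l by ring]
    simp only [wick, smul_sub, smul_smul, sub_smul]
    abel
  have hk1 : (fun l : ℤ => (c1 * (-x) ^ (-l)) • wick φ i q (m + n - l) l v -
      (c2 * (-y) ^ (-l)) • wick φ j q (m + n - l) l v).HasFiniteSupport :=
    (hφ.wick_support i q (m + n) v fun l => c1 * (-x) ^ (-l)).sub
      (hφ.wick_support j q (m + n) v fun l => c2 * (-y) ^ (-l))
  have hk2 : (fun l : ℤ => (c3 * (-y) ^ (-l)) • wick φ p i (m + n - l) l v -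
      (c4 * (-x) ^ (-l)) • wick φ p j (m + n - l) l v).HasFiniteSupport :=
    (hφ.wick_support p i (m + n) v fun l => c3 * (-y) ^ (-l)).sub
      (hφ.wick_support p j (m + n) v fun l => c4 * (-x) ^ (-l))
  have hk2' : (fun l : ℤ => (c3 * (-y) ^ (-(m + l))) • wick φ p i (m + n - (m + l)) (m + l) v -
      (c4 * (-x) ^ (-(m + l))) • wick φ p j (m + n - (m + l)) (m + l) v).HasFiniteSupport :=
    hk2.comp_of_injective (Equiv.addLeft m).injective
  have hsm : ∀ f : ℤ → ℂ, f.HasFiniteSupport → (fun l => f l • v).HasFiniteSupport :=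
    fun f hf => hf.subset fun l hl => left_ne_zero_of_smul hl
  have hk3 : (fun l : ℤ => (c1 * (-x) ^ (-l) * contraction i q (m + n - l) l -
        c4 * (-x) ^ (-(m + l)) * contraction p j (n - l) (m + l)) • v -
      (c2 * (-y) ^ (-l) * contraction j q (m + n - l) l -
        c3 * (-y) ^ (-(m + l)) * contraction p i (n - l) (m + l)) • v).HasFiniteSupport :=
    (hsm _ hS1).sub (hsm _ hS2)
  have hk12 : (fun l : ℤ => ((c1 * (-x) ^ (-l)) • wick φ i q (m + n - l) l v -
        (c2 * (-y) ^ (-l)) • wick φ j q (m + n - l) l v) +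
      ((c3 * (-y) ^ (-(m + l))) • wick φ p i (m + n - (m + l)) (m + l) v -
        (c4 * (-x) ^ (-(m + l))) • wick φ p j (m + n - (m + l)) (m + l) v)).HasFiniteSupport :=
    hk1.add hk2'
  have hshift : ∑ᶠ l : ℤ, ((c3 * (-y) ^ (-(m + l))) • wick φ p i (m + n - (m + l)) (m + l) v -
      (c4 * (-x) ^ (-(m + l))) • wick φ p j (m + n - (m + l)) (m + l) v) =
      ∑ᶠ l : ℤ, ((c3 * (-y) ^ (-l)) • wick φ p i (m + n - l) l v -
      (c4 * (-x) ^ (-l)) • wick φ p j (m + n - l) l v) :=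
    finsum_comp_equiv (Equiv.addLeft m)
      (f := fun l => (c3 * (-y) ^ (-l)) • wick φ p i (m + n - l) l v -
        (c4 * (-x) ^ (-l)) • wick φ p j (m + n - l) l v)
  rw [hlhs]
  simp only [hterm]
  rw [finsum_add_distrib hk12 hk3, finsum_add_distrib hk1 hk2', hshift,
    finsum_sub_distrib (hφ.wick_support _ _ _ _ _) (hφ.wick_support _ _ _ _ _),
    finsum_sub_distrib (hφ.wick_support _ _ _ _ _) (hφ.wick_support _ _ _ _ _),
    finsum_sub_distrib (hsm _ hS1) (hsm _ hS2), ← finsum_smul, ← finsum_smul, hS1', hS2']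
  simp only [mul_smul, ← smul_finsum, quadOp_apply, smul_add]
  set W1 := ∑ᶠ l : ℤ, (-x) ^ (-l) • wick φ i q (m + n - l) l v
  set W2 := ∑ᶠ l : ℤ, (-y) ^ (-l) • wick φ j q (m + n - l) l v
  set W3 := ∑ᶠ l : ℤ, (-y) ^ (-l) • wick φ p i (m + n - l) l v
  set W4 := ∑ᶠ l : ℤ, (-x) ^ (-l) • wick φ p j (m + n - l) l v
  -- The Möbius part of the anomaly consists of the scalars contained in the four quadratic
  -- operators on the right; what remains is proportional to m and present only for x = 1 or y = 1.
  have hconst : (if i = q ∧ j = p ∧ m + n = 0 then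
        u * (mobius x * (1 - x ^ m) + if x = 1 then 2 * (m : ℂ) else 0) else 0) -
      (if j = q ∧ i = p ∧ m + n = 0 then
        w * (mobius y * (1 - y ^ m) + if y = 1 then 2 * (m : ℂ) else 0) else 0) =
      c1 * (if i = q ∧ m + n = 0 then mobius x else 0) -
      c2 * (if j = q ∧ m + n = 0 then mobius y else 0) +
      c3 * (if p = i ∧ m + n = 0 then mobius y else 0) -
      c4 * (if p = j ∧ m + n = 0 then mobius x else 0) +
      4 * ((if i = q ∧ j = p ∧ m + n = 0 ∧ x = 1 then (m : ℂ) * a ^ n else 0) -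
        if j = q ∧ i = p ∧ m + n = 0 ∧ y = 1 then (-a) ^ (-m) * ((m : ℂ) * a⁻¹ ^ n) else 0) := by
    by_cases hmn : m + n = 0
    swap
    · simp [hmn]
    have hu' := hu hmn
    have hw' := hw hmn
    have e1 : (if i = q ∧ j = p ∧ m + n = 0 then
        u * (mobius x * (1 - x ^ m) + if x = 1 then 2 * (m : ℂ) else 0) else 0) =
        c1 * (if i = q ∧ m + n = 0 then mobius x else 0) -
        c4 * (if p = j ∧ m + n = 0 then mobius x else 0) +
        4 * (if i = q ∧ j = p ∧ m + n = 0 ∧ x = 1 then (m : ℂ) * a ^ n else 0) := by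
      rw [hc1, hc4]
      by_cases h1 : i = q
      · by_cases h2 : j = p
        · simp only [h1, h2, hmn, true_and, if_true]
          split_ifs
          · rw [hud] at hu' ⊢; linear_combination (mobius x) * hu'
          · linear_combination (mobius x) * hu'
        · simp [h1, h2, Ne.symm h2]
      · simp [h1]
    have e2 : (if j = q ∧ i = p ∧ m + n = 0 then
        w * (mobius y * (1 - y ^ m) + if y = 1 then 2 * (m : ℂ) else 0) else 0) =
        c2 * (if j = q ∧ m + n = 0 then mobius y else 0) -
        c3 * (if p = i ∧ m + n = 0 then mobius y else 0) +
        4 * (if j = q ∧ i = p ∧ m + n = 0 ∧ y = 1 then (-a) ^ (-m) * ((m : ℂ) * a⁻¹ ^ n) else 0) := by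
      rw [hc2, hc3]
      by_cases h1 : j = q
      · by_cases h2 : i = p
        · simp only [h1, h2, hmn, true_and, if_true]
          split_ifs
          · rw [inv_zpow']
            rw [hwd] at hw' ⊢
            linear_combination (mobius y) * hw'
          · linear_combination (mobius y) * hw'
        · simp [h1, h2, Ne.symm h2]
      · simp [h1]
    rw [e1, e2]
    ring
  rw [← sub_smul, hconst]
  simp only [add_smul, sub_smul, mul_smul]
  abel

end Quadratic


/-! ## The vertex representation -/

section Construction

variable {G : Type*} [AddCommGroup G] (σ : AddChar G ℂ) {ν : ℕ} {M : Type*} [AddCommGroup M]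
  [Module ℂ M] {φ : Fin ν → ℤ → Module.End ℂ M}

/-- The operator attached to the matrix unit `E_ij` with coefficient in `R_σ`. -/
def entryOp (hφ : IsNeutralFermion φ) (i j : Fin ν) : SkewLaurent σ →ₗ[ℂ] Module.End ℂ M :=
  lift (skewCocycle σ) fun x => (1 / 4 : ℂ) • quadOp hφ i j (σ x.2) x.1

/-- The operator attached to a matrix over `R_σ`. -/
def matrixOp (hφ : IsNeutralFermion φ) :
    Matrix (Fin ν) (Fin ν) (SkewLaurent σ) →ₗ[ℂ] Module.End ℂ M :=
  ∑ i, ∑ j, entryOp σ hφ i j ∘ₗ Matrix.entryLinearMap ℂ (SkewLaurent σ) i j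

variable (hφ : IsNeutralFermion φ)

theorem entryOp_mono (i j : Fin ν) (m : ℤ) (α : G) (v : M) :
    entryOp σ hφ i j (mono σ m α) v = (1 / 4 : ℂ) • quadOp hφ i j (σ α) m v := by
  simp [entryOp, mono]

theorem matrixOp_single (i j : Fin ν) (A : SkewLaurent σ) :
    matrixOp σ hφ (Matrix.single i j A) = entryOp σ hφ i j A := by
  simp only [matrixOp, LinearMap.sum_apply, LinearMap.comp_apply, Matrix.entryLinearMap_apply]
  rw [Finset.sum_eq_single i, Finset.sum_eq_single j]
  · simp
  · intro q _ hq
    rw [Matrix.single_apply_of_col_ne _ _ hq.symm, map_zero]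
  · simp
  · intro p _ hp
    refine Finset.sum_eq_zero fun q _ => ?_
    rw [Matrix.single_apply_of_row_ne hp.symm, map_zero]
  · simp

/-- `quadOp_symm` in terms of the anti-involution. As a consequence `matrixOp` depends only on the
skew-hermitian part of a matrix. -/
theorem entryOp_bar (i j : Fin ν) (A : SkewLaurent σ) :
    entryOp σ hφ j i (bar σ A) = -entryOp σ hφ i j A := by
  have h : entryOp σ hφ j i ∘ₗ bar σ = -entryOp σ hφ i j := by
    refine TwistedAlgebra.hom_ext fun x => LinearMap.ext fun v => ?_
    change entryOp σ hφ j i (bar σ (mono σ x.1 x.2)) v = -(entryOp σ hφ i j (mono σ x.1 x.2) v)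
    rw [bar_mono, map_smul, LinearMap.smul_apply, entryOp_mono, entryOp_mono,
      quadOp_symm hφ i j (char_ne_zero σ x.2), char_neg, smul_neg, neg_neg, smul_comm]
  exact LinearMap.congr_fun h A

/-- The matrix `E_ij A - E_ji \overline{A}`. -/
def skewUnit (i j : Fin ν) (A : SkewLaurent σ) : Matrix (Fin ν) (Fin ν) (SkewLaurent σ) :=
  Matrix.single i j A - Matrix.single j i (bar σ A)

theorem matrixOp_skewUnit (i j : Fin ν) (A : SkewLaurent σ) :
    matrixOp σ hφ (skewUnit σ i j A) = (2 : ℂ) • entryOp σ hφ i j A := by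
  rw [skewUnit, map_sub, matrixOp_single, matrixOp_single, entryOp_bar, sub_neg_eq_add, two_smul]

theorem matrixCocycle_single (i j p q : Fin ν) (A B : SkewLaurent σ) :
    matrixCocycle σ ν (Matrix.single i j A) (Matrix.single p q B) =
      if j = p ∧ i = q then cocycleForm σ A B else 0 := by
  rw [matrixCocycle, Finset.sum_eq_single i, Finset.sum_eq_single j]
  · simp only [Matrix.single_apply, and_self, if_true, eq_comm (a := p), eq_comm (a := q)]
    split_ifs <;> simp
  · intro k _ hk
    rw [Matrix.single_apply_of_col_ne _ _ hk.symm, map_zero, LinearMap.zero_apply]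
  · simp
  · intro k _ hk
    refine Finset.sum_eq_zero fun l _ => ?_
    rw [Matrix.single_apply_of_row_ne hk.symm, map_zero, LinearMap.zero_apply]
  · simp

theorem single_mul_single_ite (i j p q : Fin ν) (A B : SkewLaurent σ) :
    Matrix.single i j A * Matrix.single p q B = if j = p then Matrix.single i q (A * B) else 0 := by
  split_ifs with h
  · subst h
    exact Matrix.single_mul_single_same _ _ _ _ _
  · exact Matrix.single_mul_single_of_ne _ _ _ _ h _

/-- The matrix unit form of `quadOp_commutator`. The normalization 1/4 makes a skew unit act as half
a quadratic operator, and turns the central coefficient 4 into 2 · (1/4) · (1/4) · 4 = 1/2. -/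
theorem commutator_entryOp_mono (i j p q : Fin ν) (m n : ℤ) (α β : G) (v : M) :
    matrixOp σ hφ (skewUnit σ i j (mono σ m α)) (entryOp σ hφ p q (mono σ n β) v) -
      entryOp σ hφ p q (mono σ n β) (matrixOp σ hφ (skewUnit σ i j (mono σ m α)) v) =
    matrixOp σ hφ (skewUnit σ i j (mono σ m α) * Matrix.single p q (mono σ n β) -
      Matrix.single p q (mono σ n β) * skewUnit σ i j (mono σ m α)) v +
      (1 / 2 * matrixCocycle σ ν (skewUnit σ i j (mono σ m α))
        (Matrix.single p q (mono σ n β))) • v := by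
  have ha := char_ne_zero σ α
  have hq := quadOp_commutator hφ i j p q ha (char_ne_zero σ β) m n v
  have h8 : ∀ x y : M, (1 / 4 : ℂ) • (2 : ℂ) • (1 / 4 : ℂ) • x - (2 : ℂ) • (1 / 4 : ℂ) • (1 / 4 : ℂ) • y =
      (1 / 8 : ℂ) • (x - y) := by
    intro x y
    module
  have hterm : ∀ (P : Prop) [Decidable P] (c c' : ℂ) (i j : Fin ν) (n : ℤ) (β γ : G),
      (P → c = 2 * c') →
      matrixOp σ hφ (if P then Matrix.single i j (c' • mono σ n (β + γ)) else 0) v =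
        (1 / 8 : ℂ) • ((if P then c else 0) • quadOp hφ i j (σ β * σ γ) n v) := by
    intro P _ c c' i j n β γ hc
    split_ifs with h
    · rw [matrixOp_single, map_smul, LinearMap.smul_apply, entryOp_mono, AddChar.map_add_eq_mul,
        hc h]
      module
    · simp
  rw [matrixOp_skewUnit]
  simp only [LinearMap.smul_apply, map_smul, entryOp_mono]
  rw [h8, hq, skewUnit, sub_mul,
    mul_sub (Matrix.single p q _), matrixCocycle_sub_left, matrixCocycle_single,
    matrixCocycle_single]
  simp only [single_mul_single_ite, bar_mono, smul_mul_assoc, mul_smul_comm, mono_mul_mono, map_sub,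
    LinearMap.sub_apply, map_smul, LinearMap.smul_apply, cocycleForm_mono, smul_smul]
  rw [hterm (j = p) (2 * σ α ^ n) _ _ _ _ _ _ fun _ => rfl,
    hterm (i = p) (2 * ((-σ α) ^ (-m) * σ (-α) ^ n)) _ _ _ _ _ _ fun _ => rfl,
    hterm (q = i) (2 * σ β ^ m) _ _ _ _ _ _ fun _ => rfl,
    hterm (q = j) (2 * ((-σ α) ^ (-m) * σ β ^ m)) _ _ _ _ _ _ fun _ => rfl]
  simp only [char_neg, inv_zpow', eq_comm (a := q), add_comm n m, mul_comm (σ β)]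
  have hsc : (1 / 8 : ℂ) * (4 * ((if i = q ∧ j = p ∧ m + n = 0 ∧ σ α * σ β = 1 then (m : ℂ) * σ α ^ n
      else 0) - if j = q ∧ i = p ∧ m + n = 0 ∧ (σ α)⁻¹ * σ β = 1 then
        (-σ α) ^ (-m) * ((m : ℂ) * σ α ^ (-n)) else 0)) =
      1 / 2 * ((if j = p ∧ i = q then
        if m + n = 0 ∧ σ α * σ β = 1 then (m : ℂ) * σ α ^ n else 0 else 0) -
        if i = p ∧ j = q then (-σ α) ^ (-m) • (if m + n = 0 ∧ (σ α)⁻¹ * σ β = 1 then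
          (m : ℂ) * σ α ^ (-n) else 0) else 0) := by
    rw [show (1 / 2 : ℂ) = 1 / 8 * 4 by norm_num, mul_assoc]
    congr 3
    · simp only [← ite_and, and_assoc, and_left_comm]
    · by_cases h : i = p ∧ j = q
      · simp [h.1, h.2]
      · rw [if_neg h, if_neg fun h' => h ⟨h'.2.1, h'.1⟩]
  rw [smul_add, smul_smul (1 / 8 : ℂ) _ v, hsc]
  simp only [smul_sub, smul_add]
  abel

/-- Leaving `Y` arbitrary, not skew-hermitian, permits reduction by linearity to a single monomial
matrix unit. -/
theorem commutator_matrixOp_skewUnit (i j : Fin ν) (A : SkewLaurent σ)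
    (Y : Matrix (Fin ν) (Fin ν) (SkewLaurent σ)) (v : M) :
    matrixOp σ hφ (skewUnit σ i j A) (matrixOp σ hφ Y v) -
      matrixOp σ hφ Y (matrixOp σ hφ (skewUnit σ i j A) v) =
    matrixOp σ hφ (skewUnit σ i j A * Y - Y * skewUnit σ i j A) v +
      (1 / 2 * matrixCocycle σ ν (skewUnit σ i j A) Y) • v := by
  induction A using induction_on with
  | h0 => simp [skewUnit, matrixCocycle]
  | hadd x y hx hy =>
    have h : skewUnit σ i j (x + y) = skewUnit σ i j x + skewUnit σ i j y := by
      simp only [skewUnit, map_add, Matrix.single_add]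
      abel
    rw [h, add_mul, mul_add, matrixCocycle_add_left, add_sub_add_comm, map_add, map_add,
      LinearMap.add_apply, LinearMap.add_apply, LinearMap.add_apply, map_add, add_sub_add_comm, hx,
      hy, mul_add, add_smul]
    abel
  | he r a =>
    have h : skewUnit σ i j (r • e (skewCocycle σ) a) = r • skewUnit σ i j (mono σ a.1 a.2) := by
      simp only [skewUnit, map_smul, smul_sub, Matrix.smul_single]
      rfl
    have h2 : matrixCocycle σ ν (r • skewUnit σ i j (mono σ a.1 a.2)) Y =
        r * matrixCocycle σ ν (skewUnit σ i j (mono σ a.1 a.2)) Y := by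
      simp [matrixCocycle, Finset.mul_sum]
    suffices h1 : matrixOp σ hφ (skewUnit σ i j (mono σ a.1 a.2)) (matrixOp σ hφ Y v) -
        matrixOp σ hφ Y (matrixOp σ hφ (skewUnit σ i j (mono σ a.1 a.2)) v) =
        matrixOp σ hφ (skewUnit σ i j (mono σ a.1 a.2) * Y - Y * skewUnit σ i j (mono σ a.1 a.2)) v +
        (1 / 2 * matrixCocycle σ ν (skewUnit σ i j (mono σ a.1 a.2)) Y) • v by
      rw [h, h2, smul_mul_assoc, mul_smul_comm, ← smul_sub, map_smul, map_smul,
        LinearMap.smul_apply, LinearMap.smul_apply, LinearMap.smul_apply, map_smul, ← smul_sub, h1,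
        smul_add, smul_smul r (1 / 2 * _), mul_left_comm r]
    clear h2
    induction Y using Matrix.induction_on' with
    | h_zero => simp [matrixCocycle]
    | h_add X Y hX hY =>
      rw [map_add, LinearMap.add_apply, LinearMap.add_apply, map_add, add_sub_add_comm, hX, hY,
        mul_add, add_mul, add_sub_add_comm, map_add, LinearMap.add_apply, matrixCocycle_add_right,
        mul_add, add_smul]
      abel
    | h_std_basis p q B =>
      induction B using induction_on with
      | h0 => simp [matrixCocycle]
      | hadd X Y hX hY =>
        rw [Matrix.single_add, map_add, LinearMap.add_apply, LinearMap.add_apply, map_add,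
          add_sub_add_comm, hX, hY, mul_add, add_mul, add_sub_add_comm, map_add,
          LinearMap.add_apply, matrixCocycle_add_right, mul_add, add_smul]
        abel
      | he s b =>
        rw [← Matrix.smul_single, map_smul, LinearMap.smul_apply, LinearMap.smul_apply, map_smul,
          ← smul_sub, mul_smul_comm, smul_mul_assoc, ← smul_sub, map_smul, LinearMap.smul_apply,
          matrixCocycle_smul_right, mul_left_comm, ← smul_smul s, ← smul_add, matrixOp_single]
        congr 1
        exact commutator_entryOp_mono σ hφ i j p q a.1 b.1 a.2 b.2 v

theorem sum_skewUnit {X : Matrix (Fin ν) (Fin ν) (SkewLaurent σ)} (hX : matStar σ ν X = -X) :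
    ∑ i, ∑ j, skewUnit σ i j (X i j) = (2 : ℂ) • X := by
  have h1 : ∑ i, ∑ j, Matrix.single i j (X i j) = X := (Matrix.matrix_eq_sum_single X).symm
  have h2 : ∑ i, ∑ j, Matrix.single j i (bar σ (X i j)) = -X := by
    rw [← hX, Finset.sum_comm]
    exact (Matrix.matrix_eq_sum_single (matStar σ ν X)).symm
  simp only [skewUnit, Finset.sum_sub_distrib]
  rw [h1, h2, sub_neg_eq_add, two_smul]

theorem commutator_matrixOp {X : Matrix (Fin ν) (Fin ν) (SkewLaurent σ)}
    (hX : matStar σ ν X = -X) (Y : Matrix (Fin ν) (Fin ν) (SkewLaurent σ)) (v : M) :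
    matrixOp σ hφ X (matrixOp σ hφ Y v) - matrixOp σ hφ Y (matrixOp σ hφ X v) =
    matrixOp σ hφ (X * Y - Y * X) v + (1 / 2 * matrixCocycle σ ν X Y) • v := by
  have hX' : X = ∑ i, ∑ j, skewUnit σ i j ((1 / 2 : ℂ) • X i j) := by
    have h := sum_skewUnit σ (X := (1 / 2 : ℂ) • X) (by
      ext1 i j
      have := congrFun (congrFun hX i) j
      simp only [matStar, Matrix.neg_apply, Matrix.smul_apply, map_smul] at this ⊢
      rw [this, smul_neg])
    simp only [Matrix.smul_apply] at h
    rw [h, smul_smul]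
    norm_num
  rw [hX']
  have hcoc : matrixCocycle σ ν (∑ i, ∑ j, skewUnit σ i j ((1 / 2 : ℂ) • X i j)) Y =
      ∑ i, ∑ j, matrixCocycle σ ν (skewUnit σ i j ((1 / 2 : ℂ) • X i j)) Y := by
    let f : Matrix (Fin ν) (Fin ν) (SkewLaurent σ) →+ ℂ :=
      { toFun := fun X => matrixCocycle σ ν X Y
        map_zero' := by simp [matrixCocycle]
        map_add' := fun _ _ => matrixCocycle_add_left σ ν _ _ _ }
    change f _ = ∑ i, ∑ j, f _
    simp only [map_sum]
  simp only [hcoc, map_sum, LinearMap.sum_apply, Finset.sum_mul, Finset.mul_sum,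
    ← Finset.sum_sub_distrib, Finset.sum_smul, ← Finset.sum_add_distrib]
  refine Finset.sum_congr rfl fun i _ => Finset.sum_congr rfl fun j _ => ?_
  exact commutator_matrixOp_skewUnit σ hφ i j _ Y v

/-- The representation of the unitary Lie algebra attached to neutral fermions. -/
def fermionRep : unitaryHat σ ν →ₗ⁅ℂ⁆ Module.End ℂ M where
  toFun x := matrixOp σ hφ x.1.mat + (x.1.cen / 2) • (1 : Module.End ℂ M)
  map_add' x y := LinearMap.ext fun v => by
    change matrixOp σ hφ (x.1.mat + y.1.mat) v + ((x.1.cen + y.1.cen) / 2) • v =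
      (matrixOp σ hφ x.1.mat v + (x.1.cen / 2) • v) + (matrixOp σ hφ y.1.mat v + (y.1.cen / 2) • v)
    rw [map_add, LinearMap.add_apply, add_div, add_smul]
    abel
  map_smul' r x := LinearMap.ext fun v => by
    change matrixOp σ hφ (r • x.1.mat) v + (r * x.1.cen / 2) • v =
      r • (matrixOp σ hφ x.1.mat v + (x.1.cen / 2) • v)
    rw [map_smul, LinearMap.smul_apply, mul_div_assoc, smul_add, smul_smul r]
  map_lie' := by
    intro x y
    refine LinearMap.ext fun v => ?_
    change matrixOp σ hφ (x.1.mat * y.1.mat - y.1.mat * x.1.mat) v +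
        (matrixCocycle σ ν x.1.mat y.1.mat / 2) • v =
      (matrixOp σ hφ x.1.mat (matrixOp σ hφ y.1.mat v + (y.1.cen / 2) • v) +
        (x.1.cen / 2) • (matrixOp σ hφ y.1.mat v + (y.1.cen / 2) • v)) -
      (matrixOp σ hφ y.1.mat (matrixOp σ hφ x.1.mat v + (x.1.cen / 2) • v) +
        (y.1.cen / 2) • (matrixOp σ hφ x.1.mat v + (x.1.cen / 2) • v))
    have h := commutator_matrixOp σ hφ x.2 y.1.mat v
    rw [div_eq_inv_mul, ← one_div, ← h]
    simp only [map_add, map_smul, smul_add, smul_smul, mul_comm (y.1.cen / 2)]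
    abel

end Construction

theorem isVertexRep_fermionRep {G : Type*} [AddCommGroup G] (σ : AddChar G ℂ) (ν : ℕ) :
    IsVertexRep σ ν (fermionRep σ (isNeutralFermion_fermion (ν := ν))) where
  gen i j m α v := by
    have h := vertexMode_add_eq_quadMode i j (char_ne_zero σ α) m v
    -- `IsVertexRep` decides its condition classically; the two conditionals differ only in the
    -- decidability instance.
    have h2 : ∀ (P : Prop) (d d' : Decidable P) (x : Fock ν),
        @ite _ P d x 0 = @ite _ P d' x 0 := fun P d d' x => by congr
    rw [h2 _ _ (inferInstance)] at h
    rw [map_smul, LinearMap.smul_apply]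
    change (2 : ℂ) • (matrixOp σ isNeutralFermion_fermion (skewUnit σ i j (mono σ m α)) v +
      ((0 : ℂ) / 2) • v) = _
    rw [matrixOp_skewUnit, LinearMap.smul_apply, entryOp_mono, zero_div, zero_smul, add_zero,
      smul_smul, smul_smul]
    norm_num
    exact h.symm
  center v := by
    change matrixOp σ isNeutralFermion_fermion 0 v + ((1 : ℂ) / 2) • v = _
    rw [map_zero, LinearMap.zero_apply, zero_add]


/-! ## Submodules of the vertex representation -/

section Stable

variable {L M : Type*} [LieRing L] [LieAlgebra ℂ L] [AddCommGroup M] [Module ℂ M]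

/-- The elements of `L` that preserve a subspace. -/
def stabilizerAlg (ρ : L →ₗ⁅ℂ⁆ Module.End ℂ M) (W : Submodule ℂ M) : LieSubalgebra ℂ L where
  carrier := {x | ∀ w ∈ W, ρ x w ∈ W}
  zero_mem' := fun w _ => by
    rw [map_zero, LinearMap.zero_apply]
    exact W.zero_mem
  add_mem' := fun {x y} hx hy w hw => by
    rw [map_add, LinearMap.add_apply]
    exact W.add_mem (hx w hw) (hy w hw)
  smul_mem' := fun r x hx w hw => by
    rw [map_smul, LinearMap.smul_apply]
    exact W.smul_mem r (hx w hw)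
  lie_mem' := fun {x y} hx hy w hw => by
    rw [LieHom.map_lie, LieRing.of_associative_ring_bracket, LinearMap.sub_apply,
      Module.End.mul_apply, Module.End.mul_apply]
    exact W.sub_mem (hx _ (hy w hw)) (hy _ (hx w hw))

end Stable

/-! ### From the Lie algebra action to quadratic operators -/

section Translation

variable {G : Type*} [AddCommGroup G] {σ : AddChar G ℂ} {ν : ℕ}
  {ρ : unitaryHat σ ν →ₗ⁅ℂ⁆ Module.End ℂ (Fock ν)}

/-- Every vertex representation acts through the same fermionic quadratics, so the study of
submodules does not depend on how the representation was built. -/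
theorem IsVertexRep.unitaryGen_apply (hρ : IsVertexRep σ ν ρ) (i j : Fin ν) (m : ℤ) (α : G)
    (v : Fock ν) :
    ρ (unitaryGen σ ν i j m α) v = (1 / 2 : ℂ) • quadMode fermion i j (σ α) m v := by
  have h := hρ.gen i j m α v
  have h1 := vertexMode_add_eq_quadMode i j (char_ne_zero σ α) m v
  have h2 : ∀ (P : Prop) (d d' : Decidable P) (x : Fock ν),
      @ite _ P d x 0 = @ite _ P d' x 0 := fun P d d' x => by congr
  rw [h2 _ _ (inferInstance)] at h1
  rw [h1, map_smul, LinearMap.smul_apply] at h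
  rw [← h, smul_smul]
  norm_num

/-- Stability under the quadratic operators with distinct indices. -/
def IsQuadStable (σ : AddChar G ℂ) (W : Submodule ℂ (Fock ν)) : Prop :=
  ∀ i j : Fin ν, i ≠ j → ∀ (α : G) (m : ℤ), ∀ v ∈ W, quadMode fermion i j (σ α) m v ∈ W

theorem IsVertexRep.isSubrep_elementaryHat_iff (hρ : IsVertexRep σ ν ρ)
    (W : Submodule ℂ (Fock ν)) : IsSubrep ρ (elementaryHat σ ν) W ↔ IsQuadStable σ W := by
  constructor
  · intro h i j hij α m v hv
    have h1 := W.smul_mem (2 : ℂ) (h (unitaryGen σ ν i j m α)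
      (LieSubalgebra.subset_lieSpan ⟨i, j, hij, m, α, rfl⟩) v hv)
    rwa [hρ.unitaryGen_apply, smul_smul, mul_one_div_cancel (by norm_num), one_smul] at h1
  · intro h
    have h1 : elementaryHat σ ν ≤ stabilizerAlg ρ W := by
      refine LieSubalgebra.lieSpan_le.2 ?_
      rintro _ ⟨i, j, hij, m, α, rfl⟩ w hw
      rw [hρ.unitaryGen_apply]
      exact W.smul_mem _ (h i j hij α m w hw)
    exact fun x hx w hw => h1 hx w hw

/-- The elements with given matrix and no central component, as a linear map. -/
def ofMatrix (σ : AddChar G ℂ) (ν : ℕ) :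
    Matrix (Fin ν) (Fin ν) (SkewLaurent σ) →ₗ[ℂ] GLHat σ ν where
  toFun X := ⟨X, 0⟩
  map_add' X Y := GLHat.ext rfl (by simp)
  map_smul' r X := GLHat.ext rfl (by simp)

theorem ofMatrix_skewUnit_mem (i j : Fin ν) (A : SkewLaurent σ) {S : Submodule ℂ (GLHat σ ν)}
    (hS : ∀ m α, (unitaryGen σ ν i j m α : GLHat σ ν) ∈ S) :
    ofMatrix σ ν (skewUnit σ i j A) ∈ S := by
  induction A using induction_on with
  | h0 =>
    have : skewUnit σ i j (0 : SkewLaurent σ) = 0 := by simp [skewUnit]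
    rw [this, map_zero]
    exact S.zero_mem
  | hadd x y hx hy =>
    have h : skewUnit σ i j (x + y) = skewUnit σ i j x + skewUnit σ i j y := by
      simp only [skewUnit, map_add, Matrix.single_add]
      abel
    rw [h, map_add]
    exact S.add_mem hx hy
  | he r a =>
    have h : skewUnit σ i j (r • e (skewCocycle σ) a) = r • skewUnit σ i j (mono σ a.1 a.2) := by
      simp only [skewUnit, map_smul, smul_sub, Matrix.smul_single]
      rfl
    rw [h, map_smul]
    exact S.smul_mem _ (hS a.1 a.2)

/-- A skew-hermitian X is half the sum of the skew units of its entries, so the e_ij(m, α) and c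
span the whole Lie algebra. -/
theorem unitaryHat_le_of_gen {S : Submodule ℂ (GLHat σ ν)}
    (hS : ∀ i j m α, (unitaryGen σ ν i j m α : GLHat σ ν) ∈ S)
    (hc : (unitaryCenter σ ν : GLHat σ ν) ∈ S) (x : unitaryHat σ ν) : (x : GLHat σ ν) ∈ S := by
  have hx : (x : GLHat σ ν) = (1 / 2 : ℂ) • ∑ i, ∑ j, ofMatrix σ ν (skewUnit σ i j (x.1.mat i j)) +
      x.1.cen • (unitaryCenter σ ν : GLHat σ ν) := by
    simp only [← map_sum]
    rw [sum_skewUnit σ x.2]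
    refine GLHat.ext ?_ ?_
    · change x.1.mat = (1 / 2 : ℂ) • (2 : ℂ) • x.1.mat + x.1.cen • (0 : Matrix _ _ _)
      rw [smul_smul, smul_zero]
      norm_num
    · change x.1.cen = (1 / 2 : ℂ) * 0 + x.1.cen * 1
      ring
  rw [hx]
  refine S.add_mem (S.smul_mem _ (S.sum_mem fun i _ => S.sum_mem fun j _ => ?_)) (S.smul_mem _ hc)
  exact ofMatrix_skewUnit_mem i j _ (hS i j)

theorem IsVertexRep.isSubrep_top (hρ : IsVertexRep σ ν ρ) {W : Submodule ℂ (Fock ν)}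
    (hW : ∀ (i j : Fin ν) (α : G) (m : ℤ), ∀ v ∈ W, quadMode fermion i j (σ α) m v ∈ W) :
    IsSubrep ρ ⊤ W := by
  intro x _
  have h := unitaryHat_le_of_gen
    (S := (stabilizerAlg ρ W).toSubmodule.map (unitaryHat σ ν).toSubmodule.subtype)
    (fun i j m α => ⟨unitaryGen σ ν i j m α, fun w hw => by
      rw [hρ.unitaryGen_apply]; exact W.smul_mem _ (hW i j α m w hw), rfl⟩)
    ⟨unitaryCenter σ ν, fun w hw => by rw [hρ.center]; exact W.smul_mem _ hw, rfl⟩ x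
  obtain ⟨y, hy, hyx⟩ := h
  obtain rfl : y = x := Subtype.ext hyx
  exact hy

end Translation

/-! ## The subspaces `U ⊗ P` -/

section Tensor

variable {ν : ℕ}

theorem tmul_mem_tensorSub {U : Submodule ℂ (GroupAlg ν)} {P : Submodule ℂ (SymAlg ν)}
    {g : GroupAlg ν} {p : SymAlg ν} (hg : g ∈ U) (hp : p ∈ P) : g ⊗ₜ p ∈ tensorSub ν U P :=
  Submodule.apply_mem_map₂ _ hg hp

theorem tensorSub_le {U : Submodule ℂ (GroupAlg ν)} {P : Submodule ℂ (SymAlg ν)}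
    {W : Submodule ℂ (Fock ν)} : tensorSub ν U P ≤ W ↔ ∀ g ∈ U, ∀ p ∈ P, g ⊗ₜ p ∈ W :=
  Submodule.map₂_le

theorem map_mem_of_tensorSub {U : Submodule ℂ (GroupAlg ν)} {P : Submodule ℂ (SymAlg ν)}
    {W : Type*} [AddCommGroup W] [Module ℂ W] {Q : Submodule ℂ W} (T : Fock ν →ₗ[ℂ] W)
    (hT : ∀ g ∈ U, ∀ p ∈ P, T (g ⊗ₜ p) ∈ Q) {v : Fock ν} (hv : v ∈ tensorSub ν U P) : T v ∈ Q :=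
  (tensorSub_le (W := Q.comap T)).2 hT hv

theorem leftOp_mem_tensorSub {U : Submodule ℂ (GroupAlg ν)} {P : Submodule ℂ (SymAlg ν)}
    {x : GroupAlg ν} (hx : ∀ g ∈ U, x * g ∈ U) {v : Fock ν} (hv : v ∈ tensorSub ν U P) :
    leftOp x v ∈ tensorSub ν U P :=
  map_mem_of_tensorSub (leftOp x) (fun g hg p hp => by
    rw [leftOp_tmul]; exact tmul_mem_tensorSub (hx g hg) hp) hv

theorem mulOp_mem_tensorSub {U : Submodule ℂ (GroupAlg ν)} {P : Subalgebra ℂ (SymAlg ν)}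
    {q : SymAlg ν} (hq : q ∈ P) {v : Fock ν} (hv : v ∈ tensorSub ν U P.toSubmodule) :
    mulOp q v ∈ tensorSub ν U P.toSubmodule :=
  map_mem_of_tensorSub (mulOp q) (fun g hg p hp => by
    rw [mulOp_tmul]; exact tmul_mem_tensorSub hg (P.mul_mem hq hp)) hv

theorem diffOp_mem_tensorSub {U : Submodule ℂ (GroupAlg ν)} {P : Submodule ℂ (SymAlg ν)}
    (hP : ∀ (i : Fin ν) (r : ℕ), ∀ p ∈ P, oddDer i r p ∈ P) (q : SymAlg ν) {v : Fock ν}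
    (hv : v ∈ tensorSub ν U P) : diffOp q v ∈ tensorSub ν U P := by
  induction q using MvPolynomial.induction_on generalizing v with
  | C c =>
    rw [← MvPolynomial.algebraMap_eq, AlgHom.commutes, Module.algebraMap_end_apply]
    exact Submodule.smul_mem _ _ hv
  | add p q hp hq =>
    rw [map_add, LinearMap.add_apply]
    exact Submodule.add_mem _ (hp hv) (hq hv)
  | mul_X p x hp =>
    rw [map_mul, Module.End.mul_apply]
    refine hp ?_
    obtain ⟨i, k⟩ := x
    rw [← oddVar_two_mul_add_one]
    refine map_mem_of_tensorSub _ (fun g hg p hp => ?_) hv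
    rw [diffOp_oddVar_tmul]
    exact tmul_mem_tensorSub hg (hP _ _ _ hp)

theorem oddVar_mem_symZero {N : ℕ} (i : Fin ν) {n : ℕ} (hn : ¬ N ∣ n) :
    oddVar i n ∈ symZero ν N := by
  unfold oddVar
  split_ifs with h
  · refine Algebra.subset_adjoin (Submodule.subset_span (Or.inr ⟨i, n / 2, ?_, rfl⟩))
    obtain ⟨k, rfl⟩ := h
    rwa [show 2 * ((2 * k + 1) / 2) + 1 = 2 * k + 1 by omega]
  · exact Subalgebra.zero_mem _

theorem oddVar_sub_mem_symZero (N : ℕ) (i j : Fin ν) (n : ℕ) :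
    oddVar i n - oddVar j n ∈ symZero ν N := by
  unfold oddVar
  split_ifs with h
  · rcases eq_or_ne i j with rfl | hij
    · rw [sub_self]
      exact Subalgebra.zero_mem _
    · exact Algebra.subset_adjoin (Submodule.subset_span (Or.inl ⟨i, j, n / 2, hij, rfl⟩))
  · rw [sub_self]
    exact Subalgebra.zero_mem _

/-- An even number, in particular 0, divides no odd number, so every variable is admitted. -/
theorem symZero_eq_top {N : ℕ} (hN : Even N) : symZero ν N = ⊤ := by
  refine top_le_iff.1 (MvPolynomial.adjoin_range_X.symm.le.trans (Algebra.adjoin_le ?_))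
  rintro _ ⟨⟨i, k⟩, rfl⟩
  rw [SetLike.mem_coe, ← oddVar_two_mul_add_one]
  refine oddVar_mem_symZero i fun h => ?_
  have := (hN.two_dvd).trans h
  omega

/-- An induction principle for the subalgebra `S(H₀⁻)`. -/
theorem symZero_induction {N : ℕ} {p : SymAlg ν → Prop} (hsub : ∀ (i j : Fin ν) (n : ℕ), i ≠ j →
    Odd n → p (oddVar i n - oddVar j n)) (hvar : ∀ (i : Fin ν) (n : ℕ), Odd n → ¬ N ∣ n →
      p (oddVar i n)) (hC : ∀ c : ℂ, p (MvPolynomial.C c)) (hadd : ∀ x y, p x → p y → p (x + y))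
    (hmul : ∀ x y, x ∈ symZero ν N → y ∈ symZero ν N → p x → p y → p (x * y)) {x : SymAlg ν}
    (hx : x ∈ symZero ν N) : p x := by
  unfold symZero at hx hmul
  rw [Algebra.adjoin_span] at hx hmul
  induction hx using Algebra.adjoin_induction with
  | mem x hx =>
    rcases hx with ⟨i, j, k, hij, rfl⟩ | ⟨i, k, hk, rfl⟩
    · rw [← oddVar_two_mul_add_one, ← oddVar_two_mul_add_one]
      exact hsub i j _ hij (odd_two_mul_add_one k)
    · rw [← oddVar_two_mul_add_one]
      exact hvar i _ (odd_two_mul_add_one k) hk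
  | algebraMap c => exact hC c
  | add x y _ _ h1 h2 => exact hadd x y h1 h2
  | mul x y hx hy h1 h2 => exact hmul x y hx hy h1 h2

theorem oddDer_mem_symZero (N : ℕ) (i : Fin ν) (r : ℕ) {p : SymAlg ν} (hp : p ∈ symZero ν N) :
    oddDer i r p ∈ symZero ν N := by
  have hc : ∀ j n, oddDer i r (oddVar j n) ∈ symZero ν N := by
    intro j n
    rw [oddDer_oddVar]
    split_ifs
    · exact Subalgebra.algebraMap_mem _ _
    · exact Subalgebra.zero_mem _
  refine symZero_induction (p := fun p => oddDer i r p ∈ symZero ν N) ?_ ?_ ?_ ?_ ?_ hp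
  · intro k l n _ _
    rw [map_sub]
    exact Subalgebra.sub_mem _ (hc k n) (hc l n)
  · intro k n _ _
    exact hc k n
  · intro c
    rw [← MvPolynomial.algebraMap_eq, Derivation.map_algebraMap]
    exact Subalgebra.zero_mem _
  · intro x y hx hy
    rw [map_add]
    exact Subalgebra.add_mem _ hx hy
  · intro x y hx hy h1 h2
    rw [Derivation.leibniz, smul_eq_mul, smul_eq_mul]
    exact Subalgebra.add_mem _ (Subalgebra.mul_mem _ hx h2) (Subalgebra.mul_mem _ hy h1)

-- The convolution is a coefficient of exp Σ (2/n)(ε_i(-n) - a^n ε_j(-n))z^n over odd n. If N ∣ n,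
-- then a^n = 1 and the bracket lies in H_0^-; otherwise both variables do.
open PowerSeries in
theorem convMul_mem_symZero {N : ℕ} (i j : Fin ν) {a : ℂ}
    (ha : ∀ n : ℕ, Odd n → N ∣ n → a ^ n = 1) (r : ℕ) :
    convMul i j (fun x => (-a) ^ x) r ∈ symZero ν N := by
  have h1 : convMul i j (fun x => (-a) ^ x) r =
      coeff r (formalExp (oddExponent i + rescale (algebraMap ℂ (SymAlg ν) (-a)) (oddExponent j))) := by
    rw [formalExp_add (constantCoeff_oddExponent i) (by
      rw [← coeff_zero_eq_constantCoeff_apply, coeff_rescale, coeff_zero_eq_constantCoeff_apply,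
        constantCoeff_oddExponent, mul_zero]), coeff_mul, convMul]
    refine Finset.sum_congr rfl fun p _ => ?_
    have h2 := rescale_formalExp (-a) (oddExponent j)
    rw [← h2, coeff_rescale, schur_natCast, schur_natCast, zpow_natCast, ← map_pow,
      ← Algebra.smul_def, mul_smul_comm]
    rfl
  rw [h1]
  refine coeff_formalExp_mem _ (fun n => ?_) r
  rw [map_add, coeff_rescale, oddExponent, oddExponent, coeff_mk, coeff_mk, ← map_pow,
    ← Algebra.smul_def, smul_comm, ← smul_add]
  refine Subalgebra.smul_mem _ ?_ _
  by_cases hn : Odd n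
  · by_cases hd : N ∣ n
    · rw [hn.neg_pow, ha n hn hd, neg_smul, one_smul, ← sub_eq_add_neg]
      exact oddVar_sub_mem_symZero N i j n
    · exact Subalgebra.add_mem _ (oddVar_mem_symZero i hd)
        (Subalgebra.smul_mem _ (oddVar_mem_symZero j hd) _)
  · rw [oddVar, oddVar, if_neg hn, if_neg hn, smul_zero, add_zero]
    exact Subalgebra.zero_mem _

theorem convTau_eq_diffOp (i j : Fin ν) (a : ℂ) (s : ℕ) :
    convTau i j (fun x => (-a) ^ (-x)) s =
      diffOp ((-1 : ℂ) ^ s • convMul i j (fun x => (-a⁻¹) ^ x) s) := by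
  rw [convTau, convMul, Finset.smul_sum, map_sum]
  refine Finset.sum_congr rfl fun p hp => ?_
  rw [tau, tau, smul_mul_smul_comm, ← map_mul, smul_smul, map_smul, map_smul, smul_smul,
    ← Finset.HasAntidiagonal.mem_antidiagonal.1 hp, zpow_natCast, zpow_natCast, zpow_natCast,
    pow_add, zpow_neg, zpow_natCast, neg_inv, inv_pow]
  congr 1
  ring

theorem bosonMode_eq_finsum (i j : Fin ν) (a : ℂ) (m : ℤ) (v : Fock ν) :
    bosonMode ν i j a m v = ∑ᶠ r : {r : ℕ × ℕ // (r.2 : ℤ) - r.1 = m},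
      mulOp (convMul i j (fun x => (-a) ^ x) r.1.1)
        (diffOp ((-1 : ℂ) ^ r.1.2 • convMul i j (fun x => (-a⁻¹) ^ x) r.1.2) v) := by
  rw [bosonMode]
  exact finsum_congr fun r => by rw [coeff_expMinus_mul, coeff_expPlus_mul, convTau_eq_diffOp]

theorem bosonMode_mem {N : ℕ} (U : Submodule ℂ (GroupAlg ν)) (i j : Fin ν) {a : ℂ}
    (ha : ∀ n : ℕ, Odd n → N ∣ n → a ^ n = 1) (m : ℤ) {v : Fock ν}
    (hv : v ∈ tensorSub ν U (symZero ν N).toSubmodule) :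
    bosonMode ν i j a m v ∈ tensorSub ν U (symZero ν N).toSubmodule := by
  rw [bosonMode_eq_finsum]
  refine finsum_induction (· ∈ tensorSub ν U (symZero ν N).toSubmodule) (Submodule.zero_mem _)
    (fun _ _ => Submodule.add_mem _) fun r => ?_
  exact mulOp_mem_tensorSub (convMul_mem_symZero i j ha _)
    (diffOp_mem_tensorSub (fun i r p hp => oddDer_mem_symZero N i r hp) _ hv)

theorem quadMode_eq_bosonMode {i j : Fin ν} (h : i ≠ j) {a : ℂ} (ha : a ≠ 0) (m : ℤ)
    (v : Fock ν) : quadMode fermion i j a m v = leftOp (eps i * eps j) (bosonMode ν i j a m v) := by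
  rw [quadMode_of_ne h, bosonMode_eq i j ha]

theorem quadMode_mem {N : ℕ} {U : Submodule ℂ (GroupAlg ν)} {i j : Fin ν} (h : i ≠ j) {a : ℂ}
    (ha0 : a ≠ 0) (ha : ∀ n : ℕ, Odd n → N ∣ n → a ^ n = 1) (hU : ∀ g ∈ U, eps i * eps j * g ∈ U)
    (m : ℤ) {v : Fock ν} (hv : v ∈ tensorSub ν U (symZero ν N).toSubmodule) :
    quadMode fermion i j a m v ∈ tensorSub ν U (symZero ν N).toSubmodule := by
  rw [quadMode_eq_bosonMode h ha0]
  exact leftOp_mem_tensorSub hU (bosonMode_mem U i j ha m hv)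

theorem quadMode_self_mem {U : Submodule ℂ (GroupAlg ν)} (i : Fin ν) {a : ℂ}
    (ha0 : a ≠ 0) (m : ℤ) {v : Fock ν} (hv : v ∈ tensorSub ν U ⊤) :
    quadMode fermion i i a m v ∈ tensorSub ν U ⊤ := by
  by_cases h1 : a = 1
  · subst h1
    rw [quadMode_self_one, heis_single]
    refine Submodule.smul_mem _ _ (map_mem_of_tensorSub _ (fun g hg p _ => ?_) hv)
    exact tmul_mem_tensorSub hg Submodule.mem_top
  · rw [← vertexMode_add_eq_quadMode i i ha0, vertexMode, if_neg (not_not.2 rfl), if_neg h1]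
    have hb : bosonMode ν i i a m v ∈ tensorSub ν U ⊤ := by
      -- For N = 0 the condition on `a` holds trivially, so the lemma for S(H_0^-) also covers all
      -- of S(H^-).
      have h2 : (⊤ : Submodule ℂ (SymAlg ν)) = (symZero ν 0).toSubmodule := by
        rw [symZero_eq_top Even.zero, Algebra.top_toSubmodule]
      rw [h2] at hv ⊢
      refine bosonMode_mem U i i (fun n hn h0 => ?_) m hv
      rw [zero_dvd_iff.1 h0, pow_zero]
    refine Submodule.add_mem _ (Submodule.smul_mem _ _ (Submodule.sub_mem _ hb ?_)) ?_
    · split_ifs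
      exacts [hv, Submodule.zero_mem _]
    · split_ifs
      exacts [Submodule.smul_mem _ _ hv, Submodule.zero_mem _]

end Tensor


/-! ## The spaces `V_ν(γ)` -/

section Spin

variable {ν : ℕ}

/-- The scalar of the generator `e^{ε_j}` in the factor `w_j`. -/
def spinCoeff (j : Fin ν) : ℂ := if Even (j : ℕ) then Complex.I else 1

theorem spinCoeff_ne_zero (j : Fin ν) : spinCoeff j ≠ 0 := by
  unfold spinCoeff
  split_ifs <;> simp

theorem intUnit_cast_ne_zero (u : ℤˣ) : ((u : ℤ) : ℂ) ≠ 0 :=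
  Int.cast_ne_zero.2 u.ne_zero

theorem intUnit_cast_mul_self (u : ℤˣ) : ((u : ℤ) : ℂ) * ((u : ℤ) : ℂ) = 1 := by
  rcases Int.units_eq_one_or u with rfl | rfl <;> simp

/-- The factor `w_j(ρ_j)`. -/
def spinFactor (ρ : Fin ν → ℤˣ) (j : Fin ν) : GroupAlg ν :=
  1 + (spinCoeff j * ((ρ j : ℤ) : ℂ)) • eps j

theorem spinVector_eq (ρ : Fin ν → ℤˣ) :
    spinVector ν ρ = ((List.finRange ν).map (spinFactor ρ)).prod := by
  rw [spinVector, List.ofFn_eq_map]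
  rfl

theorem eps_mul_spinFactor_of_ne {k j : Fin ν} (h : k ≠ j) (ρ : Fin ν → ℤˣ) :
    eps k * spinFactor ρ j = spinFactor (-ρ) j * eps k := by
  have h1 : eps k * eps j = -(eps j * eps k) := eq_neg_of_add_eq_zero_left (eps_anticomm h)
  simp only [spinFactor, mul_add, add_mul, mul_one, one_mul, mul_smul_comm, smul_mul_assoc, h1,
    Pi.neg_apply, Units.val_neg, Int.cast_neg, mul_neg, neg_smul, smul_neg, neg_mul]

theorem eps_mul_prod_spinFactor (k : Fin ν) (ρ : Fin ν → ℤˣ) (l : List (Fin ν)) (hl : k ∉ l) :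
    eps k * (l.map (spinFactor ρ)).prod = (l.map (spinFactor (-ρ))).prod * eps k := by
  induction l with
  | nil => simp
  | cons j l ih =>
    rw [List.mem_cons, not_or] at hl
    rw [List.map_cons, List.prod_cons, ← mul_assoc, eps_mul_spinFactor_of_ne hl.1, mul_assoc,
      ih hl.2, List.map_cons, List.prod_cons, mul_assoc]

/-- The signs obtained by changing the first `2 ⌊k / 2⌋ + 1` entries. -/
def flipSigns (k : Fin ν) (ρ : Fin ν → ℤˣ) (j : Fin ν) : ℤˣ :=
  if (j : ℕ) < 2 * (k / 2) + 1 then -ρ j else ρ j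

/-- As e² = 1, e(1 + λe) = λ(1 + λ⁻¹e). Inverting λ changes its sign if λ = ±√-1 and fixes it if λ =
±1, so the entry at `k` is flipped only for `k` even. -/
theorem eps_mul_spinFactor_self (k : Fin ν) (ρ : Fin ν → ℤˣ) :
    eps k * spinFactor ρ k = (spinCoeff k * ((ρ k : ℤ) : ℂ)) • spinFactor (flipSigns k ρ) k := by
  have h := intUnit_cast_mul_self (ρ k)
  have h1 : spinCoeff k * ((ρ k : ℤ) : ℂ) *
      (spinCoeff k * (((flipSigns k ρ k : ℤˣ) : ℤ) : ℂ)) = 1 := by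
    unfold spinCoeff flipSigns
    by_cases hk : Even (k : ℕ)
    · have : (k : ℕ) < 2 * (k / 2) + 1 := by obtain ⟨a, ha⟩ := hk; omega
      rw [if_pos hk, if_pos this, Units.val_neg, Int.cast_neg]
      linear_combination (-Complex.I * Complex.I) * h - Complex.I_mul_I
    · have : ¬ (k : ℕ) < 2 * (k / 2) + 1 := by
        obtain ⟨a, ha⟩ := Nat.not_even_iff_odd.1 hk; omega
      rw [if_neg hk, if_neg this]
      linear_combination h
  rw [spinFactor, spinFactor, mul_add, mul_one, mul_smul_comm, eps_mul_self, smul_add, smul_smul,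
    h1, one_smul, add_comm]

/-- The generator anticommutes through the factors before the `k`-th, flipping their signs, and is
absorbed by the `k`-th. By the parity rule there, the number of flipped entries is odd in both
cases. -/
theorem eps_mul_spinVector (k : Fin ν) (ρ : Fin ν → ℤˣ) :
    eps k * spinVector ν ρ = (spinCoeff k * ((ρ k : ℤ) : ℂ)) • spinVector ν (flipSigns k ρ) := by
  rw [spinVector_eq, spinVector_eq]
  obtain ⟨l, l', hl⟩ := List.append_of_mem (List.mem_finRange k)
  have hp := List.pairwise_lt_finRange ν
  rw [hl, List.pairwise_append, List.pairwise_cons] at hp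
  obtain ⟨-, ⟨h1, -⟩, h2⟩ := hp
  have h3 : ∀ j ∈ l, j < k := fun j hj => h2 j hj k List.mem_cons_self
  have h4 : l.map (spinFactor (-ρ)) = l.map (spinFactor (flipSigns k ρ)) := by
    refine List.map_congr_left fun j hj => ?_
    have := Fin.lt_def.1 (h3 j hj)
    simp only [spinFactor, flipSigns]
    rw [if_pos (by omega)]
    rfl
  have h5 : l'.map (spinFactor ρ) = l'.map (spinFactor (flipSigns k ρ)) := by
    refine List.map_congr_left fun j hj => ?_
    have := Fin.lt_def.1 (h1 j hj)
    simp only [spinFactor, flipSigns]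
    rw [if_neg (by omega)]
  rw [hl, List.map_append, List.map_append, List.prod_append, List.prod_append, List.map_cons,
    List.map_cons, List.prod_cons, List.prod_cons, ← mul_assoc,
    eps_mul_prod_spinFactor k ρ l fun h => (h3 k h).ne rfl, mul_assoc, ← mul_assoc (eps k),
    eps_mul_spinFactor_self, smul_mul_assoc, mul_smul_comm, h4, h5]

theorem eps_mul_eps_mul_spinVector (i j : Fin ν) (ρ : Fin ν → ℤˣ) :
    ∃ c : ℂ, c ≠ 0 ∧ eps i * eps j * spinVector ν ρ =
      c • spinVector ν (flipSigns i (flipSigns j ρ)) := by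
  refine ⟨_, ?_, by rw [mul_assoc, eps_mul_spinVector, mul_smul_comm, eps_mul_spinVector, smul_smul]⟩
  exact mul_ne_zero (mul_ne_zero (spinCoeff_ne_zero j) (intUnit_cast_ne_zero _))
    (mul_ne_zero (spinCoeff_ne_zero i) (intUnit_cast_ne_zero _))

/-- Both indices flip the same initial segment, so their product is diagonal on the w(ρ). These
eigenvalues separate the admissible sign vectors. -/
theorem eps_mul_eps_mul_spinVector_self {i j : Fin ν} (hi : Even (i : ℕ)) (hij : (j : ℕ) = i + 1)
    (ρ : Fin ν → ℤˣ) : eps i * eps j * spinVector ν ρ =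
      (-Complex.I * (((ρ i * ρ j : ℤˣ) : ℤ) : ℂ)) • spinVector ν ρ := by
  have h1 : (i : ℕ) / 2 = j / 2 := by obtain ⟨a, ha⟩ := hi; omega
  have h2 : flipSigns i (flipSigns j ρ) = ρ := by
    funext k
    simp only [flipSigns, h1]
    split_ifs <;> simp
  have h3 : flipSigns j ρ i = -ρ i := by
    rw [flipSigns, if_pos (by rw [← h1]; obtain ⟨a, ha⟩ := hi; omega)]
  have h4 : ¬ Even (j : ℕ) := by rw [hij, Nat.even_add_one]; exact not_not.2 hi
  rw [mul_assoc, eps_mul_spinVector, mul_smul_comm, eps_mul_spinVector, smul_smul, h2, h3]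
  congr 1
  rw [spinCoeff, spinCoeff, if_pos hi, if_neg h4]
  push_cast
  ring

/-! ### Admissible signs -/

/-- The conditions on the signs `ρ` defining `V_ν(γ)`. -/
def IsAdmissible (γ : Fin (ν / 2 + 1) → ℤˣ) (ρ : Fin ν → ℤˣ) : Prop :=
  (∀ i : Fin ν, (i : ℕ) = 0 → ρ i = γ 0) ∧
    (∀ (j : Fin (ν / 2 + 1)) (i i' : Fin ν), 1 ≤ (j : ℕ) → (i : ℕ) + 1 = 2 * (j : ℕ) →
      (i' : ℕ) = 2 * (j : ℕ) → ρ i * ρ i' = γ j) ∧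
    (Even ν → ∀ i : Fin ν, (i : ℕ) + 1 = ν → ρ i = γ (Fin.last (ν / 2)))

variable {γ : Fin (ν / 2 + 1) → ℤˣ}

theorem spinModule_eq_span_range : spinModule ν γ =
    Submodule.span ℂ (Set.range fun ρ : {ρ // IsAdmissible γ ρ} => spinVector ν ρ.1) := by
  unfold spinModule
  congr 1
  ext w
  constructor
  · rintro ⟨ρ, rfl, hρ⟩
    exact ⟨⟨ρ, hρ⟩, rfl⟩
  · rintro ⟨⟨ρ, hρ⟩, rfl⟩
    exact ⟨ρ, rfl, hρ⟩

theorem spinVector_mem {ρ : Fin ν → ℤˣ} (hρ : IsAdmissible γ ρ) : spinVector ν ρ ∈ spinModule ν γ := by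
  rw [spinModule_eq_span_range]
  exact Submodule.subset_span ⟨⟨ρ, hρ⟩, rfl⟩

/-- A flipped initial segment has odd length. It contains the first entry, which two flips restore,
never separates the positions 2j-1 and 2j (counted from 0), and for even ν stops before the last
position. -/
theorem IsAdmissible.flipSigns {ρ : Fin ν → ℤˣ} (hρ : IsAdmissible γ ρ) (i j : Fin ν) :
    IsAdmissible γ (flipSigns i (flipSigns j ρ)) := by
  obtain ⟨h0, h1, h2⟩ := hρ
  refine ⟨fun k hk => ?_, fun a k k' ha hk hk' => ?_, fun hν k hk => ?_⟩
  · rw [← h0 k hk]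
    simp only [VertexUnitary.flipSigns]
    rw [if_pos (by omega), if_pos (by omega), neg_neg]
  · rw [← h1 a k k' ha hk hk']
    have : ∀ b : ℕ, (k : ℕ) < 2 * (b / 2) + 1 ↔ (k' : ℕ) < 2 * (b / 2) + 1 := fun b => by omega
    simp only [VertexUnitary.flipSigns, this]
    split_ifs <;> simp
  · rw [← h2 hν k hk]
    have := i.2
    have := j.2
    obtain ⟨b, hb⟩ := hν
    simp only [VertexUnitary.flipSigns]
    rw [if_neg (by omega), if_neg (by omega)]

theorem eps_mul_eps_mul_mem (i j : Fin ν) {g : GroupAlg ν} (hg : g ∈ spinModule ν γ) :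
    eps i * eps j * g ∈ spinModule ν γ := by
  have h : spinModule ν γ ≤ (spinModule ν γ).comap (LinearMap.mulLeft ℂ (eps i * eps j)) := by
    conv_lhs => rw [spinModule_eq_span_range]
    rw [Submodule.span_le]
    rintro _ ⟨⟨ρ, hρ⟩, rfl⟩
    obtain ⟨c, -, hc⟩ := eps_mul_eps_mul_spinVector i j ρ
    change eps i * eps j * spinVector ν ρ ∈ spinModule ν γ
    rw [hc]
    exact Submodule.smul_mem _ _ (spinVector_mem (hρ.flipSigns i j))
  exact h hg

/-- The first sign is prescribed and so is every product of neighbours: by γ if the left index is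
odd, by the hypothesis if it is even. -/
theorem IsAdmissible.ext {ρ ρ' : Fin ν → ℤˣ} (hρ : IsAdmissible γ ρ) (hρ' : IsAdmissible γ ρ')
    (h : ∀ i j : Fin ν, Even (i : ℕ) → (j : ℕ) = i + 1 → ρ i * ρ j = ρ' i * ρ' j) : ρ = ρ' := by
  have key : ∀ (n : ℕ) (hn : n < ν), ρ ⟨n, hn⟩ = ρ' ⟨n, hn⟩ := by
    intro n
    induction n with
    | zero => intro hn; rw [hρ.1 _ rfl, hρ'.1 _ rfl]
    | succ n ih =>
      intro hn
      have h1 := ih (by omega)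
      have h2 : ρ ⟨n, by omega⟩ * ρ ⟨n + 1, hn⟩ = ρ' ⟨n, by omega⟩ * ρ' ⟨n + 1, hn⟩ := by
        rcases Nat.even_or_odd n with he | ho
        · exact h _ _ he rfl
        · obtain ⟨b, hb⟩ := ho
          rw [hρ.2.1 ⟨b + 1, by omega⟩ ⟨n, by omega⟩ ⟨n + 1, hn⟩ (by simp) (by simp; omega)
            (by simp; omega), hρ'.2.1 ⟨b + 1, by omega⟩ ⟨n, by omega⟩ ⟨n + 1, hn⟩ (by simp)
            (by simp; omega) (by simp; omega)]
      rw [h1] at h2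
      exact mul_left_cancel h2
  funext k
  exact key k k.2

/-- Every nonzero stable subspace contains some `w(ρ)`. -/
theorem exists_spinVector_mem {U : Submodule ℂ (GroupAlg ν)}
    (hU : ∀ i j : Fin ν, i ≠ j → ∀ g ∈ U, eps i * eps j * g ∈ U)
    (n : ℕ) (T : Finset (Fin ν → ℤˣ)) (hn : T.card ≤ n) (hT : ∀ ρ ∈ T, IsAdmissible γ ρ)
    (hne : T.Nonempty) (c : (Fin ν → ℤˣ) → ℂ) (hc : ∀ ρ ∈ T, c ρ ≠ 0)
    (hs : ∑ ρ ∈ T, c ρ • spinVector ν ρ ∈ U) : ∃ ρ, IsAdmissible γ ρ ∧ spinVector ν ρ ∈ U := by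
  induction n generalizing T c with
  | zero => exact absurd (Finset.card_eq_zero.1 (Nat.le_zero.1 hn)) hne.ne_empty
  | succ n ih =>
    obtain ⟨ρ, hρ⟩ := hne
    by_cases h1 : ∀ ρ' ∈ T, ρ' = ρ
    · have h2 : T = {ρ} := Finset.eq_singleton_iff_unique_mem.2 ⟨hρ, h1⟩
      rw [h2, Finset.sum_singleton] at hs
      refine ⟨ρ, hT ρ hρ, ?_⟩
      have := U.smul_mem (c ρ)⁻¹ hs
      rwa [smul_smul, inv_mul_cancel₀ (hc ρ hρ), one_smul] at this
    · push Not at h1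
      obtain ⟨ρ', hρ', hne⟩ := h1
      have h2 : ∃ i j : Fin ν, Even (i : ℕ) ∧ (j : ℕ) = i + 1 ∧ ρ' i * ρ' j ≠ ρ i * ρ j := by
        by_contra h
        push Not at h
        exact hne ((hT ρ' hρ').ext (hT ρ hρ) h)
      obtain ⟨i, j, hi, hij, hd⟩ := h2
      set lam : (Fin ν → ℤˣ) → ℂ := fun τ => -Complex.I * (((τ i * τ j : ℤˣ) : ℤ) : ℂ) with hlam
      have hlam' : ∀ τ : Fin ν → ℤˣ, lam τ - lam ρ = 0 ↔ τ i * τ j = ρ i * ρ j := by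
        intro τ
        rw [hlam, sub_eq_zero, mul_right_inj' (neg_ne_zero.2 Complex.I_ne_zero), Int.cast_inj,
          Units.val_inj]
      -- Subtracting the eigenvalue of ρ from e_ie_j kills ρ and rescales the terms with the other
      -- eigenvalue, ρ' among them, by nonzero numbers: a strictly shorter nonempty combination.
      have hsum : ∑ τ ∈ T.filter (fun τ => τ i * τ j ≠ ρ i * ρ j),
          ((lam τ - lam ρ) * c τ) • spinVector ν τ =
          eps i * eps j * (∑ τ ∈ T, c τ • spinVector ν τ) - lam ρ • ∑ τ ∈ T, c τ • spinVector ν τ := by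
        rw [Finset.sum_filter_of_ne, Finset.mul_sum, Finset.smul_sum, ← Finset.sum_sub_distrib]
        · refine Finset.sum_congr rfl fun τ _ => ?_
          rw [mul_smul_comm, eps_mul_eps_mul_spinVector_self hi hij, smul_smul, smul_smul,
            ← sub_smul]
          congr 1
          ring
        · intro τ _ hτ h
          rw [(hlam' τ).2 h, zero_mul, zero_smul] at hτ
          exact hτ rfl
      refine ih (T.filter fun τ => τ i * τ j ≠ ρ i * ρ j) ?_
        (fun τ hτ => hT τ (Finset.mem_filter.1 hτ).1) ⟨ρ', Finset.mem_filter.2 ⟨hρ', hd⟩⟩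
        (fun τ => (lam τ - lam ρ) * c τ) (fun τ hτ => ?_) ?_
      · have : T.filter (fun τ => τ i * τ j ≠ ρ i * ρ j) ⊂ T :=
          Finset.filter_ssubset.2 ⟨ρ, hρ, by simp⟩
        have := Finset.card_lt_card this
        omega
      · obtain ⟨h3, h4⟩ := Finset.mem_filter.1 hτ
        exact mul_ne_zero (fun h => h4 ((hlam' τ).1 h)) (hc τ h3)
      · rw [hsum]
        refine U.sub_mem (hU i j (fun h => ?_) _ hs) (U.smul_mem _ hs)
        rw [h] at hij
        omega

/-- The product of the generators at 2b+1 and 2b+2 flips exactly these two entries. On such a pair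
two admissible vectors agree in both entries or differ in both, so one is turned into the other pair
by pair. -/
theorem spinVector_mem_of_mem {U : Submodule ℂ (GroupAlg ν)}
    (hU : ∀ i j : Fin ν, i ≠ j → ∀ g ∈ U, eps i * eps j * g ∈ U) {ρ ρ' : Fin ν → ℤˣ}
    (hρ : IsAdmissible γ ρ) (hρ' : IsAdmissible γ ρ') (h : spinVector ν ρ ∈ U) :
    spinVector ν ρ' ∈ U := by
  have key : ∀ b : ℕ, spinVector ν (fun k => if (k : ℕ) < 2 * b + 1 then ρ' k else ρ k) ∈ U := by
    intro b
    induction b with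
    | zero =>
      have h1 : (fun k : Fin ν => if (k : ℕ) < 2 * 0 + 1 then ρ' k else ρ k) = ρ := by
        funext k
        split_ifs with hk
        · rw [hρ.1 k (by omega), hρ'.1 k (by omega)]
        · rfl
      rwa [h1]
    | succ b ih =>
      set τ : Fin ν → ℤˣ := fun k => if (k : ℕ) < 2 * b + 1 then ρ' k else ρ k with hτ
      by_cases hb : 2 * b + 2 < ν
      · have e1 := hρ.2.1 ⟨b + 1, by omega⟩ ⟨2 * b + 1, by omega⟩ ⟨2 * b + 2, hb⟩ (by simp)
          (by simp; omega) (by simp; omega)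
        have e2 := hρ'.2.1 ⟨b + 1, by omega⟩ ⟨2 * b + 1, by omega⟩ ⟨2 * b + 2, hb⟩ (by simp)
          (by simp; omega) (by simp; omega)
        rw [← e1] at e2
        have hcase : ∀ k : Fin ν, (k : ℕ) = 2 * b + 1 ∨ (k : ℕ) = 2 * b + 2 →
            k = ⟨2 * b + 1, by omega⟩ ∨ k = ⟨2 * b + 2, hb⟩ := fun k hk =>
          hk.imp (fun h => Fin.ext h) fun h => Fin.ext h
        by_cases h1 : ρ' ⟨2 * b + 1, by omega⟩ = ρ ⟨2 * b + 1, by omega⟩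
        · rw [h1] at e2
          have h2 := mul_left_cancel e2
          have h3 : (fun k : Fin ν => if (k : ℕ) < 2 * (b + 1) + 1 then ρ' k else ρ k) = τ := by
            funext k
            rw [hτ]
            by_cases hk : (k : ℕ) < 2 * b + 1
            · simp only [hk, if_true]
              rw [if_pos (by omega)]
            · simp only [hk, if_false]
              split_ifs with hk'
              · rcases hcase k (by omega) with rfl | rfl
                exacts [h1, h2]
              · rfl
          rwa [h3]
        · have h1' : ρ' ⟨2 * b + 1, by omega⟩ = -ρ ⟨2 * b + 1, by omega⟩ :=
            (Int.units_ne_iff_eq_neg).1 h1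
          rw [h1', neg_mul, ← mul_neg] at e2
          have h2 : ρ' ⟨2 * b + 2, hb⟩ = -ρ ⟨2 * b + 2, hb⟩ := by
            rw [← mul_left_cancel e2, neg_neg]
          have h3 : (fun k : Fin ν => if (k : ℕ) < 2 * (b + 1) + 1 then ρ' k else ρ k) =
              flipSigns ⟨2 * b + 1, by omega⟩ (flipSigns ⟨2 * b + 2, hb⟩ τ) := by
            funext k
            simp only [flipSigns, hτ]
            by_cases hk : (k : ℕ) < 2 * b + 1
            · rw [if_pos (by omega), if_pos (by omega), if_pos (by omega), if_pos (by omega),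
                neg_neg]
            · by_cases hk' : (k : ℕ) < 2 * (b + 1) + 1
              · rw [if_pos hk', if_neg (by omega), if_pos (by omega), if_neg hk]
                rcases hcase k (by omega) with rfl | rfl
                exacts [h1', h2]
              · rw [if_neg hk', if_neg (by omega), if_neg (by omega), if_neg hk]
          obtain ⟨c, hc0, hc⟩ := eps_mul_eps_mul_spinVector (⟨2 * b + 1, by omega⟩ : Fin ν)
            ⟨2 * b + 2, hb⟩ τ
          rw [h3]
          have h4 := U.smul_mem c⁻¹ (hU ⟨2 * b + 1, by omega⟩ ⟨2 * b + 2, hb⟩ (by simp) _ ih)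
          rwa [hc, smul_smul, inv_mul_cancel₀ hc0, one_smul] at h4
      · have h3 : (fun k : Fin ν => if (k : ℕ) < 2 * (b + 1) + 1 then ρ' k else ρ k) = τ := by
          funext k
          have hk0 := k.2
          rw [hτ]
          by_cases hk : (k : ℕ) < 2 * b + 1
          · simp only [hk, if_true]
            rw [if_pos (by omega)]
          · simp only [hk, if_false]
            split_ifs with hk'
            · have he : Even ν := ⟨b + 1, by omega⟩
              rw [hρ.2.2 he k (by omega), hρ'.2.2 he k (by omega)]
            · rfl
        rwa [h3]
  have h1 := key ν
  have h2 : (fun k : Fin ν => if (k : ℕ) < 2 * ν + 1 then ρ' k else ρ k) = ρ' := by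
    funext k
    rw [if_pos (by omega)]
  rwa [h2] at h1

/-- `V_ν(γ)` is irreducible under the even part of the Clifford algebra. -/
theorem spinModule_le {U : Submodule ℂ (GroupAlg ν)}
    (hU : ∀ i j : Fin ν, i ≠ j → ∀ g ∈ U, eps i * eps j * g ∈ U) {v : GroupAlg ν}
    (hv : v ∈ spinModule ν γ) (hv0 : v ≠ 0) (hvU : v ∈ U) : spinModule ν γ ≤ U := by
  have hex : ∃ ρ, IsAdmissible γ ρ ∧ spinVector ν ρ ∈ U := by
    classical
    rw [spinModule_eq_span_range] at hv
    obtain ⟨c, hc⟩ := (Submodule.mem_span_range_iff_exists_fun ℂ).1 hv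
    set c' : (Fin ν → ℤˣ) → ℂ := fun ρ => if h : IsAdmissible γ ρ then c ⟨ρ, h⟩ else 0 with hc'
    have hsum : ∑ ρ ∈ Finset.univ.filter (fun ρ => c' ρ ≠ 0), c' ρ • spinVector ν ρ = v := by
      rw [Finset.sum_filter_of_ne (p := fun ρ => c' ρ ≠ 0)
          (fun ρ _ h h0 => h (by rw [h0, zero_smul])), ← hc,
        ← Finset.sum_filter_of_ne (p := IsAdmissible γ)
          (fun ρ _ h => by by_contra h'; exact h (by simp [hc', h'])),
        ← Finset.sum_subtype_eq_sum_filter, Finset.subtype_univ]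
      refine Finset.sum_congr rfl fun ρ _ => ?_
      rw [hc']
      simp only [ρ.2, dif_pos]
    have hadm : ∀ ρ, c' ρ ≠ 0 → IsAdmissible γ ρ := fun ρ h => by
      by_contra h'
      exact h (by simp [hc', h'])
    refine exists_spinVector_mem hU _ (Finset.univ.filter fun ρ => c' ρ ≠ 0) le_rfl
      (fun ρ hρ => hadm ρ (Finset.mem_filter.1 hρ).2) ?_ c' (fun ρ hρ => (Finset.mem_filter.1 hρ).2)
      (by rwa [hsum])
    by_contra hemp
    rw [Finset.not_nonempty_iff_eq_empty.1 hemp, Finset.sum_empty] at hsum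
    exact hv0 hsum.symm
  obtain ⟨ρ, hρ, h⟩ := hex
  rw [spinModule_eq_span_range, Submodule.span_le]
  rintro _ ⟨⟨ρ', hρ'⟩, rfl⟩
  exact spinVector_mem_of_mem hU hρ hρ' h

/-! ### Nontriviality -/

/-- The coefficient of `e^0`. -/
def coeffZero : GroupAlg ν →ₗ[ℂ] ℂ :=
  lift (latticeCocycle ν) fun a => if a = 0 then 1 else 0

/-- The partial product over `l` involves only basis vectors supported on `l`; multiplication by
e^{ε_j} with j outside `l` cannot produce e^0. Hence w(ρ) has constant coefficient 1 and is nonzero.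
-/
theorem coeffZero_prod (ρ : Fin ν → ℤˣ) (l : List (Fin ν)) (hl : l.Nodup) :
    coeffZero (l.map (spinFactor ρ)).prod = 1 ∧ (l.map (spinFactor ρ)).prod ∈
      Submodule.span ℂ (e (latticeCocycle ν) '' {a | ∀ k, k ∉ l → a k = 0}) := by
  induction l with
  | nil =>
    rw [List.map_nil, List.prod_nil, one_def]
    refine ⟨by simp [coeffZero], Submodule.subset_span ⟨0, fun _ _ => rfl, rfl⟩⟩
  | cons j l ih =>
    obtain ⟨h1, h2⟩ := ih hl.of_cons
    have hj : j ∉ l := (List.nodup_cons.1 hl).1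
    set Q := (l.map (spinFactor ρ)).prod
    have h3 : ∀ Q ∈ Submodule.span ℂ (e (latticeCocycle ν) '' {a | ∀ k, k ∉ l → a k = 0}),
        coeffZero (eps j * Q) = 0 ∧ eps j * Q ∈
          Submodule.span ℂ (e (latticeCocycle ν) '' {a | ∀ k, k ∉ j :: l → a k = 0}) := by
      intro Q hQ
      induction hQ using Submodule.span_induction with
      | mem x hx =>
        obtain ⟨a, ha, rfl⟩ := hx
        rw [eps, e_mul_e, map_smul]
        constructor
        · rw [coeffZero, lift_e, if_neg, smul_zero]
          intro h0
          have := congrFun h0 j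
          rw [Pi.add_apply, ha j hj, epsBar, Pi.single_eq_same] at this
          simp at this
        · refine Submodule.smul_mem _ _ (Submodule.subset_span ⟨_, fun k hk => ?_, rfl⟩)
          rw [List.mem_cons, not_or] at hk
          rw [Pi.add_apply, ha k hk.2, epsBar, Pi.single_eq_of_ne hk.1, add_zero]
      | zero => simp
      | add x y _ _ hx hy =>
        rw [mul_add, map_add, hx.1, hy.1, add_zero]
        exact ⟨rfl, Submodule.add_mem _ hx.2 hy.2⟩
      | smul c x _ hx =>
        rw [mul_smul_comm, map_smul, hx.1, smul_zero]
        exact ⟨rfl, Submodule.smul_mem _ _ hx.2⟩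
    have h4 := h3 Q h2
    rw [List.map_cons, List.prod_cons, spinFactor, add_mul, one_mul, smul_mul_assoc, map_add,
      map_smul, h4.1, h1, smul_zero, add_zero]
    refine ⟨rfl, Submodule.add_mem _ (Submodule.span_mono ?_ h2) (Submodule.smul_mem _ _ h4.2)⟩
    exact Set.image_mono fun a ha k hk => ha k fun h => hk (List.mem_cons_of_mem _ h)

theorem spinVector_ne_zero (ρ : Fin ν → ℤˣ) : spinVector ν ρ ≠ 0 := by
  intro h
  have h1 := (coeffZero_prod ρ _ (List.nodup_finRange ν)).1
  rw [← spinVector_eq, h, map_zero] at h1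
  exact zero_ne_one h1

theorem exists_isAdmissible (γ : Fin (ν / 2 + 1) → ℤˣ) : ∃ ρ : Fin ν → ℤˣ, IsAdmissible γ ρ := by
  -- Odd positions carry 1, so an even position 2j carries the whole prescribed product; for even ν
  -- the last, odd position is overridden by its own condition.
  refine ⟨fun k => if h : Even ν ∧ (k : ℕ) + 1 = ν then γ (Fin.last _) else
    if Odd (k : ℕ) then 1 else γ ⟨k / 2, by omega⟩, fun i hi => ?_, fun j i i' hj hi hi' => ?_,
    fun he i hi => ?_⟩
  · beta_reduce
    rw [dif_neg, if_neg (by rw [hi]; simp)]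
    · congr 1
      ext
      simp [hi]
    · rintro ⟨⟨b, hb⟩, h⟩
      omega
  · have := i'.2
    beta_reduce
    rw [dif_neg (fun h => by omega), if_pos ⟨j - 1, by omega⟩, dif_neg, if_neg, one_mul]
    · congr 1
      ext
      simp [hi']
    · rw [Nat.not_odd_iff_even]
      exact ⟨j, by omega⟩
    · rintro ⟨⟨b, hb⟩, h⟩
      omega
  · beta_reduce
    rw [dif_pos ⟨he, hi⟩]

theorem exists_ne_zero_mem_spinModule (γ : Fin (ν / 2 + 1) → ℤˣ) :
    ∃ v ∈ spinModule ν γ, v ≠ 0 := by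
  obtain ⟨ρ, hρ⟩ := exists_isAdmissible γ
  exact ⟨_, spinVector_mem hρ, spinVector_ne_zero ρ⟩

end Spin


/-! ## The order of a character -/

section Character

variable {G : Type*} [AddCommGroup G] (σ : AddChar G ℂ)

/-- The image of a character, as a group of units. -/
def charRange : Subgroup ℂˣ := (AddChar.toMonoidHom σ).toHomUnits.range

theorem mem_charRange (α : G) : ∃ u ∈ charRange σ, (u : ℂ) = σ α :=
  ⟨_, ⟨Multiplicative.ofAdd α, rfl⟩, rfl⟩

theorem exists_of_mem_charRange {u : ℂˣ} (hu : u ∈ charRange σ) : ∃ α, (u : ℂ) = σ α := by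
  obtain ⟨α, rfl⟩ := hu
  exact ⟨α.toAdd, rfl⟩

theorem card_charRange : Nat.card (charRange σ) = Nat.card (Set.range σ) := by
  have h : Set.range σ = (Units.val : ℂˣ → ℂ) '' (charRange σ : Set ℂˣ) := by
    ext x
    constructor
    · rintro ⟨α, rfl⟩
      exact mem_charRange σ α
    · rintro ⟨u, hu, rfl⟩
      obtain ⟨α, hα⟩ := exists_of_mem_charRange σ hu
      exact ⟨α, hα.symm⟩
  rw [h, Nat.card_image_of_injective Units.val_injective]
  rfl

theorem char_pow_eq_one (α : G) {n : ℕ} (h : Nat.card (Set.range σ) ∣ n) : σ α ^ n = 1 := by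
  rw [← card_charRange] at h
  obtain ⟨u, hu, hα⟩ := mem_charRange σ α
  obtain ⟨k, rfl⟩ := h
  have h1 : (⟨u, hu⟩ : charRange σ) ^ Nat.card (charRange σ) = 1 := pow_card_eq_one'
  have h2 : (u : ℂ) ^ Nat.card (charRange σ) = 1 := by
    have h3 : u ^ Nat.card (charRange σ) = 1 := congrArg Subtype.val h1
    rw [← Units.val_pow_eq_pow_val, h3, Units.val_one]
  rw [← hα, pow_mul, h2, one_pow]

/-- Otherwise σ(G) lies in the n-th roots of unity, is finite cyclic, and the order of a generator
divides n. An infinite image has `Nat.card` equal to 0, which divides no positive n, so it is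
included. -/
theorem exists_char_pow_ne_one {n : ℕ} (hn : 0 < n) (h : ¬ Nat.card (Set.range σ) ∣ n) :
    ∃ α, σ α ^ n ≠ 1 := by
  by_contra! hall
  apply h
  have h1 : ∀ u ∈ charRange σ, u ^ n = 1 := by
    intro u hu
    obtain ⟨α, hα⟩ := exists_of_mem_charRange σ hu
    exact Units.ext (by rw [Units.val_pow_eq_pow_val, hα, hall]; rfl)
  have : NeZero n := ⟨hn.ne'⟩
  have hle : charRange σ ≤ rootsOfUnity n ℂ := fun u hu => (mem_rootsOfUnity n u).2 (h1 u hu)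
  have hfin : Finite (charRange σ) :=
    Finite.of_injective (Subgroup.inclusion hle) (Subgroup.inclusion_injective hle)
  obtain ⟨g, hg⟩ := IsCyclic.exists_generator (α := charRange σ)
  rw [← card_charRange, ← orderOf_eq_card_of_forall_mem_zpowers hg]
  exact orderOf_dvd_of_pow_eq_one (Subtype.ext (h1 g g.2))

end Character

/-! ## Heisenberg operators from the elementary subalgebra -/

section Heisenberg

variable {G : Type*} [AddCommGroup G] {σ : AddChar G ℂ} {ν : ℕ} {W : Submodule ℂ (Fock ν)}

/-- The commutator of Q_ij(a,n) with Q_ji(a⁻¹,0), both off-diagonal, is 2Q_ii(1,n) -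
2a^{-n}Q_jj(1,n), and Q_ii(1,n) = 4ε_i(n); since n ≠ 0 there is no central term. -/
theorem IsQuadStable.heis_sub_mem (hW : IsQuadStable σ W) {i j : Fin ν} (hij : i ≠ j) (α : G)
    {n : ℤ} (hn : n ≠ 0) {v : Fock ν} (hv : v ∈ W) :
    heis ν (Pi.single i 1) n v - (σ α)⁻¹ ^ n • heis ν (Pi.single j 1) n v ∈ W := by
  have ha := char_ne_zero σ α
  have h := quadOp_commutator (isNeutralFermion_fermion (ν := ν)) i j j i ha (inv_ne_zero ha) n 0 v
  have h1 : ∀ (i j : Fin ν), i ≠ j → ∀ α m v, v ∈ W →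
      quadOp (isNeutralFermion_fermion (ν := ν)) i j (σ α) m v ∈ W :=
    fun i j hij α m v hv => hW i j hij α m v hv
  have h2 : ∀ (i : Fin ν) (w : Fock ν), quadOp (isNeutralFermion_fermion (ν := ν)) i i 1 n w =
      (4 : ℂ) • heis ν (Pi.single i 1) n w := fun i w => quadMode_self_one i n w
  rw [if_pos rfl, if_neg hij, if_neg hij.symm, if_pos rfl, add_zero,
    if_neg (fun h => hn h.2.2.1), if_neg (fun h => hn h.2.2.1), mul_inv_cancel₀ ha, h2, h2,
    sub_self, mul_zero, zero_smul, zero_smul, sub_zero, add_zero, add_zero, zpow_zero,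
    mul_one] at h
  have h3 : quadOp (isNeutralFermion_fermion (ν := ν)) i j (σ α) n
      (quadOp isNeutralFermion_fermion j i (σ α)⁻¹ 0 v) -
      quadOp isNeutralFermion_fermion j i (σ α)⁻¹ 0
        (quadOp isNeutralFermion_fermion i j (σ α) n v) ∈ W := by
    rw [← char_neg]
    exact W.sub_mem (h1 _ _ hij _ _ _ (h1 _ _ hij.symm _ _ _ hv))
      (h1 _ _ hij.symm _ _ _ (h1 _ _ hij _ _ _ hv))
  rw [h] at h3
  have h4 := W.smul_mem (1 / 8 : ℂ) h3
  rw [smul_sub, smul_smul, smul_smul, smul_smul, smul_smul] at h4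
  convert h4 using 2
  · norm_num
  · congr 1
    ring

/-- The sign `s` treats creation and annihilation together. The trivial character value gives ε_i(n)
- ε_j(n); comparison with an α such that σ(α)^n ≠ 1 isolates ε_i(n) for N ∤ n. A second index is
available because ν ≥ 2. -/
theorem IsQuadStable.op_mem (hν : 2 ≤ ν) (hW : IsQuadStable σ W)
    (op : SymAlg ν →ₐ[ℂ] Module.End ℂ (Fock ν)) {s : ℤ} (hs : s = 1 ∨ s = -1)
    (hop : ∀ i (r : ℕ), heis ν (Pi.single i 1) (s * r) = op (oddVar i r)) {p : SymAlg ν}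
    (hp : p ∈ symZero ν (Nat.card (Set.range σ))) {v : Fock ν} (hv : v ∈ W) : op p v ∈ W := by
  have hgen : ∀ (i j : Fin ν), i ≠ j → ∀ (α : G) (n : ℕ), Odd n → ∀ v ∈ W,
      op (oddVar i n) v - (σ α)⁻¹ ^ (s * n) • op (oddVar j n) v ∈ W := by
    intro i j hij α n hn v hv
    rw [← hop, ← hop]
    refine hW.heis_sub_mem hij α ?_ hv
    have := hn.pos
    rcases hs with rfl | rfl <;> omega
  have hsub : ∀ (i j : Fin ν) (n : ℕ), i ≠ j → Odd n → ∀ v ∈ W,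
      op (oddVar i n - oddVar j n) v ∈ W := by
    intro i j n hij hn v hv
    have := hgen i j hij 0 n hn v hv
    rwa [AddChar.map_zero_eq_one, inv_one, one_zpow, one_smul, ← LinearMap.sub_apply,
      ← map_sub] at this
  refine symZero_induction (p := fun p => ∀ v ∈ W, op p v ∈ W) hsub ?_ ?_ ?_ ?_ hp v hv
  · intro i n hn hd v hv
    obtain ⟨α, hα⟩ := exists_char_pow_ne_one σ hn.pos hd
    obtain ⟨j, hij⟩ : ∃ j : Fin ν, j ≠ i := by
      have : Nontrivial (Fin ν) := Fin.nontrivial_iff_two_le.2 hν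
      exact exists_ne i
    have h1 := hgen j i hij α n hn v hv
    have h2 := hsub j i n hij hn v hv
    rw [map_sub, LinearMap.sub_apply] at h2
    have h3 := W.sub_mem h1 h2
    rw [sub_sub_sub_cancel_left] at h3
    have hc : 1 - (σ α)⁻¹ ^ (s * n) ≠ 0 := by
      rw [sub_ne_zero]
      rcases hs with rfl | rfl
      · rw [one_mul, inv_zpow, zpow_natCast]
        exact fun h => hα (inv_eq_one.1 h.symm)
      · rw [neg_mul, one_mul, zpow_neg, inv_zpow, inv_inv, zpow_natCast]
        exact hα.symm
    have h4 : op (oddVar i n) v - (σ α)⁻¹ ^ (s * n) • op (oddVar i n) v =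
        (1 - (σ α)⁻¹ ^ (s * n)) • op (oddVar i n) v := by rw [sub_smul, one_smul]
    rw [h4] at h3
    have h5 := W.smul_mem (1 - (σ α)⁻¹ ^ (s * n))⁻¹ h3
    rwa [smul_smul, inv_mul_cancel₀ hc, one_smul] at h5
  · intro c v hv
    rw [← MvPolynomial.algebraMap_eq, AlgHom.commutes, Module.algebraMap_end_apply]
    exact W.smul_mem c hv
  · intro x y hx hy v hv
    rw [map_add, LinearMap.add_apply]
    exact W.add_mem (hx v hv) (hy v hv)
  · intro x y _ _ hx hy v hv
    rw [map_mul, Module.End.mul_apply]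
    exact hx _ (hy v hv)

theorem IsQuadStable.mulOp_mem (hν : 2 ≤ ν) (hW : IsQuadStable σ W) {p : SymAlg ν}
    (hp : p ∈ symZero ν (Nat.card (Set.range σ))) {v : Fock ν} (hv : v ∈ W) : mulOp p v ∈ W :=
  hW.op_mem hν mulOp (Or.inr rfl) (fun i r => by rw [neg_mul, one_mul, heis_single_neg]) hp hv

theorem IsQuadStable.diffOp_mem (hν : 2 ≤ ν) (hW : IsQuadStable σ W) {p : SymAlg ν}
    (hp : p ∈ symZero ν (Nat.card (Set.range σ))) {v : Fock ν} (hv : v ∈ W) : diffOp p v ∈ W :=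
  hW.op_mem hν diffOp (Or.inl rfl) (fun i r => by rw [one_mul, heis_single_pos]) hp hv

end Heisenberg

/-! ## Lowering to the vacuum -/

section Lowering

variable {ν : ℕ}

/-- The component of an element of the Fock space along `e^a`. -/
def coordSym (a : GammaBar ν) : Fock ν →ₗ[ℂ] SymAlg ν :=
  TensorProduct.lift (lift (latticeCocycle ν) fun b => if b = a then LinearMap.id else 0)

theorem coordSym_e_tmul (a b : GammaBar ν) (p : SymAlg ν) :
    coordSym a (e (latticeCocycle ν) b ⊗ₜ p) = if b = a then p else 0 := by
  rw [coordSym, TensorProduct.lift.tmul, lift_e]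
  split_ifs <;> rfl

theorem fock_hom_ext_e {W : Type*} [AddCommGroup W] [Module ℂ W] {f g : Fock ν →ₗ[ℂ] W}
    (h : ∀ a p, f (e (latticeCocycle ν) a ⊗ₜ p) = g (e (latticeCocycle ν) a ⊗ₜ p)) : f = g := by
  refine TensorProduct.ext (TwistedAlgebra.hom_ext fun a => LinearMap.ext fun p => ?_)
  exact h a p

theorem sum_e_tmul_coordSym (v : Fock ν) :
    ∑ a, e (latticeCocycle ν) a ⊗ₜ[ℂ] coordSym a v = v := by
  have h : ∑ a, (TensorProduct.mk ℂ (GroupAlg ν) (SymAlg ν) (e (latticeCocycle ν) a)) ∘ₗ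
      coordSym a = LinearMap.id := by
    refine fock_hom_ext_e fun b p => ?_
    rw [LinearMap.sum_apply, Finset.sum_eq_single b]
    · rw [LinearMap.comp_apply, coordSym_e_tmul, if_pos rfl]
      rfl
    · intro a _ hab
      rw [LinearMap.comp_apply, coordSym_e_tmul, if_neg hab.symm, map_zero]
    · simp
  have := LinearMap.congr_fun h v
  rwa [LinearMap.sum_apply] at this

theorem coordSym_lTensor (a : GammaBar ν) (T : Module.End ℂ (SymAlg ν)) (v : Fock ν) :
    coordSym a (LinearMap.lTensor (GroupAlg ν) T v) = T (coordSym a v) := by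
  have h : coordSym a ∘ₗ LinearMap.lTensor (GroupAlg ν) T = T ∘ₗ coordSym a := by
    refine fock_hom_ext_e fun b p => ?_
    rw [LinearMap.comp_apply, LinearMap.comp_apply, LinearMap.lTensor_tmul, coordSym_e_tmul,
      coordSym_e_tmul]
    split_ifs
    · rfl
    · rw [map_zero]
  exact LinearMap.congr_fun h v

theorem coeff_coordSym_diffOp (a : GammaBar ν) (i : Fin ν) (k : ℕ) (m : Fin ν × ℕ →₀ ℕ)
    (v : Fock ν) : MvPolynomial.coeff m (coordSym a (diffOp (oddVar i (2 * k + 1)) v)) =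
      (((2 * k + 1 : ℕ) : ℂ) / 2) *
        (MvPolynomial.coeff (m + Finsupp.single (i, k) 1) (coordSym a v) * ((m (i, k) : ℂ) + 1)) := by
  rw [diffOp_oddVar, coordSym_lTensor, oddDer, if_pos (odd_two_mul_add_one k),
    show (2 * k + 1) / 2 = k by omega, ← MvPolynomial.coeff_pderiv]
  exact MvPolynomial.coeff_smul _ (((2 * k + 1 : ℕ) : ℂ) / 2)
    (MvPolynomial.pderiv (i, k) (coordSym a v))

/-- All components of the element have degree at most `d`. -/
def DegreeLE (d : ℕ) (v : Fock ν) : Prop :=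
  ∀ (a : GammaBar ν) (m : Fin ν × ℕ →₀ ℕ), d < m.degree → MvPolynomial.coeff m (coordSym a v) = 0

theorem DegreeLE.sub {d : ℕ} {v w : Fock ν} (hv : DegreeLE d v) (hw : DegreeLE d w) :
    DegreeLE d (v - w) := fun a m hm => by
  rw [map_sub, MvPolynomial.coeff_sub, hv a m hm, hw a m hm, sub_zero]

theorem DegreeLE.diffOp_oddVar {d : ℕ} {v : Fock ν} (hv : DegreeLE (d + 1) v) (i : Fin ν) (n : ℕ) :
    DegreeLE d (diffOp (oddVar i n) v) := by
  intro a m hm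
  rcases Nat.even_or_odd' n with ⟨k, rfl | rfl⟩
  · rw [oddVar, if_neg (by simp), map_zero, LinearMap.zero_apply, map_zero, MvPolynomial.coeff_zero]
  · rw [coeff_coordSym_diffOp, hv a _ (by rw [map_add, Finsupp.degree_single]; omega), zero_mul,
      mul_zero]

theorem exists_degreeLE (v : Fock ν) : ∃ d, DegreeLE d v := by
  refine ⟨∑ a, (coordSym a v).totalDegree, fun a m hm => ?_⟩
  refine MvPolynomial.coeff_eq_zero_of_totalDegree_lt (lt_of_le_of_lt ?_ hm)
  exact Finset.single_le_sum (f := fun a => (coordSym a v).totalDegree) (fun _ _ => Nat.zero_le _)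
    (Finset.mem_univ a)

theorem eq_tmul_one_of_degreeLE {v : Fock ν} (hv : DegreeLE 0 v) :
    ∃ g : GroupAlg ν, v = g ⊗ₜ 1 := by
  refine ⟨∑ a, MvPolynomial.coeff 0 (coordSym a v) • e (latticeCocycle ν) a, ?_⟩
  rw [TensorProduct.sum_tmul]
  conv_lhs => rw [← sum_e_tmul_coordSym v]
  refine Finset.sum_congr rfl fun a _ => ?_
  rw [TensorProduct.smul_tmul]
  congr 1
  rw [MvPolynomial.smul_eq_C_mul, mul_one]
  ext m
  rw [MvPolynomial.coeff_C]
  split_ifs with h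
  · rw [h]
  · refine hv a m (Nat.pos_of_ne_zero fun h0 => h ?_)
    exact ((Finsupp.degree_eq_zero_iff m).1 h0).symm

theorem degreeLE_zero_of_diffOp {v : Fock ν} (hv : ∀ i n, diffOp (oddVar i n) v = 0) :
    DegreeLE 0 v := by
  intro a m hm
  obtain ⟨⟨i, k⟩, hx⟩ : ∃ x, m x ≠ 0 := by
    by_contra! h
    rw [Finsupp.ext (g := 0) h, map_zero] at hm
    exact lt_irrefl _ hm
  have hle : Finsupp.single (i, k) 1 ≤ m := Finsupp.single_le_iff.2 (Nat.one_le_iff_ne_zero.2 hx)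
  have h1 := coeff_coordSym_diffOp a i k (m - Finsupp.single (i, k) 1) v
  rw [hv, map_zero, MvPolynomial.coeff_zero, tsub_add_cancel_of_le hle] at h1
  have h2 : (((2 * k + 1 : ℕ) : ℂ) / 2) ≠ 0 := div_ne_zero (Nat.cast_ne_zero.2 (by omega)) two_ne_zero
  have h3 : (((m - Finsupp.single (i, k) 1 : Fin ν × ℕ →₀ ℕ) (i, k) : ℕ) : ℂ) + 1 ≠ 0 :=
    Nat.cast_add_one_ne_zero _
  rcases mul_eq_zero.1 h1.symm with h | h
  · exact absurd h h2
  · exact (mul_eq_zero.1 h).resolve_right h3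

/-- For N ∣ n the derivation Σ_j ε_j(n) vanishes on the generators of S(H_0^-). -/
theorem sum_oddDer_symZero {N : ℕ} {n : ℕ} (hd : N ∣ n) {p : SymAlg ν}
    (hp : p ∈ symZero ν N) : ∑ j, oddDer j n p = 0 := by
  have hvar : ∀ (i : Fin ν) (r : ℕ), ∑ j, oddDer j n (oddVar i r) =
      if n = r ∧ Odd n then MvPolynomial.C ((n : ℂ) / 2) else 0 := by
    intro i r
    simp only [oddDer_oddVar]
    rw [Finset.sum_eq_single i]
    · simp
    · intro j _ hj
      rw [if_neg fun h => hj h.1]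
    · simp
  refine symZero_induction (p := fun p => ∑ j, oddDer j n p = 0) ?_ ?_ ?_ ?_ ?_ hp
  · intro i j r _ _
    simp only [map_sub, Finset.sum_sub_distrib, hvar, sub_self]
  · intro i r _ hr
    rw [hvar, if_neg]
    rintro ⟨rfl, -⟩
    exact hr hd
  · intro c
    simp only [← MvPolynomial.algebraMap_eq, Derivation.map_algebraMap, Finset.sum_const_zero]
  · intro x y hx hy
    simp only [map_add, Finset.sum_add_distrib, hx, hy, add_zero]
  · intro x y _ _ hx hy
    simp only [Derivation.leibniz, smul_eq_mul, Finset.sum_add_distrib, ← Finset.mul_sum, hx, hy,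
      mul_zero, add_zero]

theorem sum_diffOp_symZero {N : ℕ} {n : ℕ} (hd : N ∣ n) {U : Submodule ℂ (GroupAlg ν)}
    {v : Fock ν} (hv : v ∈ tensorSub ν U (symZero ν N).toSubmodule) :
    ∑ j, diffOp (oddVar j n) v = 0 := by
  have h : (∑ j, diffOp (oddVar j n)) v ∈ (⊥ : Submodule ℂ (Fock ν)) := by
    refine map_mem_of_tensorSub _ (fun g _ p hp => ?_) hv
    rw [Submodule.mem_bot, LinearMap.sum_apply]
    simp only [diffOp_oddVar_tmul]
    rw [← TensorProduct.tmul_sum, sum_oddDer_symZero hd hp, TensorProduct.tmul_zero]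
  rwa [Submodule.mem_bot, LinearMap.sum_apply] at h

/-- Descent on the degree by annihilators from H_0^-. A vector killed by all of them is killed by
ε_i(n) for N ∤ n; for N ∣ n the vectors ε_i(n)v all coincide and sum to zero, hence vanish. Such a
vector has degree zero. -/
theorem exists_tmul_one_mem {N : ℕ} {U : Submodule ℂ (GroupAlg ν)} {W : Submodule ℂ (Fock ν)}
    (hle : W ≤ tensorSub ν U (symZero ν N).toSubmodule)
    (hW : ∀ p ∈ symZero ν N, ∀ v ∈ W, diffOp p v ∈ W) {v : Fock ν} (hv : v ∈ W) (hv0 : v ≠ 0) :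
    ∃ g : GroupAlg ν, g ≠ 0 ∧ g ⊗ₜ 1 ∈ W := by
  have hconst : ∀ v ∈ W, v ≠ 0 → DegreeLE 0 v → ∃ g : GroupAlg ν, g ≠ 0 ∧ g ⊗ₜ 1 ∈ W := by
    intro v hv hv0 hd
    obtain ⟨g, rfl⟩ := eq_tmul_one_of_degreeLE hd
    refine ⟨g, ?_, hv⟩
    rintro rfl
    exact hv0 (TensorProduct.zero_tmul _ _)
  obtain ⟨d, hd⟩ := exists_degreeLE v
  induction d generalizing v with
  | zero => exact hconst v hv hv0 hd
  | succ d ih =>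
    by_cases h1 : ∃ i j n, diffOp (oddVar i n - oddVar j n) v ≠ 0
    · obtain ⟨i, j, n, h⟩ := h1
      refine ih (hW _ (oddVar_sub_mem_symZero N i j n) v hv) h ?_
      rw [map_sub, LinearMap.sub_apply]
      exact (hd.diffOp_oddVar i n).sub (hd.diffOp_oddVar j n)
    by_cases h2 : ∃ i n, ¬ N ∣ n ∧ diffOp (oddVar i n) v ≠ 0
    · obtain ⟨i, n, hn, h⟩ := h2
      exact ih (hW _ (oddVar_mem_symZero i hn) v hv) h (hd.diffOp_oddVar i n)
    push Not at h1 h2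
    refine hconst v hv hv0 (degreeLE_zero_of_diffOp fun i n => ?_)
    by_cases hn : N ∣ n
    · have h3 := sum_diffOp_symZero hn (hle hv)
      have h4 : ∀ j, diffOp (oddVar j n) v = diffOp (oddVar i n) v := by
        intro j
        have := h1 j i n
        rwa [map_sub, LinearMap.sub_apply, sub_eq_zero] at this
      simp only [h4, Finset.sum_const, Finset.card_univ, Fintype.card_fin] at h3
      rw [← Nat.cast_smul_eq_nsmul ℂ] at h3
      refine (smul_eq_zero.1 h3).resolve_left ?_
      have := i.pos
      exact_mod_cast this.ne'
    · exact h2 i n hn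

end Lowering

/-! ## Irreducibility -/

section Irreducible

variable {ν : ℕ}

/-- The component of an element of the Fock space in degree zero. -/
def constPart : Fock ν →ₗ[ℂ] GroupAlg ν :=
  (TensorProduct.rid ℂ (GroupAlg ν)).toLinearMap ∘ₗ LinearMap.lTensor (GroupAlg ν)
    (MvPolynomial.aeval (fun _ => (0 : ℂ))).toLinearMap

theorem constPart_tmul (g : GroupAlg ν) (p : SymAlg ν) :
    constPart (g ⊗ₜ p) = MvPolynomial.aeval (fun _ => (0 : ℂ)) p • g := by
  simp [constPart]

theorem constPart_mem {U : Submodule ℂ (GroupAlg ν)} {P : Submodule ℂ (SymAlg ν)} {v : Fock ν}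
    (hv : v ∈ tensorSub ν U P) : constPart v ∈ U :=
  map_mem_of_tensorSub constPart (fun g hg p _ => by
    rw [constPart_tmul]; exact U.smul_mem _ hg) hv

theorem constPart_tmul_one (g : GroupAlg ν) : constPart (g ⊗ₜ 1) = g := by
  rw [constPart_tmul, map_one, one_smul]

theorem convTau_tmul_one (i j : Fin ν) (a : ℤ → ℂ) {s : ℕ} (hs : s ≠ 0) (g : GroupAlg ν) :
    convTau i j a s (g ⊗ₜ 1) = 0 := by
  rw [convTau, LinearMap.sum_apply]
  refine Finset.sum_eq_zero fun p hp => ?_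
  have hp := Finset.HasAntidiagonal.mem_antidiagonal.1 hp
  rw [LinearMap.smul_apply, Module.End.mul_apply]
  by_cases h : p.2 = 0
  · rw [h, Nat.cast_zero, tau_zero, Module.End.one_apply, tau_tmul_one i (by omega), smul_zero]
  · rw [tau_tmul_one j (by omega), map_zero, smul_zero]

/-- On degree zero only the constant terms of the exponentials contribute to the zero mode, which
recovers the even Clifford action on the group algebra. -/
theorem quadMode_tmul_one {i j : Fin ν} (hij : i ≠ j) (g : GroupAlg ν) :
    quadMode fermion i j 1 0 (g ⊗ₜ 1) = (eps i * eps j * g) ⊗ₜ 1 := by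
  rw [quadMode_eq_bosonMode hij one_ne_zero, bosonMode,
    finsum_eq_single _ ⟨(0, 0), by simp⟩]
  · rw [coeff_expMinus_mul, coeff_expPlus_mul, convTau, convMul]
    simp [schurSeries, constantCoeff_formalExp, tau_zero]
  · rintro ⟨⟨r, s⟩, h⟩ hne
    have hs : s ≠ 0 := by
      rintro rfl
      refine hne (Subtype.ext (Prod.ext ?_ rfl))
      simp only at h ⊢
      omega
    rw [coeff_expPlus_mul, convTau_tmul_one i j _ hs, map_zero]

variable {G : Type*} [AddCommGroup G] {σ : AddChar G ℂ} {γ : Fin (ν / 2 + 1) → ℤˣ}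

theorem char_pow_of_odd (α : G) (n : ℕ) (_ : Odd n) (h : Nat.card (Set.range σ) ∣ n) :
    σ α ^ n = 1 := char_pow_eq_one σ α h

theorem isQuadStable_componentZero :
    IsQuadStable σ (componentZero ν (Nat.card (Set.range σ)) γ) := by
  intro i j hij α m v hv
  exact quadMode_mem hij (char_ne_zero σ α) (char_pow_of_odd α)
    (fun g hg => eps_mul_eps_mul_mem i j hg) m hv

/-- Lowering yields a vector g ⊗ 1, Clifford irreducibility spreads it to V ⊗ 1, and multiplication
by S(H_0^-) gives the rest. -/
theorem componentZero_le_of_isQuadStable (hν : 2 ≤ ν) {W : Submodule ℂ (Fock ν)}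
    (hle : W ≤ componentZero ν (Nat.card (Set.range σ)) γ) (hW : IsQuadStable σ W) (h0 : W ≠ ⊥) :
    componentZero ν (Nat.card (Set.range σ)) γ ≤ W := by
  obtain ⟨v, hv, hv0⟩ := Submodule.exists_mem_ne_zero_of_ne_bot h0
  obtain ⟨g, hg0, hg⟩ := exists_tmul_one_mem hle (fun p hp v hv => hW.diffOp_mem hν hp hv) hv hv0
  have hgV : g ∈ spinModule ν γ := by
    have := constPart_mem (hle hg)
    rwa [constPart_tmul_one] at this
  have hle1 : spinModule ν γ ≤ W.comap ((TensorProduct.mk ℂ (GroupAlg ν) (SymAlg ν)).flip 1) := by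
    refine spinModule_le (fun i j hij x hx => ?_) hgV hg0 hg
    change (eps i * eps j * x) ⊗ₜ 1 ∈ W
    rw [← quadMode_tmul_one hij, ← AddChar.map_zero_eq_one σ]
    exact hW i j hij 0 0 _ hx
  refine tensorSub_le.2 fun x hx p hp => ?_
  have := hW.mulOp_mem hν hp (hle1 hx)
  rwa [LinearMap.flip_apply, TensorProduct.mk_apply, mulOp_tmul, mul_one] at this

theorem componentZero_ne_bot (N : ℕ) : componentZero ν N γ ≠ ⊥ := by
  obtain ⟨v, hv, hv0⟩ := exists_ne_zero_mem_spinModule γ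
  intro h
  have h1 : v ⊗ₜ 1 ∈ componentZero ν N γ := tmul_mem_tensorSub hv (Subalgebra.one_mem _)
  rw [h, Submodule.mem_bot] at h1
  apply hv0
  rw [← constPart_tmul_one v, h1, map_zero]

variable {ρ : unitaryHat σ ν →ₗ⁅ℂ⁆ Module.End ℂ (Fock ν)}

theorem IsVertexRep.isIrreducibleSubrep_componentZero (hν : 2 ≤ ν) (hρ : IsVertexRep σ ν ρ) :
    IsIrreducibleSubrep ρ (elementaryHat σ ν) (componentZero ν (Nat.card (Set.range σ)) γ) := by
  refine ⟨(hρ.isSubrep_elementaryHat_iff _).2 isQuadStable_componentZero, componentZero_ne_bot _,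
    fun W hle hW => ?_⟩
  rw [hρ.isSubrep_elementaryHat_iff] at hW
  by_cases h0 : W = ⊥
  · exact Or.inl h0
  · exact Or.inr (le_antisymm hle (componentZero_le_of_isQuadStable hν hle hW h0))

theorem componentZero_le_component (N : ℕ) : componentZero ν N γ ≤ component ν γ :=
  Submodule.map₂_le_map₂_right le_top

theorem componentZero_eq_component {N : ℕ} (hN : Even N) : componentZero ν N γ = component ν γ := by
  rw [componentZero, symZero_eq_top hN, Algebra.top_toSubmodule, component]

theorem IsVertexRep.isSubrep_component (hρ : IsVertexRep σ ν ρ) : IsSubrep ρ ⊤ (component ν γ) := by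
  refine hρ.isSubrep_top fun i j α m v hv => ?_
  by_cases hij : i = j
  · subst hij
    exact quadMode_self_mem i (char_ne_zero σ α) m hv
  · rw [← componentZero_eq_component Even.zero] at hv ⊢
    refine quadMode_mem hij (char_ne_zero σ α) (fun n _ h0 => ?_)
      (fun g hg => eps_mul_eps_mul_mem i j hg) m hv
    rw [zero_dvd_iff.1 h0, pow_zero]

end Irreducible


/-! ## Sums of irreducible submodules -/

section Semisimple

variable {L M : Type*} [LieRing L] [LieAlgebra ℂ L] [AddCommGroup M] [Module ℂ M]
  (ρ : L →ₗ⁅ℂ⁆ Module.End ℂ M) (K : LieSubalgebra ℂ L)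

/-- The associative algebra generated by the operators of a Lie subalgebra. -/
abbrev envelope : Subalgebra ℂ (Module.End ℂ M) := Algebra.adjoin ℂ (ρ '' (K : Set L))

variable {ρ K}

/-- A stable subspace as a submodule over the associative envelope. -/
def IsSubrep.toSubmodule {W : Submodule ℂ M} (hW : IsSubrep ρ K W) :
    Submodule (envelope ρ K) M where
  carrier := W
  add_mem' := W.add_mem
  zero_mem' := W.zero_mem
  smul_mem' := by
    rintro ⟨a, ha⟩ w hw
    change a w ∈ W
    induction ha using Algebra.adjoin_induction generalizing w with
    | mem x hx =>
      obtain ⟨y, hy, rfl⟩ := hx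
      exact hW y hy w hw
    | algebraMap c =>
      rw [Module.algebraMap_end_apply]
      exact W.smul_mem c hw
    | add x y _ _ hx hy =>
      rw [LinearMap.add_apply]
      exact W.add_mem (hx hw) (hy hw)
    | mul x y _ _ hx hy =>
      rw [Module.End.mul_apply]
      exact hx (hy hw)

theorem isSubrep_restrictScalars (U : Submodule (envelope ρ K) M) :
    IsSubrep ρ K (U.restrictScalars ℂ) := fun x hx _ hw =>
  U.smul_mem ⟨ρ x, Algebra.subset_adjoin ⟨x, hx, rfl⟩⟩ hw

/-- Stable subspaces are the submodules over the associative envelope, so complete reducibility can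
be read off from the lattice of submodules. -/
theorem isIrreducibleSubrep_restrictScalars_iff (U : Submodule (envelope ρ K) M) :
    IsIrreducibleSubrep ρ K (U.restrictScalars ℂ) ↔ IsAtom U := by
  have hbot : ∀ U : Submodule (envelope ρ K) M, U.restrictScalars ℂ = ⊥ ↔ U = ⊥ := fun _ =>
    Submodule.restrictScalars_eq_bot_iff ..
  rw [isAtom_iff_le_of_ge]
  constructor
  · rintro ⟨-, h0, h⟩
    refine ⟨fun h' => h0 ((hbot _).2 h'), fun V hV hVU => ?_⟩
    rcases h (V.restrictScalars ℂ) hVU (isSubrep_restrictScalars V) with h1 | h1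
    · exact absurd ((hbot _).1 h1) hV
    · exact (Submodule.restrictScalars_injective ℂ _ _ h1).ge
  · rintro ⟨h0, h⟩
    refine ⟨isSubrep_restrictScalars U,
      fun h' => h0 ((hbot _).1 h'), fun V hV hs => ?_⟩
    by_cases hV0 : V = ⊥
    · exact Or.inl hV0
    · refine Or.inr (le_antisymm hV ?_)
      exact h hs.toSubmodule (fun h' => hV0 ((hbot _).2 h')) hV

/-- A sum of submodules that are irreducible or zero is completely reducible. -/
theorem isCompletelyReducibleSubrep_sSup {𝒯 : Set (Submodule ℂ M)}
    (h𝒯 : ∀ U ∈ 𝒯, U = ⊥ ∨ IsIrreducibleSubrep ρ K U) :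
    IsCompletelyReducibleSubrep ρ K (sSup 𝒯) := by
  set 𝒰 : Set (Submodule (envelope ρ K) M) :=
    {U | IsAtom U ∧ U.restrictScalars ℂ ∈ 𝒯} with h𝒰
  have hsup : ∀ s : Set (Submodule (envelope ρ K) M), (sSup s).restrictScalars ℂ =
      sSup ((fun U : Submodule (envelope ρ K) M => U.restrictScalars ℂ) '' s) := fun s =>
    map_sSup (Submodule.restrictScalarsLatticeHom ℂ (envelope ρ K) M) s
  have hW : (sSup 𝒰).restrictScalars ℂ = sSup 𝒯 := by
    rw [hsup]
    refine le_antisymm (sSup_le_sSup ?_) (sSup_le fun U hU => ?_)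
    · rintro _ ⟨U, hU, rfl⟩
      exact hU.2
    · rcases h𝒯 U hU with rfl | hirr
      · exact bot_le
      · exact le_sSup ⟨hirr.1.toSubmodule,
          ⟨(isIrreducibleSubrep_restrictScalars_iff hirr.1.toSubmodule).1 hirr, hU⟩, rfl⟩
  -- In the lattice of submodules a supremum of atoms is also the supremum of an independent family
  -- of atoms.
  obtain ⟨s, hind, hs, hatom⟩ := exists_sSupIndep_of_sSup_atoms (sSup 𝒰)
    (le_antisymm (sSup_le fun U hU => hU.1) (sSup_le_sSup fun U hU => ⟨le_sSup hU, hU.1⟩))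
  refine ⟨hW ▸ isSubrep_restrictScalars _,
    (fun U : Submodule (envelope ρ K) M => U.restrictScalars ℂ) '' s, ?_, ?_, ?_⟩
  · rintro _ ⟨U, hU, rfl⟩
    exact (isIrreducibleSubrep_restrictScalars_iff U).2 (hatom hU)
  · rintro _ ⟨U, hU, rfl⟩
    have h1 := hind hU
    rw [← Set.image_singleton, ← Set.image_sdiff (Submodule.restrictScalars_injective ℂ _ _), ← hsup,
      disjoint_iff]
    rw [disjoint_iff] at h1
    change U.restrictScalars ℂ ⊓ (sSup (s \ {U})).restrictScalars ℂ = ⊥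
    rw [← Submodule.restrictScalars_inf, h1]
    rfl
  · rw [← hsup, hs, hW]

end Semisimple

/-! ## Operators commuting with the elementary subalgebra -/

section Commuting

variable {ν : ℕ}

/-- The polynomials whose multiplication operators commute with the annihilation operators from
`S(H₀⁻)`. -/
def IsCentralPoly (N : ℕ) (b : SymAlg ν) : Prop :=
  ∀ q ∈ symZero ν N, ∀ v : Fock ν, diffOp q (mulOp b v) = mulOp b (diffOp q v)

theorem isCentralPoly_one (N : ℕ) : IsCentralPoly N (1 : SymAlg ν) := fun q _ v => by
  rw [map_one, Module.End.one_apply, Module.End.one_apply]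

theorem IsCentralPoly.mul {N : ℕ} {b b' : SymAlg ν} (hb : IsCentralPoly N b)
    (hb' : IsCentralPoly N b') : IsCentralPoly N (b * b') := fun q hq v => by
  rw [map_mul, Module.End.mul_apply, Module.End.mul_apply, hb q hq, hb' q hq]

/-- The element `∑ ε_i(-n)`. -/
def oddVarSum (n : ℕ) : SymAlg ν := ∑ i, oddVar i n

theorem oddDer_oddVarSum (i : Fin ν) (r n : ℕ) : oddDer i r (oddVarSum n) =
    if r = n ∧ Odd r then MvPolynomial.C ((r : ℂ) / 2) else 0 := by
  rw [oddVarSum, map_sum, Finset.sum_eq_single i]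
  · rw [oddDer_oddVar]
    simp
  · intro j _ hj
    rw [oddDer_oddVar, if_neg fun h => hj h.1.symm]
  · simp

/-- The commutator of ε_i(r) with Σ_j ε_j(-n) is a scalar that does not depend on i and vanishes
unless r = n. It cancels in ε_i(r) - ε_j(r), and cannot arise from ε_i(r) with N ∤ r. -/
theorem isCentralPoly_oddVarSum {N n : ℕ} (hn : N ∣ n) :
    IsCentralPoly N (oddVarSum n : SymAlg ν) := by
  have hcomm : ∀ (i : Fin ν) (r : ℕ) (v : Fock ν), diffOp (oddVar i r) (mulOp (oddVarSum n) v) =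
      mulOp (oddVarSum n) (diffOp (oddVar i r) v) + mulOp (oddDer i r (oddVarSum n)) v :=
    fun i r v => LinearMap.congr_fun (diffOp_oddVar_mul_mulOp i r (oddVarSum n)) v
  intro q hq
  refine symZero_induction (p := fun q => ∀ v : Fock ν, diffOp q (mulOp (oddVarSum n) v) =
    mulOp (oddVarSum n) (diffOp q v)) ?_ ?_ ?_ ?_ ?_ hq
  · intro i j r _ _ v
    rw [map_sub, LinearMap.sub_apply, LinearMap.sub_apply, hcomm, hcomm, oddDer_oddVarSum,
      oddDer_oddVarSum, add_sub_add_right_eq_sub, map_sub]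
  · intro i r _ hr v
    rw [hcomm, oddDer_oddVarSum, if_neg, map_zero, LinearMap.zero_apply, add_zero]
    rintro ⟨rfl, -⟩
    exact hr hn
  · intro c v
    rw [← MvPolynomial.algebraMap_eq, AlgHom.commutes, Module.algebraMap_end_apply,
      Module.algebraMap_end_apply, map_smul]
  · intro x y hx hy v
    rw [map_add, LinearMap.add_apply, LinearMap.add_apply, hx, hy, map_add]
  · intro x y _ _ hx hy v
    rw [map_mul, Module.End.mul_apply, Module.End.mul_apply, hy, hx]

theorem convTau_eq_zero {d : ℤ} {v : Fock ν} (hd : ∀ i s, d < s → tau i s v = 0) (i j : Fin ν)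
    (a : ℤ → ℂ) {s : ℕ} (hs : 2 * d < s) : convTau i j a s v = 0 := by
  rw [convTau, LinearMap.sum_apply]
  refine Finset.sum_eq_zero fun p hp => ?_
  have hp := Finset.HasAntidiagonal.mem_antidiagonal.1 hp
  rw [LinearMap.smul_apply, Module.End.mul_apply]
  by_cases h : d < p.2
  · rw [hd j _ h, map_zero, smul_zero]
  · rw [← Module.End.mul_apply, tau_comm, Module.End.mul_apply, hd i _ (by omega), map_zero,
      smul_zero]

/-- The modes are built from multiplications and from differential operators with symbols in
S(H_0^-); multiplication by `b` commutes with both. -/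
theorem mulOp_bosonMode {N : ℕ} {b : SymAlg ν} (hb : IsCentralPoly N b) (i j : Fin ν) {a : ℂ}
    (ha : ∀ n : ℕ, Odd n → N ∣ n → a ^ n = 1) (m : ℤ) (v : Fock ν) :
    bosonMode ν i j a m (mulOp b v) = mulOp b (bosonMode ν i j a m v) := by
  rw [bosonMode_eq_finsum, bosonMode_eq_finsum, map_finsum]
  · refine finsum_congr fun r => ?_
    have ha' : ∀ n : ℕ, Odd n → N ∣ n → a⁻¹ ^ n = 1 := fun n h1 h2 => by
      rw [inv_pow, ha n h1 h2, inv_one]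
    rw [hb _ (Subalgebra.smul_mem _ (convMul_mem_symZero i j ha' _) _), mulOp_comm]
  · obtain ⟨d, hd⟩ := exists_tau_eq_zero v
    refine Set.Finite.of_finite_image (f := fun r => r.1.2) ((Set.finite_Iic (2 * d).toNat).subset ?_) ?_
    · rintro _ ⟨r, hr, rfl⟩
      by_contra h
      refine hr ?_
      beta_reduce
      rw [← convTau_eq_diffOp, convTau_eq_zero hd, map_zero]
      simp only [Set.mem_Iic] at h
      omega
    · rintro ⟨⟨r, s⟩, h⟩ - ⟨⟨r', s'⟩, h'⟩ - heq
      simp only at heq h h'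
      refine Subtype.ext (Prod.ext ?_ heq)
      simp only
      omega

theorem mulOp_quadMode {N : ℕ} {b : SymAlg ν} (hb : IsCentralPoly N b) {i j : Fin ν} (hij : i ≠ j)
    {a : ℂ} (ha0 : a ≠ 0) (ha : ∀ n : ℕ, Odd n → N ∣ n → a ^ n = 1) (m : ℤ) (v : Fock ν) :
    quadMode fermion i j a m (mulOp b v) = mulOp b (quadMode fermion i j a m v) := by
  rw [quadMode_eq_bosonMode hij ha0, quadMode_eq_bosonMode hij ha0, mulOp_bosonMode hb i j ha,
    leftOp_mulOp]

variable {G : Type*} [AddCommGroup G] {σ : AddChar G ℂ} {γ : Fin (ν / 2 + 1) → ℤˣ}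

theorem IsQuadStable.map_mulOp {W : Submodule ℂ (Fock ν)} (hW : IsQuadStable σ W) {b : SymAlg ν}
    (hb : IsCentralPoly (Nat.card (Set.range σ)) b) : IsQuadStable σ (W.map (mulOp b)) := by
  rintro i j hij α m _ ⟨v, hv, rfl⟩
  rw [mulOp_quadMode hb hij (char_ne_zero σ α) (char_pow_of_odd α)]
  exact ⟨_, hW i j hij α m v hv, rfl⟩

theorem IsQuadStable.comap_mulOp {W : Submodule ℂ (Fock ν)} (hW : IsQuadStable σ W) {b : SymAlg ν}
    (hb : IsCentralPoly (Nat.card (Set.range σ)) b) : IsQuadStable σ (W.comap (mulOp b)) := by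
  intro i j hij α m v hv
  rw [Submodule.mem_comap] at hv ⊢
  rw [← mulOp_quadMode hb hij (char_ne_zero σ α) (char_pow_of_odd α)]
  exact hW i j hij α m _ hv

theorem IsQuadStable.inf {W W' : Submodule ℂ (Fock ν)} (hW : IsQuadStable σ W)
    (hW' : IsQuadStable σ W') : IsQuadStable σ (W ⊓ W') := fun i j hij α m v hv =>
  ⟨hW i j hij α m v hv.1, hW' i j hij α m v hv.2⟩

variable {ρ : unitaryHat σ ν →ₗ⁅ℂ⁆ Module.End ℂ (Fock ν)}

/-- Multiplication by `b` is an endomorphism of the module over the elementary subalgebra, and a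
homomorphic image of an irreducible module is irreducible or zero. -/
theorem IsVertexRep.isIrreducibleSubrep_map (hρ : IsVertexRep σ ν ρ) {W : Submodule ℂ (Fock ν)}
    (hW : IsIrreducibleSubrep ρ (elementaryHat σ ν) W) {b : SymAlg ν}
    (hb : IsCentralPoly (Nat.card (Set.range σ)) b) :
    W.map (mulOp b) = ⊥ ∨ IsIrreducibleSubrep ρ (elementaryHat σ ν) (W.map (mulOp b)) := by
  by_cases h0 : W.map (mulOp b) = ⊥
  · exact Or.inl h0
  obtain ⟨h1, -, h2⟩ := hW
  simp only [hρ.isSubrep_elementaryHat_iff] at h1 h2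
  refine Or.inr ⟨(hρ.isSubrep_elementaryHat_iff _).2 (h1.map_mulOp hb), h0, fun V hV hs => ?_⟩
  rw [hρ.isSubrep_elementaryHat_iff] at hs
  have hmap : (W ⊓ V.comap (mulOp b)).map (mulOp b) = V := by
    refine le_antisymm ?_ fun x hx => ?_
    · rintro _ ⟨w, hw, rfl⟩
      exact hw.2
    · obtain ⟨w, hw, rfl⟩ := hV hx
      exact ⟨w, ⟨hw, hx⟩, rfl⟩
  rcases h2 _ inf_le_left (h1.inf (hs.comap_mulOp hb)) with h3 | h3
  · left
    rw [← hmap, h3, Submodule.map_bot]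
  · right
    rw [← hmap, h3]

/-- If N ∣ n, then ε_i(-n) is ν⁻¹ times the sum of Σ_j (ε_i(-n) - ε_j(-n)), which lies in S(H_0^-),
and Σ_j ε_j(-n), which is central. So each variable of `p` can be moved into `q` or into `b`. -/
theorem tmul_mem_sSup_map {N : ℕ} {U : Submodule ℂ (GroupAlg ν)} {g : GroupAlg ν} (hg : g ∈ U)
    (p : SymAlg ν) {b q : SymAlg ν} (hb : IsCentralPoly N b) (hq : q ∈ symZero ν N) :
    g ⊗ₜ (p * (b * q)) ∈ sSup {W | ∃ b : SymAlg ν, IsCentralPoly N b ∧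
      W = (tensorSub ν U (symZero ν N).toSubmodule).map (mulOp b)} := by
  set S := sSup {W | ∃ b : SymAlg ν, IsCentralPoly N b ∧
      W = (tensorSub ν U (symZero ν N).toSubmodule).map (mulOp b)} with hS
  induction p using MvPolynomial.induction_on generalizing b q with
  | C c =>
    rw [← MvPolynomial.smul_eq_C_mul, TensorProduct.tmul_smul]
    have hle : (tensorSub ν U (symZero ν N).toSubmodule).map (mulOp b) ≤ S := le_sSup ⟨b, hb, rfl⟩
    exact S.smul_mem c (hle ⟨g ⊗ₜ q, tmul_mem_tensorSub hg hq, mulOp_tmul _ _ _⟩)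
  | add p p' hp hp' =>
    rw [add_mul, TensorProduct.tmul_add]
    exact S.add_mem (hp hb hq) (hp' hb hq)
  | mul_X p x hp =>
    obtain ⟨i, k⟩ := x
    rw [← oddVar_two_mul_add_one]
    by_cases hd : N ∣ 2 * k + 1
    · have hν : (ν : ℂ) ≠ 0 := Nat.cast_ne_zero.2 i.pos.ne'
      have h1 : oddVar i (2 * k + 1) = (ν : ℂ)⁻¹ • ((∑ j, (oddVar i (2 * k + 1) -
          oddVar j (2 * k + 1))) + oddVarSum (2 * k + 1)) := by
        rw [Finset.sum_sub_distrib, oddVarSum, sub_add_cancel, Finset.sum_const, Finset.card_univ,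
          Fintype.card_fin, ← Nat.cast_smul_eq_nsmul ℂ, smul_smul, inv_mul_cancel₀ hν, one_smul]
      have h2 : p * oddVar i (2 * k + 1) * (b * q) = (ν : ℂ)⁻¹ •
          (p * (b * ((∑ j, (oddVar i (2 * k + 1) - oddVar j (2 * k + 1))) * q)) +
            p * ((b * oddVarSum (2 * k + 1)) * q)) := by
        conv_lhs => rw [h1]
        rw [mul_smul_comm, smul_mul_assoc]
        congr 1
        ring
      rw [h2, TensorProduct.tmul_smul, TensorProduct.tmul_add]
      refine S.smul_mem _ (S.add_mem (hp hb ?_) (hp (hb.mul (isCentralPoly_oddVarSum hd)) hq))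
      exact Subalgebra.mul_mem _ (Subalgebra.sum_mem _ fun j _ => oddVar_sub_mem_symZero N i j _) hq
    · have h2 : p * oddVar i (2 * k + 1) * (b * q) = p * (b * (oddVar i (2 * k + 1) * q)) := by ring
      rw [h2]
      exact hp hb (Subalgebra.mul_mem _ (oddVar_mem_symZero i hd) hq)

theorem sSup_map_componentZero (N : ℕ) : sSup {W | ∃ b : SymAlg ν, IsCentralPoly N b ∧
    W = (componentZero ν N γ).map (mulOp b)} = component ν γ := by
  refine le_antisymm (sSup_le ?_) (tensorSub_le.2 fun g hg p _ => ?_)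
  · rintro _ ⟨b, -, rfl⟩
    rw [Submodule.map_le_iff_le_comap]
    refine tensorSub_le.2 fun g hg p _ => ?_
    rw [Submodule.mem_comap, mulOp_tmul]
    exact tmul_mem_tensorSub hg Submodule.mem_top
  · have h := tmul_mem_sSup_map hg p (isCentralPoly_one N) (Subalgebra.one_mem (symZero ν N))
    rwa [mul_one, mul_one] at h

theorem IsVertexRep.isCompletelyReducibleSubrep_component (hν : 2 ≤ ν) (hρ : IsVertexRep σ ν ρ) :
    IsCompletelyReducibleSubrep ρ (elementaryHat σ ν) (component ν γ) := by
  rw [← sSup_map_componentZero (Nat.card (Set.range σ))]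
  refine isCompletelyReducibleSubrep_sSup ?_
  rintro _ ⟨b, hb, rfl⟩
  exact hρ.isIrreducibleSubrep_map (hρ.isIrreducibleSubrep_componentZero hν) hb

end Commuting

end VertexUnitary
end

open VertexUnitary in
theorem theorem4p4 {G : Type*} [AddCommGroup G] (σ : AddChar G ℂ) (ν : ℕ) (hν : 2 ≤ ν) :
    (∃ ρ : unitaryHat σ ν →ₗ⁅ℂ⁆ Module.End ℂ (Fock ν), IsVertexRep σ ν ρ) ∧
    ∀ ρ : unitaryHat σ ν →ₗ⁅ℂ⁆ Module.End ℂ (Fock ν), IsVertexRep σ ν ρ →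
      ∀ γ : Fin (ν / 2 + 1) → ℤˣ,
        IsSubrep ρ ⊤ (component ν γ) ∧
        ((Set.range σ).Infinite ∨ Even (Nat.card (Set.range σ)) →
          IsIrreducibleSubrep ρ (elementaryHat σ ν) (component ν γ)) ∧
        (Odd (Nat.card (Set.range σ)) →
          componentZero ν (Nat.card (Set.range σ)) γ ≤ component ν γ ∧
          IsIrreducibleSubrep ρ (elementaryHat σ ν)
            (componentZero ν (Nat.card (Set.range σ)) γ) ∧
          IsCompletelyReducibleSubrep ρ (elementaryHat σ ν) (component ν γ)) := by
  refine ⟨⟨_, isVertexRep_fermionRep σ ν⟩, fun ρ hρ γ => ⟨hρ.isSubrep_component, fun h => ?_,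
    fun _ => ⟨componentZero_le_component _, hρ.isIrreducibleSubrep_componentZero hν,
      hρ.isCompletelyReducibleSubrep_component hν⟩⟩⟩
  have hN : Even (Nat.card (Set.range σ)) := by
    rcases h with h | h
    -- An infinite image counts as cardinality 0, an even number.
    · rw [@Nat.card_eq_zero_of_infinite _ h.to_subtype]
      exact Even.zero
    · exact h
  rw [← componentZero_eq_component hN]
  exact hρ.isIrreducibleSubrep_componentZero hν
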